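/- Notation. Let $A$ be a C*-algebra and let $\mathbb K$ be the compact operators on a separable infinite-dimensional Hilbert space; identify $A$ with $A\otimes e_{1,1}\subset A\otimes\mathbb K$. $\mathrm{Ped}(B)$ denotes the Pedersen ideal (the smallest dense two-sided ideal) of a C*-algebra $B$; $\mathrm{Her}(a)$ is the hereditary C*-subalgebra of $A\otimes\mathbb K$ generated by $a\in (A\otimes\mathbb K)_+$; $S_+$ and $S_+^1$ denote the sets of positive elements, respectively of positive elements of norm at most $1$, of $S$. For $\varepsilon>0$, $f_\varepsilon:\mathbb R\to[0,1]$ is $0$ on $(-\infty,\varepsilon]$, $1$ on $[2\varepsilon,\infty)$ and linear on $[\varepsilon,2\varepsilon]$. A quasitrace on a pre-C*-algebra $P$ is a map $\tau:P\to\mathbb C$ with $\tau(x^*x)=\tau(xx^*)\ge 0$ for all $x$, linear on commutative *-subalgebras, and with $\tau(a+ib)=\tau(a)+i\tau(b)$ for self-adjoint $a,b$; it is a 2-quasitrace if it extends to a quasitrace on $M_2(P)$ (with $x$ identified with $x\otimes e_{1,1}$). Let $\widetilde{\mathrm{QT}}(A)$ be the set of 2-quasitraces on $\mathrm{Ped}(A\otimes\mathbb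 K)$ with the topology of pointwise convergence, let $\mathrm{QT}(A)$ be the set of those $\tau$ with $\sup\{|\tau(b)|: b\in \mathrm{Ped}(A)_+^1\}=1$, and let $\overline{\mathrm{QT}(A)}^w$ be its closure in $\widetilde{\mathrm{QT}}(A)$. For $a\in(A\otimes\mathbb K)_+$ put $d_\tau(a)=\lim_n\tau(f_{1/n}(a))\in[0,\infty]$ and $$\omega(a)=\lim_{n\to\infty}\sup\{d_\tau(a)-\tau(f_{1/n}(a)):\tau\in\overline{\mathrm{QT}(A)}^w\};$$ for $x\in A\otimes\mathbb K$ put $\|x\|_2=\sup\{\tau((x^*x-\varepsilon)_+)^{1/2}:\varepsilon>0,\ \tau\in\overline{\mathrm{QT}(A)}^w\}$. The algebra $A$ has tracial approximate oscillation zero if for every $a\in\mathrm{Ped}(A\otimes\mathbb K)_+$ and every $\varepsilon>0$ there is $c\in\mathrm{Her}(a)_+$ with $\|a-c\|_2<\varepsilon$, $\|c\|\le\|a\|$ and $\omega(c)<\varepsilon$. Theorem. Let $A$ be a $\sigma$-unital algebraically simple C*-algebra with $\mathrm{QT}(A)\ne\emptyset$. Then the following are equivalent: (i) $A$ has tracial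 approximate oscillation zero. (ii) For all $e\in\mathrm{Ped}(A\otimes\mathbb K)_+$ and all $\varepsilon>0$ there is a sequence of mutually orthogonal elements $b_n\in\mathrm{Her}(e)_+^1$ such that $\sum_{n=1}^\infty\omega(b_n)<\varepsilon$ and $d_\tau(e)-\sum_{n=1}^\infty\tau(b_n)<\varepsilon$ for all $\tau\in\overline{\mathrm{QT}(A)}^w$. (iii) For all $e\in\mathrm{Ped}(A\otimes\mathbb K)_+$ and all $\varepsilon>0$ there is a sequence of mutually orthogonal elements $b_n\in\mathrm{Her}(e)_+^1$ such that $\sum_{n=1}^\infty\omega(b_n)<\varepsilon$ and $d_\tau(e)-\sum_{n=1}^\infty d_\tau(b_n)<\varepsilon$ for all $\tau\in\overline{\mathrm{QT}(A)}^w$. -/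

import Mathlib

open Filter Topology
open scoped ENNReal ComplexOrder

noncomputable section

namespace CStarStab

universe u

section Stabilization

variable (A : Type u) [NonUnitalCStarAlgebra A]

/-- The square matrices `M_n(A)`, a C⋆-algebra. -/
abbrev Mat (n : ℕ) : Type u := CStarMatrix (Fin n) (Fin n) A

variable {A} in
/-- The matrix `x ⊕ 0`, with entries `0` in the last row and in the last column. -/
def padFun {n : ℕ} (x : Mat A n) : Mat A (n + 1) :=
  CStarMatrix.ofMatrix fun i j =>
    if h : i.val < n ∧ j.val < n then x ⟨i, h.1⟩ ⟨j, h.2⟩ else 0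

variable {A} in
@[simp] theorem padFun_castSucc_castSucc {n : ℕ} (x : Mat A n) (i j : Fin n) :
    padFun x i.castSucc j.castSucc = x i j :=
  dif_pos (c := i.val < n ∧ j.val < n) ⟨i.2, j.2⟩

variable {A} in
@[simp] theorem padFun_last_left {n : ℕ} (x : Mat A n) (j : Fin (n + 1)) :
    padFun x (Fin.last n) j = 0 :=
  dif_neg (c := n < n ∧ j.val < n) fun h => lt_irrefl n h.1

variable {A} in
@[simp] theorem padFun_last_right {n : ℕ} (x : Mat A n) (i : Fin (n + 1)) :
    padFun x i (Fin.last n) = 0 :=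
  dif_neg (c := i.val < n ∧ n < n) fun h => lt_irrefl n h.2

variable {A} in
/-- The corner embedding `M_n(A) → M_{n+1}(A)`, `x ↦ x ⊕ 0`. -/
def pad (n : ℕ) : Mat A n →⋆ₙₐ[ℂ] Mat A (n + 1) where
  toFun := padFun
  map_smul' c x := by
    ext i j
    induction i using Fin.lastCases <;> induction j using Fin.lastCases <;> simp
  map_zero' := by
    ext i j
    induction i using Fin.lastCases <;> induction j using Fin.lastCases <;> simp
  map_add' x y := by
    ext i j
    induction i using Fin.lastCases <;> induction j using Fin.lastCases <;> simp
  map_mul' x y := by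
    ext i j
    induction i using Fin.lastCases <;> induction j using Fin.lastCases <;>
      simp [CStarMatrix.mul_apply, Fin.sum_univ_castSucc]
  map_star' x := by
    ext i j
    induction i using Fin.lastCases <;> induction j using Fin.lastCases <;>
      simp [CStarMatrix.star_apply]

variable {A} in
theorem pad_injective (n : ℕ) : Function.Injective (pad (A := A) n) := by
  intro x y h
  ext i j
  rw [← padFun_castSucc_castSucc x, ← padFun_castSucc_castSucc y]
  exact congrFun (congrFun h i.castSucc) j.castSucc

variable {A} in
/-- The `n × n` matrix with upper left entry `a` and all other entries `0`. -/
def cornerMat (n : ℕ) (a : A) : Mat A n :=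
  CStarMatrix.ofMatrix fun i j => if i.val = 0 ∧ j.val = 0 then a else 0

variable {A} in
theorem cornerMat_apply (n : ℕ) (a : A) (i j : Fin n) :
    cornerMat n a i j = if i.val = 0 ∧ j.val = 0 then a else 0 := rfl

variable {A} in
theorem cornerMat_mul (n : ℕ) (a b : A) :
    cornerMat n (a * b) = cornerMat n a * cornerMat n b := by
  ext i j
  cases n with
  | zero => exact i.elim0
  | succ n =>
    rw [CStarMatrix.mul_apply, Fin.sum_univ_succ]
    simp only [cornerMat_apply, Fin.val_succ]
    by_cases hi : i.val = 0 <;> by_cases hj : j.val = 0 <;> simp [hi, hj]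

variable [PartialOrder A] [StarOrderedRing A]

/-- The sequences `(x_n)` with `x_n ∈ M_n(A)` and `x_{n+1} = x_n ⊕ 0` for all large `n`. -/
def finMatSubalgebra : NonUnitalStarSubalgebra ℂ (∀ n : ℕ, Mat A n) where
  carrier := {x | ∀ᶠ n in atTop, x (n + 1) = pad n (x n)}
  add_mem' {x y} hx hy := by
    filter_upwards [hx, hy] with n h1 h2
    simp [h1, h2]
  zero_mem' := by simp
  mul_mem' {x y} hx hy := by
    filter_upwards [hx, hy] with n h1 h2
    simp [h1, h2]
  smul_mem' c x hx := by
    filter_upwards [hx] with n h1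
    simp [h1]
  star_mem' {x} hx := by
    filter_upwards [hx] with n h1
    simp [h1, map_star]

/-- The algebraic inductive limit of `M_1(A) → M_2(A) → ⋯`, up to the null sequences of
the seminorm below. -/
def FinMat : Type u := finMatSubalgebra A

instance : NonUnitalRing (FinMat A) := inferInstanceAs (NonUnitalRing (finMatSubalgebra A))
instance : StarRing (FinMat A) := inferInstanceAs (StarRing (finMatSubalgebra A))
instance : Module ℂ (FinMat A) := inferInstanceAs (Module ℂ (finMatSubalgebra A))
instance : IsScalarTower ℂ (FinMat A) (FinMat A) :=
  inferInstanceAs (IsScalarTower ℂ (finMatSubalgebra A) (finMatSubalgebra A))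
instance : SMulCommClass ℂ (FinMat A) (FinMat A) :=
  inferInstanceAs (SMulCommClass ℂ (finMatSubalgebra A) (finMatSubalgebra A))
instance : StarModule ℂ (FinMat A) := inferInstanceAs (StarModule ℂ (finMatSubalgebra A))

variable {A}

/-- The `n`-th entry of the sequence. -/
def FinMat.entry (n : ℕ) (x : FinMat A) : Mat A n := x.1 n

@[simp] theorem FinMat.entry_add (n : ℕ) (x y : FinMat A) :
    (x + y).entry n = x.entry n + y.entry n := rfl
@[simp] theorem FinMat.entry_zero (n : ℕ) : (0 : FinMat A).entry n = 0 := rfl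
@[simp] theorem FinMat.entry_neg (n : ℕ) (x : FinMat A) : (-x).entry n = -x.entry n := rfl
@[simp] theorem FinMat.entry_mul (n : ℕ) (x y : FinMat A) :
    (x * y).entry n = x.entry n * y.entry n := rfl
@[simp] theorem FinMat.entry_smul (n : ℕ) (c : ℂ) (x : FinMat A) :
    (c • x).entry n = c • x.entry n := rfl
@[simp] theorem FinMat.entry_star (n : ℕ) (x : FinMat A) :
    (star x).entry n = star (x.entry n) := rfl

theorem FinMat.eventually_norm_eq (x : FinMat A) :
    ∃ r : ℝ, ∀ᶠ n in atTop, ‖x.entry n‖ = r := by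
  obtain ⟨N, hN⟩ := eventually_atTop.1 (show ∀ᶠ n in atTop, x.1 (n + 1) = pad n (x.1 n) from x.2)
  refine ⟨‖x.entry N‖, eventually_atTop.2 ⟨N, fun n hn => ?_⟩⟩
  induction n, hn using Nat.le_induction with
  | base => rfl
  | succ n hn ih =>
    rw [← ih]
    show ‖x.1 (n + 1)‖ = ‖x.1 n‖
    rw [hN n hn]
    exact NonUnitalStarAlgHom.norm_map (pad n) (pad_injective n) _

/-- The seminorm `lim_n ‖x_n‖`; the sequence of norms is eventually constant. -/
instance : Norm (FinMat A) := ⟨fun x => limUnder atTop fun n => ‖x.entry n‖⟩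

theorem FinMat.norm_eq (x : FinMat A) : ∀ᶠ n in atTop, ‖x.entry n‖ = ‖x‖ := by
  obtain ⟨r, hr⟩ := x.eventually_norm_eq
  have : ‖x‖ = r := (tendsto_const_nhds.congr' (hr.mono fun _ h => h.symm)).limUnder_eq
  rwa [this]

instance : NonUnitalSeminormedRing (FinMat A) :=
  { (inferInstance : NonUnitalRing (FinMat A)),
    SeminormedAddCommGroup.ofCore (𝕜 := ℂ) (E := FinMat A)
      { norm_nonneg := fun x => by
          obtain ⟨n, h⟩ := x.norm_eq.exists
          rw [← h]; exact norm_nonneg _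
        norm_smul := fun c x => by
          obtain ⟨n, h1, h2⟩ := (x.norm_eq.and (c • x).norm_eq).exists
          rw [← h1, ← h2, FinMat.entry_smul, norm_smul]
        norm_triangle := fun x y => by
          obtain ⟨n, ⟨h1, h2⟩, h3⟩ := ((x.norm_eq.and y.norm_eq).and (x + y).norm_eq).exists
          rw [← h1, ← h2, ← h3]; exact norm_add_le _ _ } with
    norm_mul_le := fun x y => by
      obtain ⟨n, ⟨h1, h2⟩, h3⟩ := ((x.norm_eq.and y.norm_eq).and (x * y).norm_eq).exists
      rw [← h1, ← h2, ← h3]; exact norm_mul_le _ _ }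

instance : NormedSpace ℂ (FinMat A) where
  norm_smul_le c x := by
    obtain ⟨n, h1, h2⟩ := (x.norm_eq.and (c • x).norm_eq).exists
    rw [← h1, ← h2, FinMat.entry_smul, norm_smul]

instance : NormedStarGroup (FinMat A) where
  norm_star_le x := by
    obtain ⟨n, h1, h2⟩ := (x.norm_eq.and (star x).norm_eq).exists
    rw [← h1, ← h2, FinMat.entry_star, norm_star]

theorem FinMat.norm_mul_self_le (x : FinMat A) : ‖x‖ * ‖x‖ ≤ ‖star x * x‖ := by
  obtain ⟨n, h1, h2⟩ := (x.norm_eq.and (star x * x).norm_eq).exists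
  rw [← h1, ← h2, FinMat.entry_mul, FinMat.entry_star, CStarRing.norm_star_mul_self]

variable (A) in
/-- The stabilization `A ⊗ 𝕂`, as the C⋆-inductive limit of `M_n(A)` along `x ↦ x ⊕ 0`: the
(Hausdorff) completion of the algebraic inductive limit. -/
def Stab : Type u := UniformSpace.Completion (FinMat A)

instance : NormedAddCommGroup (Stab A) :=
  inferInstanceAs (NormedAddCommGroup (UniformSpace.Completion (FinMat A)))
instance : NormedSpace ℂ (Stab A) :=
  inferInstanceAs (NormedSpace ℂ (UniformSpace.Completion (FinMat A)))
instance : CompleteSpace (Stab A) :=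
  inferInstanceAs (CompleteSpace (UniformSpace.Completion (FinMat A)))

/-- The canonical map of the algebraic inductive limit into `A ⊗ 𝕂`. -/
def toStab : FinMat A →ₗᵢ[ℂ] Stab A := UniformSpace.Completion.toComplₗᵢ

theorem denseRange_toStab : DenseRange (toStab (A := A)) :=
  UniformSpace.Completion.denseRange_coe

theorem isDenseInducing_toStab : IsDenseInducing (toStab (A := A)) :=
  UniformSpace.Completion.isDenseInducing_coe

instance : Mul (Stab A) :=
  ⟨Function.curry <| (isDenseInducing_toStab.prodMap isDenseInducing_toStab).extend
    (toStab ∘ Function.uncurry (· * ·))⟩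

theorem toStab_mul (x y : FinMat A) : toStab (x * y) = toStab x * toStab y :=
  ((isDenseInducing_toStab.prodMap isDenseInducing_toStab).extend_eq
      (toStab.continuous.comp (continuous_mul (M := FinMat A))) (x, y)).symm

theorem continuous_mul_stab : Continuous fun p : Stab A × Stab A => p.1 * p.2 := by
  let m := (AddMonoidHom.mul : FinMat A →+ FinMat A →+ FinMat A).compr₂
    (toStab (A := A)).toLinearMap.toAddMonoidHom
  have h : Continuous fun p : FinMat A × FinMat A => m p.1 p.2 :=
    toStab.continuous.comp (continuous_mul (M := FinMat A))
  have di : IsDenseInducing (toStab (A := A)).toLinearMap.toAddMonoidHom := isDenseInducing_toStab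
  exact di.extend_Z_bilin di h

instance : ContinuousMul (Stab A) := ⟨continuous_mul_stab⟩

instance : Star (Stab A) := ⟨UniformSpace.Completion.map (star : FinMat A → FinMat A)⟩

instance : ContinuousStar (Stab A) :=
  ⟨UniformSpace.Completion.continuous_map (f := fun x : FinMat A => star x)⟩

theorem toStab_star (x : FinMat A) : toStab (star x) = star (toStab x) :=
  (UniformSpace.Completion.map_coe (f := (star : FinMat A → FinMat A))
    star_isometry.uniformContinuous x).symm

theorem Stab.induction₁ {p : Stab A → Prop} (hp : IsClosed {x | p x})
    (ih : ∀ x, p (toStab x)) (x : Stab A) : p x :=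
  denseRange_toStab.induction_on x hp ih

theorem Stab.induction₂ {p : Stab A → Stab A → Prop} (hp : IsClosed {x : Stab A × Stab A | p x.1 x.2})
    (ih : ∀ x y, p (toStab x) (toStab y)) (x y : Stab A) : p x y :=
  denseRange_toStab.induction_on₂ hp ih x y

theorem Stab.induction₃ {p : Stab A → Stab A → Stab A → Prop}
    (hp : IsClosed {x : Stab A × Stab A × Stab A | p x.1 x.2.1 x.2.2})
    (ih : ∀ x y z, p (toStab x) (toStab y) (toStab z)) (x y z : Stab A) : p x y z :=
  denseRange_toStab.induction_on₃ hp ih x y z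

instance : NonUnitalNormedRing (Stab A) :=
  { (inferInstance : NormedAddCommGroup (Stab A)), (inferInstance : Mul (Stab A)) with
    zero_mul := Stab.induction₁ (isClosed_eq (by fun_prop) (by fun_prop)) fun x => by
      rw [← map_zero toStab, ← toStab_mul, zero_mul]
    mul_zero := Stab.induction₁ (isClosed_eq (by fun_prop) (by fun_prop)) fun x => by
      rw [← map_zero toStab, ← toStab_mul, mul_zero]
    mul_assoc := Stab.induction₃ (isClosed_eq (by fun_prop) (by fun_prop)) fun x y z => by
      simp only [← toStab_mul, mul_assoc]
    left_distrib := Stab.induction₃ (isClosed_eq (by fun_prop) (by fun_prop)) fun x y z => by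
      simp only [← toStab_mul, ← map_add, mul_add]
    right_distrib := Stab.induction₃ (isClosed_eq (by fun_prop) (by fun_prop)) fun x y z => by
      simp only [← toStab_mul, ← map_add, add_mul]
    norm_mul_le := Stab.induction₂ (isClosed_le (by fun_prop) (by fun_prop)) fun x y => by
      simp only [← toStab_mul, LinearIsometry.norm_map, norm_mul_le] }

instance : StarRing (Stab A) where
  star_involutive := Stab.induction₁ (isClosed_eq (by fun_prop) (by fun_prop)) fun x => by
    simp only [← toStab_star, star_star]
  star_mul := Stab.induction₂ (isClosed_eq (by fun_prop) (by fun_prop)) fun x y => by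
    simp only [← toStab_star, ← toStab_mul, star_mul]
  star_add := Stab.induction₂ (isClosed_eq (by fun_prop) (by fun_prop)) fun x y => by
    simp only [← toStab_star, ← map_add, star_add]

instance : CStarRing (Stab A) where
  norm_mul_self_le := Stab.induction₁ (isClosed_le (by fun_prop) (by fun_prop)) fun x => by
    simp only [← toStab_star, ← toStab_mul, LinearIsometry.norm_map, FinMat.norm_mul_self_le]

theorem continuous_smul_stab (c : ℂ) : Continuous fun x : Stab A => c • x :=
  continuous_const_smul c

theorem toStab_smul (c : ℂ) (x : FinMat A) : toStab (c • x) = c • toStab x := map_smul _ _ _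

instance : IsScalarTower ℂ (Stab A) (Stab A) where
  smul_assoc c := Stab.induction₂
    (isClosed_eq (((continuous_smul_stab c).comp continuous_fst).mul continuous_snd)
      ((continuous_smul_stab c).comp (continuous_fst.mul continuous_snd))) fun x y => by
    simp only [smul_eq_mul, ← toStab_smul, ← toStab_mul, smul_mul_assoc]

instance : SMulCommClass ℂ (Stab A) (Stab A) where
  smul_comm c := Stab.induction₂
    (isClosed_eq ((continuous_smul_stab c).comp (continuous_fst.mul continuous_snd))
      (continuous_fst.mul ((continuous_smul_stab c).comp continuous_snd))) fun x y => by
    simp only [smul_eq_mul, ← toStab_smul, ← toStab_mul, mul_smul_comm]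

instance : StarModule ℂ (Stab A) where
  star_smul c := Stab.induction₁
    (isClosed_eq (continuous_star.comp (continuous_smul_stab c))
      ((continuous_smul_stab (star c)).comp continuous_star)) fun x => by
    simp only [← toStab_smul, ← toStab_star, star_smul]

instance : NonUnitalCStarAlgebra (Stab A) where

/-- `x ≤ y` iff `y - x` is a positive element. -/
instance : PartialOrder (Stab A) := CStarAlgebra.spectralOrder _
instance : StarOrderedRing (Stab A) := CStarAlgebra.spectralOrderedRing _

/-- The sequence `a ⊗ e_{1,1} ∈ M_n(A)`, `n ≥ 1`. -/
def cornerSeq (a : A) : FinMat A :=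
  ⟨fun n => cornerMat n a, by
    refine eventually_atTop.2 ⟨1, fun n hn => ?_⟩
    ext i j
    show cornerMat (n + 1) a i j = padFun (cornerMat n a) i j
    have hn' : n ≠ 0 := by omega
    induction i using Fin.lastCases <;> induction j using Fin.lastCases <;>
      simp [cornerMat_apply, hn']⟩

theorem cornerSeq_ext {x y : FinMat A} (h : ∀ n, x.entry n = y.entry n) : x = y :=
  Subtype.ext (funext h)

/-- The canonical embedding `a ↦ a ⊗ e_{1,1}` of `A` into `A ⊗ 𝕂`. -/
def corner : A →⋆ₙₐ[ℂ] Stab A where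
  toFun a := toStab (cornerSeq a)
  map_smul' c a := by
    rw [MonoidHom.id_apply, ← toStab_smul]
    congr 1
    refine cornerSeq_ext fun n => ?_
    ext i j
    show cornerMat n (c • a) i j = c • cornerMat n a i j
    simp only [cornerMat_apply]; split_ifs <;> simp
  map_zero' := by
    rw [← map_zero toStab]
    congr 1
    refine cornerSeq_ext fun n => ?_
    ext i j
    show cornerMat n (0 : A) i j = 0
    simp only [cornerMat_apply]; split_ifs <;> simp
  map_add' a b := by
    rw [← map_add]
    congr 1
    refine cornerSeq_ext fun n => ?_
    ext i j
    show cornerMat n (a + b) i j = cornerMat n a i j + cornerMat n b i j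
    simp only [cornerMat_apply]; split_ifs <;> simp
  map_mul' a b := by
    rw [← toStab_mul]
    congr 1
    exact cornerSeq_ext fun n => cornerMat_mul n a b
  map_star' a := by
    rw [← toStab_star]
    congr 1
    refine cornerSeq_ext fun n => ?_
    ext i j
    show cornerMat n (star a) i j = star (cornerMat n a j i)
    simp only [cornerMat_apply, and_comm (a := i.val = 0)]; split_ifs <;> simp

end Stabilization

section Pedersen

variable {D : Type u} [NonUnitalCStarAlgebra D]

/-- Dense two-sided (not necessarily closed) ideals. -/
structure IsDenseIdeal (J : Submodule ℂ D) : Prop where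
  mul_mem_left : ∀ a : D, ∀ x ∈ J, a * x ∈ J
  mul_mem_right : ∀ a : D, ∀ x ∈ J, x * a ∈ J
  dense : Dense (J : Set D)

theorem IsDenseIdeal.star {J : Submodule ℂ D} (hJ : IsDenseIdeal J) :
    ∃ J' : Submodule ℂ D, IsDenseIdeal J' ∧ ∀ x, x ∈ J' ↔ Star.star x ∈ J := by
  refine ⟨{ carrier := {x | Star.star x ∈ J}
            add_mem' := fun {x y} hx hy => ?_
            zero_mem' := ?_
            smul_mem' := fun c x hx => ?_ }, ⟨fun a x hx => ?_, fun a x hx => ?_, ?_⟩,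
    fun x => Iff.rfl⟩
  · simpa using J.add_mem hx hy
  · simp
  · simpa using J.smul_mem _ hx
  · show Star.star (a * x) ∈ J
    rw [star_mul]; exact hJ.mul_mem_right _ _ hx
  · show Star.star (x * a) ∈ J
    rw [star_mul]; exact hJ.mul_mem_left _ _ hx
  · have h : Dense (Star.star '' (J : Set D)) :=
      star_involutive.surjective.denseRange.dense_image continuous_star hJ.dense
    refine h.mono ?_
    rintro _ ⟨x, hx, rfl⟩
    show Star.star (Star.star x) ∈ J
    rwa [star_star]

variable (D) in
/-- The Pedersen ideal, the smallest dense two-sided ideal, as a `*`-subalgebra. -/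
def Ped : NonUnitalStarSubalgebra ℂ D where
  carrier := {x | ∀ J : Submodule ℂ D, IsDenseIdeal J → x ∈ J}
  add_mem' hx hy J hJ := J.add_mem (hx J hJ) (hy J hJ)
  zero_mem' J _ := J.zero_mem
  mul_mem' _ hy J hJ := hJ.mul_mem_left _ _ (hy J hJ)
  smul_mem' c _ hx J hJ := J.smul_mem c (hx J hJ)
  star_mem' {x} hx J hJ := by
    obtain ⟨J', hJ', h⟩ := hJ.star
    exact (h x).1 (hx J' hJ')

/-- `f_ε : ℝ → [0,1]`: it is `0` on `(-∞, ε]`, `1` on `[2ε, ∞)` and linear in between. -/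
def cutoff (ε t : ℝ) : ℝ := max 0 (min 1 ((t - ε) / ε))

/-- Functions that vanish on `(-∞, δ]`, `δ > 0`, map into every dense ideal. -/
theorem IsDenseIdeal.cfc_mem {J : Submodule ℂ D} (hJ : IsDenseIdeal J) {δ : ℝ} (hδ : 0 < δ)
    {g : ℝ → ℝ} (hg : ∀ t ≤ δ, g t = 0) (a : D) : cfcₙ g a ∈ J := by
  by_cases ha : IsSelfAdjoint a
  swap
  · rw [cfcₙ_apply_of_not_predicate a ha]; exact J.zero_mem
  by_cases hc : ContinuousOn g (quasispectrum ℝ a)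
  swap
  · rw [cfcₙ_apply_of_not_continuousOn a hc]; exact J.zero_mem
  have hg0 : g 0 = 0 := hg 0 hδ.le
  have hh0 : cutoff (δ / 2) 0 = 0 := by
    have : (0 - δ / 2) / (δ / 2) ≤ 0 := div_nonpos_of_nonpos_of_nonneg (by linarith) (by linarith)
    simp only [cutoff]
    exact max_eq_left ((min_le_right _ _).trans this)
  have hhc : Continuous (cutoff (δ / 2)) := by
    unfold cutoff
    fun_prop
  set u := cfcₙ (cutoff (δ / 2)) a with hu
  set f := cfcₙ g a with hf
  have huf : u * f = f := by
    rw [hu, hf, ← cfcₙ_mul _ _ a hhc.continuousOn hh0 hc hg0]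
    refine cfcₙ_congr fun t _ => ?_
    rcases le_total t δ with h | h
    · simp [hg t h]
    · have : 1 ≤ (t - δ / 2) / (δ / 2) := by rw [le_div_iff₀ (by linarith)]; linarith
      simp [cutoff, min_eq_left this]
  obtain ⟨x, hxJ, hx⟩ := hJ.dense.exists_dist_lt u one_pos
  have hz : ‖((u - x : D) : Unitization ℂ D)‖ < 1 := by
    rwa [Unitization.norm_inr, ← dist_eq_norm]
  obtain ⟨w, hw⟩ := isUnit_one_sub_of_norm_lt_one hz
  have h1 : (w : Unitization ℂ D) * (f : Unitization ℂ D) = ((x * f : D) : Unitization ℂ D) := by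
    rw [hw, sub_mul, one_mul, ← Unitization.inr_mul, ← Unitization.inr_sub]
    congr 1
    rw [sub_mul, huf, sub_sub_cancel]
  have h2 : (f : Unitization ℂ D) = ((w⁻¹ : (Unitization ℂ D)ˣ) : Unitization ℂ D) *
      ((x * f : D) : Unitization ℂ D) := by
    rw [← h1, Units.inv_mul_cancel_left]
  have h3 : f = ((w⁻¹ : (Unitization ℂ D)ˣ) : Unitization ℂ D).fst • (x * f) +
      ((w⁻¹ : (Unitization ℂ D)ˣ) : Unitization ℂ D).snd * (x * f) := by
    have := congrArg (fun x : Unitization ℂ D => x.snd) h2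
    simpa using this
  have h4 : x * f ∈ J := hJ.mul_mem_right _ _ hxJ
  rw [h3]
  exact J.add_mem (J.smul_mem _ h4) (hJ.mul_mem_left _ _ h4)

theorem cfc_mem_Ped {δ : ℝ} (hδ : 0 < δ) {g : ℝ → ℝ} (hg : ∀ t ≤ δ, g t = 0) (a : D) :
    cfcₙ g a ∈ Ped D := fun _ hJ => hJ.cfc_mem hδ hg a

/-- `f_ε(a)`, an element of the Pedersen ideal. -/
def cutoffPed {ε : ℝ} (hε : 0 < ε) (a : D) : Ped D :=
  ⟨cfcₙ (cutoff ε) a, cfc_mem_Ped hε (fun t ht => by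
    have : (t - ε) / ε ≤ 0 := div_nonpos_of_nonpos_of_nonneg (by linarith) hε.le
    exact max_eq_left ((min_le_right _ _).trans this)) a⟩

/-- `(a - ε)₊`, an element of the Pedersen ideal. -/
def cutdownPed {ε : ℝ} (hε : 0 < ε) (a : D) : Ped D :=
  ⟨cfcₙ (fun t : ℝ => max (t - ε) 0) a,
    cfc_mem_Ped hε (fun t ht => max_eq_right (by linarith)) a⟩

theorem corner_mem_Ped {A : Type u} [NonUnitalCStarAlgebra A] [PartialOrder A] [StarOrderedRing A]
    {b : A} (hb : b ∈ Ped A) : corner b ∈ Ped (Stab A) := by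
  intro J hJ
  let φ : A →ₗ[ℂ] Stab A :=
    { toFun := corner, map_add' := map_add corner, map_smul' := fun c a => map_smul corner c a }
  refine hb (J.comap φ) ⟨fun a x hx => ?_, fun a x hx => ?_, ?_⟩
  · show corner (a * x) ∈ J
    rw [map_mul]; exact hJ.mul_mem_left _ _ hx
  · show corner (x * a) ∈ J
    rw [map_mul]; exact hJ.mul_mem_right _ _ hx
  · rw [Submodule.dense_iff_topologicalClosure_eq_top, eq_top_iff, ← CStarAlgebra.span_nonneg,
      Submodule.span_le]
    intro a (ha : 0 ≤ a)
    refine Metric.mem_closure_iff.2 fun ε hε => ?_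
    have hsa : IsSelfAdjoint a := IsSelfAdjoint.of_nonneg ha
    refine ⟨cfcₙ (fun t : ℝ => max (t - ε / 2) 0) a, ?_, ?_⟩
    · show corner (cfcₙ (fun t : ℝ => max (t - ε / 2) 0) a) ∈ J
      rw [NonUnitalStarAlgHomClass.map_cfcₙ corner (fun t : ℝ => max (t - ε / 2) 0) a
        (by fun_prop) (max_eq_right (by linarith)) (map_continuous corner) hsa
        (hsa.map corner)]
      exact hJ.cfc_mem (half_pos hε) (fun t ht => max_eq_right (by linarith)) _
    · rw [dist_eq_norm]
      conv_lhs => enter [1, 1]; rw [← cfcₙ_id' ℝ a hsa]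
      rw [← cfcₙ_sub (fun x : ℝ => x) (fun t : ℝ => max (t - ε / 2) 0) a (by fun_prop) rfl
        (by fun_prop) (max_eq_right (by linarith))]
      refine (norm_cfcₙ_le fun t ht => ?_).trans_lt (half_lt_self hε)
      have ht0 : 0 ≤ t := quasispectrum_nonneg_of_nonneg a ha t ht
      rw [Real.norm_eq_abs, abs_le]
      rcases le_total (t - ε / 2) 0 with h | h
      · rw [max_eq_right h]; constructor <;> linarith
      · rw [max_eq_left h]; constructor <;> linarith

end Pedersen

section Quasitraces

/-- Quasitraces on a pre-C⋆-algebra. -/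
structure IsQuasitrace {R : Type u} [NonUnitalRing R] [StarRing R] [Module ℂ R] (τ : R → ℂ) :
    Prop where
  nonneg : ∀ x, 0 ≤ τ (star x * x)
  tracial : ∀ x, τ (star x * x) = τ (x * star x)
  linear : ∀ B : NonUnitalStarSubalgebra ℂ R, (∀ x ∈ B, ∀ y ∈ B, x * y = y * x) →
    (∀ x ∈ B, ∀ y ∈ B, τ (x + y) = τ x + τ y) ∧ ∀ c : ℂ, ∀ x ∈ B, τ (c • x) = c * τ x
  re_im : ∀ a b : R, IsSelfAdjoint a → IsSelfAdjoint b →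
    τ (a + Complex.I • b) = τ a + Complex.I * τ b

/-- A `2`-quasitrace is a quasitrace that extends to a quasitrace on the `2 × 2` matrices,
where `x` is identified with `x ⊗ e_{1,1}`. -/
def IsTwoQuasitrace {R : Type u} [NonUnitalRing R] [StarRing R] [Module ℂ R] (τ : R → ℂ) : Prop :=
  IsQuasitrace τ ∧ ∃ τ₂ : Matrix (Fin 2) (Fin 2) R → ℂ,
    IsQuasitrace τ₂ ∧ ∀ x : R, τ₂ (Matrix.single 0 0 x) = τ x

/-- The densely defined `2`-quasitraces on `D`, i.e. the `2`-quasitraces on its Pedersen ideal. -/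
def DQT (D : Type u) [NonUnitalCStarAlgebra D] : Type u :=
  {τ : Ped D → ℂ // IsTwoQuasitrace τ}

/-- The topology of pointwise convergence on the Pedersen ideal. -/
instance (D : Type u) [NonUnitalCStarAlgebra D] : TopologicalSpace (DQT D) :=
  inferInstanceAs (TopologicalSpace {τ : Ped D → ℂ // IsTwoQuasitrace τ})

variable {D : Type u} [NonUnitalCStarAlgebra D]

/-- The value of `τ` at a positive element of the Pedersen ideal, as an element of `[0, ∞]`. -/
def DQT.eval (τ : DQT D) (x : Ped D) : ℝ≥0∞ := ENNReal.ofReal (τ.1 x).re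

/-- `d_τ(a) = lim_n τ(f_{1/n}(a))` for `a ≥ 0`; the sequence is increasing. -/
def dimFun (τ : DQT D) (a : D) : ℝ≥0∞ :=
  ⨆ n : ℕ, τ.eval (cutoffPed (Nat.one_div_pos_of_nat (α := ℝ) (n := n)) a)

/-- `‖x‖_{2,τ} = sup_{ε > 0} τ((x⋆x - ε)₊)^{1/2}`. -/
def twoNormAt (τ : DQT D) (x : D) : ℝ≥0∞ :=
  ⨆ ε : Set.Ioi (0 : ℝ), τ.eval (cutdownPed ε.2 (star x * x)) ^ (1 / 2 : ℝ)

end Quasitraces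

section Hereditary

variable {D : Type u} [NonUnitalCStarAlgebra D] [PartialOrder D]

/-- Hereditary C⋆-subalgebras. -/
structure IsHereditary (B : NonUnitalStarSubalgebra ℂ D) : Prop where
  isClosed : IsClosed (B : Set D)
  mem_of_le : ∀ x y : D, 0 ≤ x → x ≤ y → y ∈ B → x ∈ B

/-- The hereditary C⋆-subalgebra generated by `a`. -/
def Her (a : D) : NonUnitalStarSubalgebra ℂ D :=
  sInf {B | IsHereditary B ∧ a ∈ B}

end Hereditary

section Oscillation

variable (A : Type u) [NonUnitalCStarAlgebra A] [PartialOrder A] [StarOrderedRing A]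

/-- `A` is σ-unital: it has a countable approximate unit. -/
def IsSigmaUnital : Prop :=
  ∃ u : ℕ → A, Monotone u ∧ (Filter.map u atTop).IsIncreasingApproximateUnit

variable {A} in
/-- `‖τ|_A‖ = sup {|τ(b)| : b ∈ Ped(A)₊, ‖b‖ ≤ 1}`, with `A` identified with `A ⊗ e_{1,1}`. -/
def normOn (τ : DQT (Stab A)) : ℝ≥0∞ :=
  ⨆ b : {b : Ped A // 0 ≤ (b : A) ∧ ‖(b : A)‖ ≤ 1}, ‖τ.1 ⟨corner (b.1 : A), corner_mem_Ped b.1.2⟩‖ₑ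

/-- `QT(A)`. -/
def QT : Set (DQT (Stab A)) := {τ | normOn τ = 1}

variable {A}

/-- `‖x‖₂`, the supremum of `‖x‖_{2,τ}` over the closure of `QT(A)`. -/
def twoNorm (x : Stab A) : ℝ≥0∞ := ⨆ τ ∈ closure (QT A), twoNormAt τ x

/-- The tracial oscillation
`ω(a) = lim_n sup {d_τ(a) - τ(f_{1/n}(a)) : τ ∈ closure QT(A)}` for `a ≥ 0`; the sequence is
decreasing, and the terms `τ(f_{1/n}(a)) ≤ d_τ(a)` are finite. -/
def osc (a : Stab A) : ℝ≥0∞ :=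
  ⨅ n : ℕ, ⨆ τ ∈ closure (QT A),
    dimFun τ a - τ.eval (cutoffPed (Nat.one_div_pos_of_nat (α := ℝ) (n := n)) a)

/-- `a ≥ 0` has tracial approximate oscillation zero. -/
def ElementTAOZ (a : Stab A) : Prop :=
  ∀ ε : ℝ, 0 < ε → ∃ c ∈ Her a, 0 ≤ c ∧
    twoNorm (a - c) < ENNReal.ofReal ε ∧ ‖c‖ ≤ ‖a‖ ∧ osc c < ENNReal.ofReal ε

variable (A) in
/-- `A` has tracial approximate oscillation zero. -/
def HasTAOZ : Prop := ∀ a ∈ Ped (Stab A), 0 ≤ a → ElementTAOZ a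

end Oscillation

end CStarStab

open CStarStab

/-!
Everything rests on a comparison theory for `2`-quasitraces that needs only local properties. A
quasitrace `τ` on the Pedersen ideal is monotone on commuting elements and satisfies
`τ(y⋆ y) = τ(y y⋆)`, and the Pedersen ideal `P` is spanned by squares `u⋆ u` with a local unit in `P`
(`IsPedLike`; this property passes to `2 × 2` matrices). If `a ≤ z⋆ z + r` with `‖r‖ < η`, then
`f_η(a)` has the form `y⋆ y`, where every left local unit `h` of `z` is one of `y`; hence
`τ(f_η(a)) = τ(y y⋆) ≤ τ(h)` (`IsLocalTrace.cutoff_le_of_le_star_mul`). All comparisons follow from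
this one: `d_τ` is monotone for inclusions of hereditary subalgebras and additive on orthogonal
elements, `τ(x) ≤ ‖x‖ d_τ(x)`, and, by passing to `2 × 2` matrices, `d_τ` is subadditive.

Since `A` is algebraically simple, the elements with bounded dimension on `QT(A)` form a dense ideal
of `A ⊗ 𝕂`, which therefore contains the Pedersen ideal (`exists_dim_le`). The same bounds hold for
the extensions to `2 × 2` matrices, and Tychonoff's theorem shows that the closure of `QT(A)` is
compact (`isCompact_closure_QT`).

(i) ⇒ (ii). Approximate a cut-off of `e` in the `2`-norm by an element `c` of small oscillation, and
let `b` and `p` be cut-offs of `c` with `p b = b`. The trace of `b` nearly captures that of a cut-off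
of `e`, and by subadditivity what it misses of other cut-offs is found in `(1 - p) e (1 - p)`, which
is orthogonal to `b` (`HasTAOZ.exists_step`). Iteration with cut-offs that tend to `0` fast enough
exhausts the dimension of `e` (`HasTAOZ.exists_exhaustion`).

(ii) ⇒ (iii). A positive contraction `b` satisfies `τ(b) ≤ d_τ(b)`.

(iii) ⇒ (i). Let `P_N` be the sum of suitable cut-offs of `b_0, …, b_{N-1}`, and let
`c = (1 - κ) P_N a P_N + κ ‖a‖ P_N`. Then `c` lies between multiples of `P_N`, so that its
oscillation is small (`osc_compression_le`). Up to errors of order `κ`, both `a - c` and `c - a` are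
dominated by a multiple of `(1 - P_N) a (1 - P_N)`. The dimension of the latter tends to a small value
at each `τ`, and it is equivalent to `a^{1/2} (1 - P_N)² a^{1/2}`, which decreases with `N`; by
compactness its cut-offs are small uniformly in `τ` (`exists_cutoff_lt_of_isCompact`). This bounds
the `2`-norm of `a - c` (`elementTAOZ_of_exhaustion`).
-/

namespace CStarStab

set_option linter.unusedSectionVars false

universe u

/-! ### The functions `f_ε` -/

section Cutoff

@[fun_prop]
theorem continuous_cutoff (ε : ℝ) : Continuous (cutoff ε) := by
  unfold cutoff; fun_prop

theorem cutoff_eq_zero {ε t : ℝ} (hε : 0 < ε) (ht : t ≤ ε) : cutoff ε t = 0 := by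
  have : (t - ε) / ε ≤ 0 := div_nonpos_of_nonpos_of_nonneg (by linarith) hε.le
  exact max_eq_left ((min_le_right _ _).trans this)

@[simp] theorem cutoff_zero (ε : ℝ) : cutoff ε 0 = 0 := by
  have : (0 - ε) / ε ≤ 0 := by
    rcases eq_or_ne ε 0 with rfl | h
    · simp
    · rw [zero_sub, neg_div, div_self h]; norm_num
  exact max_eq_left ((min_le_right _ _).trans this)

theorem cutoff_eq_one {ε t : ℝ} (hε : 0 < ε) (ht : 2 * ε ≤ t) : cutoff ε t = 1 := by
  have : 1 ≤ (t - ε) / ε := by rw [le_div_iff₀ hε]; linarith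
  simp [cutoff, min_eq_left this]

theorem cutoff_nonneg (ε t : ℝ) : 0 ≤ cutoff ε t := le_max_left _ _

theorem cutoff_le_one (ε t : ℝ) : cutoff ε t ≤ 1 := by
  simp [cutoff]

theorem cutoff_le_cutoff {ε δ : ℝ} (hε : 0 < ε) (h : ε ≤ δ) (t : ℝ) : cutoff δ t ≤ cutoff ε t := by
  have hδ : 0 < δ := hε.trans_le h
  rcases le_total t 0 with ht | ht
  · rw [cutoff_eq_zero hδ (ht.trans hδ.le)]; exact cutoff_nonneg _ _
  · refine max_le_max le_rfl (min_le_min le_rfl ?_)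
    rw [sub_div, sub_div, div_self hε.ne', div_self hδ.ne']
    have := div_le_div_of_nonneg_left ht hε h
    linarith

end Cutoff

/-! ### Compressions and orthogonal elements -/

section CStarAlgebra

variable {D : Type u} [NonUnitalCStarAlgebra D]

theorem mul_eq_zero_symm {x y : D} (hx : IsSelfAdjoint x)
    (hy : IsSelfAdjoint y) (h : x * y = 0) : y * x = 0 := by
  rw [← star_inj, star_mul, hx.star_eq, hy.star_eq, h, star_zero]

section Order

variable [PartialOrder D] [StarOrderedRing D]

/-- The compression `(1 - p) a (1 - p)`, written without a unit. -/
def compress (p a : D) : D := a - p * a - a * p + p * a * p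

theorem compress_eq_star_mul {p a r : D} (hp : IsSelfAdjoint p) (hr : IsSelfAdjoint r) (h : r * r = a) :
    star (r - r * p) * (r - r * p) = compress p a := by
  rw [compress, ← h, star_sub, star_mul, hp.star_eq, hr.star_eq]; noncomm_ring

theorem compress_eq_mul_star {p a r : D} (hp : IsSelfAdjoint p) (hr : IsSelfAdjoint r) (h : r * r = a) :
    (r - p * r) * star (r - p * r) = compress p a := by
  rw [compress, ← h, star_sub, star_mul, hp.star_eq, hr.star_eq]; noncomm_ring

theorem sqrt_isSelfAdjoint (a : D) : IsSelfAdjoint (CFC.sqrt a) :=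
  IsSelfAdjoint.of_nonneg (CFC.sqrt_nonneg a)

theorem compress_nonneg {p a : D} (hp : IsSelfAdjoint p) (ha : 0 ≤ a) : 0 ≤ compress p a := by
  rw [← compress_eq_star_mul hp (sqrt_isSelfAdjoint a) (CFC.sqrt_mul_sqrt_self a ha)]
  exact star_mul_self_nonneg _

theorem compress_mono {p a b : D} (hp : IsSelfAdjoint p) (h : a ≤ b) : compress p a ≤ compress p b := by
  rw [← sub_nonneg] at h ⊢
  have : compress p b - compress p a = compress p (b - a) := by simp only [compress]; noncomm_ring
  rw [this]; exact compress_nonneg hp h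

theorem norm_sub_mul_sqrt_sq {p a : D} (hp : IsSelfAdjoint p) (ha : 0 ≤ a) :
    ‖CFC.sqrt a - p * CFC.sqrt a‖ ^ 2 = ‖compress p a‖ := by
  rw [← compress_eq_mul_star hp (sqrt_isSelfAdjoint a) (CFC.sqrt_mul_sqrt_self a ha),
    CStarRing.norm_self_mul_star, sq]

theorem norm_compress_mono {p a b : D} (hp : IsSelfAdjoint p) (ha : 0 ≤ a) (h : a ≤ b) :
    ‖compress p a‖ ≤ ‖compress p b‖ :=
  CStarAlgebra.norm_le_norm_of_nonneg_of_le (compress_nonneg hp ha) (compress_mono hp h)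

theorem compress_cfc {f g : ℝ → ℝ} (a : D) (hf : Continuous f) (hg : Continuous g)
    (hf0 : f 0 = 0) (hg0 : g 0 = 0) :
    compress (cfcₙ f a) (cfcₙ g a) = cfcₙ (fun s => g s * (1 - f s) ^ 2) a := by
  have h : (fun s => g s * (1 - f s) ^ 2) =
      fun s => (g s - f s * g s - g s * f s) + f s * g s * f s := by ext s; ring
  rw [h, cfcₙ_add .., cfcₙ_sub .., cfcₙ_sub .., cfcₙ_mul .., cfcₙ_mul .., cfcₙ_mul .., cfcₙ_mul ..,
    compress]

/-- A positive element dominated by one that `p` annihilates is annihilated by `p`. -/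
theorem mul_eq_zero_of_le {p a b : D} (ha : 0 ≤ a) (h : a ≤ b) (hb : p * b = 0) : p * a = 0 := by
  have h1 : p * a * star p ≤ p * b * star p := star_right_conjugate_le_conjugate h p
  rw [hb, zero_mul] at h1
  have h2 : p * a * star p = 0 := le_antisymm h1 (star_right_conjugate_nonneg ha p)
  have h3 : (p * CFC.sqrt a) * star (p * CFC.sqrt a) = 0 := by
    rw [star_mul, (sqrt_isSelfAdjoint a).star_eq, mul_assoc, ← mul_assoc (CFC.sqrt a),
      CFC.sqrt_mul_sqrt_self a ha, ← mul_assoc, h2]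
  rw [CStarRing.mul_star_self_eq_zero_iff] at h3
  rw [← CFC.sqrt_mul_sqrt_self a ha, ← mul_assoc, h3, zero_mul]

theorem mul_self_le_self {p : D} (hp : 0 ≤ p) (hp1 : ‖p‖ ≤ 1) : p * p ≤ p := by
  obtain ⟨s, hs, hp'⟩ : ∃ s : D, IsSelfAdjoint s ∧ s * s = p :=
    ⟨_, sqrt_isSelfAdjoint p, CFC.sqrt_mul_sqrt_self p hp⟩
  have h := CStarAlgebra.star_left_conjugate_le_norm_smul (a := s) (b := p)
    (IsSelfAdjoint.of_nonneg hp)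
  have e : s * p * s = p * p := by rw [← hp']; simp only [mul_assoc]
  rw [hs.star_eq, e, hp'] at h
  refine h.trans ?_
  have := smul_le_smul_of_nonneg_right hp1 hp
  rwa [one_smul] at this

/-- The functional calculus is additive on orthogonal positive elements. -/
theorem cfcₙ_add_of_mul_eq_zero {x y : D} (hx : 0 ≤ x) (hy : 0 ≤ y) (hxy : x * y = 0) {f : ℝ → ℝ}
    (hf : Continuous f) (hf0 : f 0 = 0) : cfcₙ f (x + y) = cfcₙ f x + cfcₙ f y := by
  -- `x` and `y` are the positive and the negative part of `x - y`, and `x + y = |x - y|`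
  obtain ⟨w, hw⟩ : ∃ w, w = x - y := ⟨_, rfl⟩
  have hsa : IsSelfAdjoint w :=
    hw ▸ (IsSelfAdjoint.of_nonneg hx).sub (IsSelfAdjoint.of_nonneg hy)
  obtain ⟨h1, h2⟩ := CFC.posPart_negPart_unique hw hxy hx hy
  rw [CFC.posPart_def] at h1
  rw [CFC.negPart_def] at h2
  have h3 : x + y = cfcₙ (fun s : ℝ => s⁺ + s⁻) w := by
    rw [cfcₙ_add (fun s : ℝ => s⁺) (fun s : ℝ => s⁻) .., h1, h2]
  rw [h3, ← h1, ← h2, ← cfcₙ_comp' .., ← cfcₙ_comp' f .., ← cfcₙ_comp' f .., ← cfcₙ_add ..]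
  congr 1
  ext s
  rcases le_total s 0 with h | h
  · simp [posPart_eq_zero.2 h, hf0]
  · simp [negPart_eq_zero.2 h, hf0]

end Order

/-! ### Hereditary subalgebras -/

section Her

variable [PartialOrder D]

theorem mem_Her_self (a : D) : a ∈ Her a := by
  simp only [Her, NonUnitalStarAlgebra.mem_sInf]
  exact fun B hB => hB.2

theorem Her_le {a : D} {B : NonUnitalStarSubalgebra ℂ D} (hB : IsHereditary B) (ha : a ∈ B) :
    Her a ≤ B := sInf_le ⟨hB, ha⟩

theorem isHereditary_Her (a : D) : IsHereditary (Her a) where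
  isClosed := by
    rw [Her, NonUnitalStarAlgebra.coe_sInf]
    exact isClosed_biInter fun B hB => hB.1.isClosed
  mem_of_le x y hx hxy hy := by
    simp only [Her, NonUnitalStarAlgebra.mem_sInf] at hy ⊢
    exact fun B hB => hB.1.mem_of_le x y hx hxy (hy B hB)

theorem Her_mono {a b : D} (h : a ∈ Her b) : Her a ≤ Her b := Her_le (isHereditary_Her b) h

theorem cfc_mem_Her {a x : D} (h : x ∈ Her a) (f : ℝ → ℝ) : cfcₙ f x ∈ Her a := by
  by_cases hx : IsSelfAdjoint x
  · have := (isHereditary_Her a).isClosed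
    exact cfcₙ_mem (𝕜' := ℂ) f h
  · rw [cfcₙ_apply_of_not_predicate x hx]; exact zero_mem _

variable [StarOrderedRing D]

theorem sqrt_mem_Her {a x : D} (h : x ∈ Her a) (hx : 0 ≤ x) : CFC.sqrt x ∈ Her a := by
  rw [CFC.sqrt_eq_real_sqrt x hx]; exact cfc_mem_Her h _

/-- The two-sided annihilator of `p` is a hereditary subalgebra. -/
theorem mul_eq_zero_of_mem_Her {a p x : D} (hp : IsSelfAdjoint p) (ha : IsSelfAdjoint a)
    (h : p * a = 0) (hx : x ∈ Her a) : p * x = 0 := by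
  let B : NonUnitalStarSubalgebra ℂ D :=
    { carrier := {x | p * x = 0 ∧ x * p = 0}
      add_mem' := fun {x y} hx hy => by
        simp only [Set.mem_ofPred_eq] at *; simp [mul_add, add_mul, hx, hy]
      zero_mem' := by simp
      mul_mem' := fun {x y} hx hy => by
        simp only [Set.mem_ofPred_eq] at *
        simp [mul_assoc, hy.2, ← mul_assoc p, hx.1]
      smul_mem' := fun c x hx => by
        simp only [Set.mem_ofPred_eq] at *
        rw [mul_smul_comm, smul_mul_assoc, hx.1, hx.2, smul_zero]; simp
      star_mem' := fun {x} hx => by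
        simp only [Set.mem_ofPred_eq] at *
        constructor
        · rw [← star_inj, star_mul, star_star, hp.star_eq, hx.2, star_zero]
        · rw [← star_inj, star_mul, star_star, hp.star_eq, hx.1, star_zero] }
  have hB : IsHereditary B := by
    constructor
    · exact (isClosed_eq (by fun_prop) (by fun_prop)).inter (isClosed_eq (by fun_prop) (by fun_prop))
    · intro x y hx hxy hy
      have h1 := mul_eq_zero_of_le hx hxy hy.1
      refine ⟨h1, ?_⟩
      rw [← star_inj, star_mul, (IsSelfAdjoint.of_nonneg hx).star_eq, hp.star_eq, h1, star_zero]
  refine (Her_le hB ⟨h, ?_⟩ hx).1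
  rw [← star_inj, star_mul, ha.star_eq, hp.star_eq, h, star_zero]

theorem compress_mem_Her {a p : D} (hp : p ∈ Her a) : compress p a ∈ Her a := by
  have ha := mem_Her_self a
  exact add_mem (sub_mem (sub_mem ha (mul_mem hp ha)) (mul_mem ha hp)) (mul_mem (mul_mem hp ha) hp)

/-- The spectral cut-offs `f_{1/(n+1)}(w)` are an approximate unit of `Her(w)`. -/
def apx (w : D) (n : ℕ) : D := cfcₙ (cutoff (1 / (n + 1))) w

theorem apx_isSelfAdjoint (w : D) (n : ℕ) : IsSelfAdjoint (apx w n) := cfcₙ_predicate _ _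

theorem norm_cutoff_le (ε : ℝ) (w : D) : ‖cfcₙ (cutoff ε) w‖ ≤ 1 :=
  norm_cfcₙ_le fun t _ => by
    rw [Real.norm_of_nonneg (cutoff_nonneg _ _)]; exact cutoff_le_one _ _

theorem norm_compress_apx_le {w : D} (hw : 0 ≤ w) (n : ℕ) :
    ‖compress (apx w n) w‖ ≤ 2 / (n + 1) := by
  have hwsa := IsSelfAdjoint.of_nonneg hw
  have hn : (0 : ℝ) < 1 / (n + 1) := by positivity
  have h : compress (apx w n) w = compress (apx w n) (cfcₙ (fun s : ℝ => s) w) := by rw [cfcₙ_id' ℝ w]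
  rw [h, apx, compress_cfc w (by fun_prop) (by fun_prop) (by simp) rfl]
  refine norm_cfcₙ_le fun t ht => ?_
  have ht0 : 0 ≤ t := quasispectrum_nonneg_of_nonneg w hw t ht
  rw [Real.norm_of_nonneg (by positivity)]
  rcases le_total (2 * (1 / ((n : ℝ) + 1))) t with h | h
  · rw [cutoff_eq_one hn h]; simp; positivity
  · have h1 := cutoff_nonneg (1 / ((n : ℝ) + 1)) t
    have h2 := cutoff_le_one (1 / ((n : ℝ) + 1)) t
    have : (1 - cutoff (1 / ((n : ℝ) + 1)) t) ^ 2 ≤ 1 := by nlinarith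
    calc t * (1 - cutoff (1 / ((n : ℝ) + 1)) t) ^ 2 ≤ t * 1 := by gcongr
      _ ≤ 2 / (n + 1) := by rw [mul_one]; refine h.trans_eq (by ring)

theorem tendsto_compress_apx {w : D} (hw : 0 ≤ w) :
    Tendsto (fun n => ‖compress (apx w n) w‖) atTop (𝓝 0) := by
  refine squeeze_zero (fun _ => norm_nonneg _) (norm_compress_apx_le hw) ?_
  have := (tendsto_one_div_add_atTop_nhds_zero_nat (𝕜 := ℝ)).const_mul 2
  simpa [div_eq_mul_inv] using this

theorem tendsto_of_compress {p : ℕ → D} {g : D} (hp : ∀ n, IsSelfAdjoint (p n)) (hg : 0 ≤ g)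
    (h : Tendsto (fun n => ‖compress (p n) g‖) atTop (𝓝 0)) :
    Tendsto (fun n => p n * g) atTop (𝓝 g) := by
  have h1 : Tendsto (fun n => ‖CFC.sqrt g - p n * CFC.sqrt g‖) atTop (𝓝 0) := by
    have : Tendsto (fun n => √‖compress (p n) g‖) atTop (𝓝 0) := by simpa using h.sqrt
    refine this.congr fun n => ?_
    rw [← norm_sub_mul_sqrt_sq (hp n) hg, Real.sqrt_sq (norm_nonneg _)]
  have h2 : Tendsto (fun n => p n * CFC.sqrt g) atTop (𝓝 (CFC.sqrt g)) :=
    tendsto_iff_norm_sub_tendsto_zero.2 (by simpa [norm_sub_rev] using h1)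
  simpa [mul_assoc, CFC.sqrt_mul_sqrt_self g hg] using h2.mul_const (CFC.sqrt g)

theorem tendsto_compress_of_tendsto {p : ℕ → D} {g : D} (hp1 : ∀ n, ‖p n‖ ≤ 1)
    (h : Tendsto (fun n => p n * g) atTop (𝓝 g)) :
    Tendsto (fun n => ‖compress (p n) g‖) atTop (𝓝 0) := by
  have h1 : Tendsto (fun n => 2 * ‖g - p n * g‖) atTop (𝓝 0) := by
    have := (tendsto_const_nhds (x := g)).sub h
    simpa using this.norm.const_mul 2
  refine squeeze_zero (fun _ => norm_nonneg _) (fun n => ?_) h1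
  have : compress (p n) g = (g - p n * g) - (g - p n * g) * p n := by
    simp only [compress]; noncomm_ring
  rw [this, two_mul]
  refine (norm_sub_le _ _).trans (add_le_add le_rfl ((norm_mul_le _ _).trans ?_))
  exact mul_le_of_le_one_right (norm_nonneg _) (hp1 n)

/-- The elements on which the cut-offs of `w` act as an approximate unit form a hereditary
subalgebra: by `tendsto_of_compress` and `tendsto_compress_of_tendsto`, for `x ≥ 0` this is the condition
`‖(1 - f(w)) x (1 - f(w))‖ → 0`, which is monotone in `x`. -/
theorem tendsto_apx_mul {w x : D} (hw : 0 ≤ w) (hx : x ∈ Her w) :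
    Tendsto (fun n => apx w n * x) atTop (𝓝 x) := by
  have hn (n : ℕ) : ‖apx w n‖ ≤ 1 := norm_cutoff_le _ w
  have hsa := apx_isSelfAdjoint w
  have hstar {x : D} (h : Tendsto (fun n => x * apx w n) atTop (𝓝 x)) :
      Tendsto (fun n => apx w n * star x) atTop (𝓝 (star x)) :=
    h.star.congr fun n => by rw [star_mul, (hsa n).star_eq]
  have hstar' {x : D} (h : Tendsto (fun n => apx w n * x) atTop (𝓝 x)) :
      Tendsto (fun n => star x * apx w n) atTop (𝓝 (star x)) :=
    h.star.congr fun n => by rw [star_mul, (hsa n).star_eq]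
  let B : NonUnitalStarSubalgebra ℂ D :=
    { carrier := {x | Tendsto (fun n => apx w n * x) atTop (𝓝 x) ∧
        Tendsto (fun n => x * apx w n) atTop (𝓝 x)}
      add_mem' := fun {x y} hx hy =>
        ⟨by simpa [mul_add] using hx.1.add hy.1, by simpa [add_mul] using hx.2.add hy.2⟩
      zero_mem' := by simp
      mul_mem' := fun {x y} hx hy =>
        ⟨by simpa [mul_assoc] using hx.1.mul_const y,
          by simpa [mul_assoc] using hy.2.const_mul x⟩
      smul_mem' := fun c x hx =>
        ⟨by simpa only [mul_smul_comm] using hx.1.const_smul c,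
          by simpa only [smul_mul_assoc] using hx.2.const_smul c⟩
      star_mem' := fun {x} hx => ⟨hstar hx.2, hstar' hx.1⟩ }
  have hB1 : ∀ {x}, x ∈ B ↔ Tendsto (fun n => apx w n * x) atTop (𝓝 x) ∧
        Tendsto (fun n => x * apx w n) atTop (𝓝 x) := Iff.rfl
  have key : ∀ x, 0 ≤ x → Tendsto (fun n => ‖compress (apx w n) x‖) atTop (𝓝 0) → x ∈ B := by
    intro x hx h
    have h1 := tendsto_of_compress hsa hx h
    refine hB1.2 ⟨h1, ?_⟩
    have h2 := hstar' h1
    rwa [(IsSelfAdjoint.of_nonneg hx).star_eq] at h2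
  have hB : IsHereditary B := by
    constructor
    · refine isClosed_of_closure_subset fun x hx => ?_
      have hcl : ∀ ε > 0, ∃ y ∈ B, ‖x - y‖ < ε := fun ε hε => by
        obtain ⟨y, hy, h⟩ := Metric.mem_closure_iff.1 hx ε hε
        exact ⟨y, hy, by rwa [← dist_eq_norm]⟩
      refine hB1.2 ⟨?_, ?_⟩ <;> rw [Metric.tendsto_atTop] <;> intro ε hε
      all_goals
        obtain ⟨y, hy, hxy⟩ := hcl (ε / 3) (by positivity)
        rw [hB1] at hy
      · obtain ⟨N, hN⟩ := Metric.tendsto_atTop.1 hy.1 (ε / 3) (by positivity)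
        refine ⟨N, fun n hnN => ?_⟩
        have h1 := hN n hnN
        rw [dist_eq_norm] at h1 ⊢
        have e : apx w n * x - x = apx w n * (x - y) + (apx w n * y - y) - (x - y) := by
          noncomm_ring
        have h2 : ‖apx w n * (x - y)‖ ≤ ‖x - y‖ :=
          (norm_mul_le _ _).trans (mul_le_of_le_one_left (norm_nonneg _) (hn n))
        rw [e]
        have h3 := norm_sub_le (apx w n * (x - y) + (apx w n * y - y)) (x - y)
        have h4 := norm_add_le (apx w n * (x - y)) (apx w n * y - y)
        linarith
      · obtain ⟨N, hN⟩ := Metric.tendsto_atTop.1 hy.2 (ε / 3) (by positivity)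
        refine ⟨N, fun n hnN => ?_⟩
        have h1 := hN n hnN
        rw [dist_eq_norm] at h1 ⊢
        have e : x * apx w n - x = (x - y) * apx w n + (y * apx w n - y) - (x - y) := by
          noncomm_ring
        have h2 : ‖(x - y) * apx w n‖ ≤ ‖x - y‖ :=
          (norm_mul_le _ _).trans (mul_le_of_le_one_right (norm_nonneg _) (hn n))
        rw [e]
        have h3 := norm_sub_le ((x - y) * apx w n + (y * apx w n - y)) (x - y)
        have h4 := norm_add_le ((x - y) * apx w n) (y * apx w n - y)
        linarith
    · intro x y hx hxy hy
      refine key x hx (squeeze_zero (fun _ => norm_nonneg _)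
        (fun n => norm_compress_mono (hsa n) hx hxy) (tendsto_compress_of_tendsto hn (hB1.1 hy).1))
  exact (hB1.1 (Her_le hB (key w hw (tendsto_compress_apx hw)) hx)).1

/-- The continuous function `s ↦ f_ε(s) / √s`. The denominator is modified where the numerator
vanishes. -/
def cutoffDivSqrt (ε s : ℝ) : ℝ := cutoff ε s / √(max s ε)

theorem continuous_cutoffDivSqrt {ε : ℝ} (hε : 0 < ε) : Continuous (cutoffDivSqrt ε) := by
  unfold cutoffDivSqrt
  refine (continuous_cutoff ε).div (by fun_prop) fun s => ?_
  exact (Real.sqrt_pos.2 (hε.trans_le (le_max_right _ _))).ne'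

/-- Despite the cut-off at `ε` in the denominator, `cutoffDivSqrt` serves as an inverse square root. -/
theorem cutoffDivSqrt_mul {ε : ℝ} (hε : 0 < ε) (δ s : ℝ) (hδ : 0 < δ) :
    s * cutoffDivSqrt ε s * cutoffDivSqrt δ s = cutoff ε s * cutoff δ s := by
  unfold cutoffDivSqrt
  rcases le_or_gt s ε with h | h
  · simp [cutoff_eq_zero hε h]
  rcases le_or_gt s δ with h' | h'
  · simp [cutoff_eq_zero hδ h']
  have hs : 0 < s := hε.trans h
  rw [max_eq_left h.le, max_eq_left h'.le]
  have := Real.mul_self_sqrt hs.le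
  have h0 := (Real.sqrt_pos.2 hs).ne'
  field_simp
  rw [sq, this]; ring

/-- A positive element `g` of the hereditary subalgebra generated by `w = Σ uᵢ⋆ uᵢ` is of the form
`Σ yᵢ⋆ yᵢ`, where `yᵢ` lies in the closed right ideal generated by `uᵢ`. Formally,
`yᵢ = uᵢ w^{-1/2} g^{1/2}`; the limit of `uᵢ k_n(w) g^{1/2}`, where `k_n(s) = f_{1/(n+1)}(s) / √s`,
exists and takes its place. -/
theorem exists_sum_star_mul {ι : Type*} [Fintype ι] (u : ι → D) {g : D} (hg0 : 0 ≤ g)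
    (hg : g ∈ Her (∑ i, star (u i) * u i)) :
    ∃ y : ι → D, ∑ i, star (y i) * y i = g ∧ ∀ i h, h * u i = u i → h * y i = y i := by
  set w := ∑ i, star (u i) * u i with hw_def
  have hw : 0 ≤ w := Finset.sum_nonneg fun i _ => star_mul_self_nonneg _
  have hwsa := IsSelfAdjoint.of_nonneg hw
  set r := CFC.sqrt g
  have hr := tendsto_apx_mul hw (sqrt_mem_Her hg hg0)
  have hn (n : ℕ) : (0 : ℝ) < 1 / (n + 1) := by positivity
  let k (n : ℕ) : D := cfcₙ (cutoffDivSqrt (1 / (n + 1))) w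
  have hk0 (ε : ℝ) : cutoffDivSqrt ε 0 = 0 := by simp [cutoffDivSqrt]
  have hksa (n) : star (k n) = k n := (cfcₙ_predicate (cutoffDivSqrt (1 / (n + 1))) w).star_eq
  have hkw (n m : ℕ) : k n * w * k m = apx w n * apx w m := by
    have := continuous_cutoffDivSqrt (hn n)
    have := continuous_cutoffDivSqrt (hn m)
    have := hk0
    have e : k n * w * k m = k n * cfcₙ (fun s : ℝ => s) w * k m := by rw [cfcₙ_id' ℝ w]
    rw [e, apx, apx, ← cfcₙ_mul .., ← cfcₙ_mul .., ← cfcₙ_mul ..]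
    congr 1; ext s
    rw [← cutoffDivSqrt_mul (hn n) _ s (hn m)]; ring
  have hsum (v : D) : ∑ i, star (u i * v) * (u i * v) = star v * w * v := by
    rw [hw_def, Finset.mul_sum, Finset.sum_mul]
    exact Finset.sum_congr rfl fun i _ => by simp [star_mul, mul_assoc]
  have hsq (n m : ℕ) : star ((k n - k m) * r) * w * ((k n - k m) * r) =
      star ((apx w n - apx w m) * r) * ((apx w n - apx w m) * r) := by
    have e : (k n - k m) * w * (k n - k m) =
        (apx w n - apx w m) * (apx w n - apx w m) := by
      simp only [sub_mul, mul_sub, hkw]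
    calc star ((k n - k m) * r) * w * ((k n - k m) * r)
        = star r * ((k n - k m) * w * (k n - k m)) * r := by
          rw [star_mul, star_sub, hksa, hksa]; simp only [mul_assoc]
      _ = _ := by
          rw [e, star_mul, star_sub, (apx_isSelfAdjoint w n).star_eq,
            (apx_isSelfAdjoint w m).star_eq]
          simp only [mul_assoc]
  -- one summand of `Σ ‖·‖²` is dominated by the whole sum, which `hsum` and `hsq` compute
  have hcauchy (i : ι) : CauchySeq fun n => u i * (k n * r) := by
    have hc := hr.cauchySeq
    rw [Metric.cauchySeq_iff] at hc ⊢
    intro ε hε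
    obtain ⟨N, hN⟩ := hc ε hε
    refine ⟨N, fun n hn m hm => lt_of_le_of_lt ?_ (hN n hn m hm)⟩
    rw [dist_eq_norm, dist_eq_norm, ← mul_sub, ← sub_mul, ← sub_mul]
    refine le_of_sq_le_sq ?_ (norm_nonneg _)
    rw [sq, sq, ← CStarRing.norm_star_mul_self, ← CStarRing.norm_star_mul_self, ← hsq, ← hsum]
    exact CStarAlgebra.norm_le_norm_of_nonneg_of_le (star_mul_self_nonneg _)
      (Finset.single_le_sum (f := fun i => star (u i * ((k n - k m) * r)) *
        (u i * ((k n - k m) * r))) (fun i _ => star_mul_self_nonneg _) (Finset.mem_univ i))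
  choose y hy using fun i => cauchySeq_tendsto_of_complete (hcauchy i)
  refine ⟨y, ?_, fun i h hh => ?_⟩
  · have h1 : Tendsto (fun n => ∑ i, star (u i * (k n * r)) * (u i * (k n * r))) atTop
        (𝓝 (∑ i, star (y i) * y i)) :=
      tendsto_finsetSum _ fun i _ => (hy i).star.mul (hy i)
    have h2 : Tendsto (fun n => star (apx w n * r) * (apx w n * r)) atTop (𝓝 g) := by
      have := hr.star.mul hr
      rwa [(sqrt_isSelfAdjoint g).star_eq, CFC.sqrt_mul_sqrt_self g hg0] at this
    refine tendsto_nhds_unique h1 (h2.congr fun n => ?_)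
    rw [hsum, star_mul, star_mul, hksa, (apx_isSelfAdjoint w n).star_eq]
    calc star r * apx w n * (apx w n * r) = star r * (apx w n * apx w n) * r := by
          simp only [mul_assoc]
      _ = _ := by rw [← hkw]; simp only [mul_assoc]
  · have h1 := (hy i).const_mul h
    refine tendsto_nhds_unique h1 ((hy i).congr fun n => ?_)
    show u i * (k n * r) = h * (u i * (k n * r))
    rw [← mul_assoc h, hh]

theorem exists_star_mul_eq {z g : D} (hg0 : 0 ≤ g) (hg : g ≤ star z * z) :
    ∃ y : D, star y * y = g ∧ ∀ h, h * z = z → h * y = y := by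
  obtain ⟨y, hy, h⟩ := exists_sum_star_mul (fun _ : Unit => z) hg0 (by
    simpa using (isHereditary_Her _).mem_of_le _ _ hg0 hg (mem_Her_self _))
  exact ⟨y (), by simpa using hy, h ()⟩

end Her

end CStarAlgebra

/-! ### The Pedersen ideal -/

section PedLike

variable {D : Type u} [NonUnitalCStarAlgebra D]

/-- The elements `u⋆ u` such that `u` has a left local unit in `P`. -/
def unitalSquares (P : NonUnitalStarSubalgebra ℂ D) : Set D :=
  {z | ∃ u, star u * u = z ∧ ∃ h ∈ P, h * u = u}

/-- The properties of the Pedersen ideal on which the theory of quasitraces rests: `P` is a dense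
ideal, and it is spanned by squares `u⋆ u` with local units in `P`. They pass to matrices. -/
structure IsPedLike (P : NonUnitalStarSubalgebra ℂ D) : Prop where
  ideal : IsDenseIdeal P.toNonUnitalSubalgebra.toSubmodule
  gen : ∀ x ∈ P, x ∈ Submodule.span ℂ (unitalSquares P)

theorem IsPedLike.mul_mem_left {P : NonUnitalStarSubalgebra ℂ D} (hP : IsPedLike P) (a : D) {x : D}
    (hx : x ∈ P) : a * x ∈ P := hP.ideal.mul_mem_left a x hx

theorem IsPedLike.mul_mem_right {P : NonUnitalStarSubalgebra ℂ D} (hP : IsPedLike P) (a : D) {x : D}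
    (hx : x ∈ P) : x * a ∈ P := hP.ideal.mul_mem_right a x hx

theorem IsPedLike.cfc_mem {P : NonUnitalStarSubalgebra ℂ D} (hP : IsPedLike P) {δ : ℝ} (hδ : 0 < δ)
    {g : ℝ → ℝ} (hg : ∀ t ≤ δ, g t = 0) (a : D) : cfcₙ g a ∈ P := hP.ideal.cfc_mem hδ hg a

theorem IsPedLike.cutoff_mem {P : NonUnitalStarSubalgebra ℂ D} (hP : IsPedLike P) {δ : ℝ}
    (hδ : 0 < δ) (a : D) : cfcₙ (cutoff δ) a ∈ P :=
  hP.cfc_mem hδ (fun _ ht => cutoff_eq_zero hδ ht) a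

/-- The polarization identity. -/
theorem four_smul_star_mul (x y : D) : (4 : ℂ) • (star x * y) =
    star (x + y) * (x + y) - star (x - y) * (x - y)
      - Complex.I • (star (x + Complex.I • y) * (x + Complex.I • y))
      + Complex.I • (star (x - Complex.I • y) * (x - Complex.I • y)) := by
  simp only [star_add, star_sub, star_smul, add_mul, sub_mul, mul_add, mul_sub, smul_mul_assoc,
    mul_smul_comm, smul_add, smul_sub, smul_smul, Complex.star_def, Complex.conj_I]
  simp only [mul_neg, Complex.I_mul_I, neg_neg, neg_smul, one_smul]
  module

theorem star_mul_mem_span {P : NonUnitalStarSubalgebra ℂ D} {x y h : D} (hh : h ∈ P)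
    (hx : h * x = x) (hy : h * y = y) : star x * y ∈ Submodule.span ℂ (unitalSquares P) := by
  have hs (v : D) (hv : h * v = v) : star v * v ∈ Submodule.span ℂ (unitalSquares P) :=
    Submodule.subset_span ⟨v, rfl, h, hh, hv⟩
  have h4 : (4 : ℂ) • (star x * y) ∈ Submodule.span ℂ (unitalSquares P) := by
    rw [four_smul_star_mul]
    refine add_mem (sub_mem (sub_mem (hs _ ?_) (hs _ ?_)) (Submodule.smul_mem _ _ (hs _ ?_)))
      (Submodule.smul_mem _ _ (hs _ ?_))
    · rw [mul_add, hx, hy]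
    · rw [mul_sub, hx, hy]
    · rw [mul_add, hx, mul_smul_comm, hy]
    · rw [mul_sub, hx, mul_smul_comm, hy]
  have := Submodule.smul_mem _ (4 : ℂ)⁻¹ h4
  rwa [smul_smul, inv_mul_cancel₀ (by norm_num), one_smul] at this

section Order

variable [PartialOrder D] [StarOrderedRing D]

/-- Real parts of elements of the span of squares are dominated by sums of squares. The scalar `c` is
needed for the induction. -/
theorem exists_le_sum {P : NonUnitalStarSubalgebra ℂ D} {x : D}
    (hx : x ∈ Submodule.span ℂ (unitalSquares P)) (c : ℂ) :
    ∃ (ι : Type) (_ : Fintype ι) (u : ι → D), (∀ i, ∃ h ∈ P, h * u i = u i) ∧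
      c • x + star (c • x) ≤ ∑ i, star (u i) * u i := by
  induction hx using Submodule.span_induction generalizing c with
  | mem x hx =>
    obtain ⟨u, rfl, h, hP, hu⟩ := hx
    refine ⟨Unit, inferInstance, fun _ => ((√(2 * ‖c‖) : ℝ) : ℂ) • u, fun _ => ⟨h, hP, by
      rw [mul_smul_comm, hu]⟩, ?_⟩
    have h1 : star (((√(2 * ‖c‖) : ℝ) : ℂ) • u) * (((√(2 * ‖c‖) : ℝ) : ℂ) • u) =
        (2 * ‖c‖) • (star u * u) := by
      rw [star_smul, smul_mul_assoc, mul_smul_comm, smul_smul, Complex.star_def, Complex.conj_ofReal,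
        ← Complex.ofReal_mul, Real.mul_self_sqrt (by positivity)]
      rfl
    have h2 : c • (star u * u) + star (c • (star u * u)) = (2 * c.re) • (star u * u) := by
      rw [star_smul, star_mul, star_star, ← add_smul, Complex.star_def, Complex.add_conj]
      rfl
    rw [Fintype.sum_unique, h1, h2]
    exact smul_le_smul_of_nonneg_right (by linarith [Complex.re_le_norm c])
      (star_mul_self_nonneg u)
  | zero => exact ⟨Empty, inferInstance, Empty.elim, fun i => i.elim, by simp⟩
  | add x y _ _ hx hy =>
    obtain ⟨ι, _, u, hu, h1⟩ := hx c
    obtain ⟨κ, _, v, hv, h2⟩ := hy c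
    refine ⟨ι ⊕ κ, inferInstance, Sum.elim u v, ?_, ?_⟩
    · rintro (i | i)
      · exact hu i
      · exact hv i
    · rw [Fintype.sum_sum_type]
      refine le_of_eq_of_le ?_ (add_le_add h1 h2)
      rw [smul_add, star_add]; abel
  | smul a x _ hx =>
    obtain ⟨ι, _, u, hu, h1⟩ := hx (c * a)
    exact ⟨ι, _, u, hu, by rwa [smul_smul]⟩

/-- The positive part of `P` is hereditary; indeed `P` contains the positive cone of the hereditary
C⋆-algebra generated by any of its positive elements. -/
theorem IsPedLike.mem_of_mem_Her {P : NonUnitalStarSubalgebra ℂ D} (hP : IsPedLike P) {b x : D}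
    (hb : b ∈ P) (hb0 : 0 ≤ b) (hx : x ∈ Her b) (hx0 : 0 ≤ x) : x ∈ P := by
  obtain ⟨ι, _, u, hu, h⟩ := exists_le_sum (hP.gen b hb) 1
  have hbw : b ∈ Her (∑ i, star (u i) * u i) := by
    refine (isHereditary_Her _).mem_of_le _ _ hb0 (le_trans ?_ h) (mem_Her_self _)
    rw [one_smul, (IsSelfAdjoint.of_nonneg hb0).star_eq]
    exact le_add_of_nonneg_left hb0
  obtain ⟨y, hy, hyu⟩ := exists_sum_star_mul u hx0 (Her_mono hbw hx)
  rw [← hy]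
  refine sum_mem fun i _ => hP.mul_mem_left _ ?_
  obtain ⟨k, hk, hku⟩ := hu i
  rw [← hyu i k hku]
  exact hP.mul_mem_right _ hk

theorem IsPedLike.sqrt_mem {P : NonUnitalStarSubalgebra ℂ D} (hP : IsPedLike P) {b : D}
    (hb : b ∈ P) (hb0 : 0 ≤ b) : CFC.sqrt b ∈ P :=
  hP.mem_of_mem_Her hb hb0 (sqrt_mem_Her (mem_Her_self b) hb0) (CFC.sqrt_nonneg b)

theorem cfc_mem_Her_sq {x : D} (hx : IsSelfAdjoint x) {g : ℝ → ℝ} (hg : Continuous g)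
    (hg0 : ∀ s, 0 ≤ g s) (hgs : ∀ s, g s ^ 2 ≤ s ^ 2) : cfcₙ g x ∈ Her (x * x) := by
  have h0 : g 0 = 0 := by
    have := hgs 0
    exact pow_eq_zero_iff (n := 2) (by norm_num) |>.1
      (le_antisymm (by simpa using this) (sq_nonneg _))
  have hy0 : 0 ≤ cfcₙ g x := cfcₙ_nonneg fun s _ => hg0 s
  have h1 : cfcₙ g x * cfcₙ g x ≤ x * x := by
    have e : x * x = cfcₙ (fun s : ℝ => s * s) x := by
      rw [cfcₙ_mul (fun s : ℝ => s) (fun s : ℝ => s) .., cfcₙ_id' ℝ x]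
    rw [e, ← cfcₙ_mul ..]
    exact cfcₙ_mono fun s _ => by have := hgs s; nlinarith
  have h2 : cfcₙ g x * cfcₙ g x ∈ Her (x * x) :=
    (isHereditary_Her _).mem_of_le _ _ (IsSelfAdjoint.of_nonneg hy0).mul_self_nonneg h1
      (mem_Her_self _)
  have h3 := sqrt_mem_Her h2 (IsSelfAdjoint.of_nonneg hy0).mul_self_nonneg
  rwa [CFC.sqrt_mul_self _ hy0] at h3

/-- For self-adjoint `x ∈ P`, the functional calculus stays in `P` for functions `g ≥ 0` with
`g(s) ≤ |s|`, because `g(x)` lies in the hereditary subalgebra of `x²`. -/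
theorem IsPedLike.cfc_mem_of_sq_le {P : NonUnitalStarSubalgebra ℂ D} (hP : IsPedLike P) {x : D}
    (hx : x ∈ P) (hsa : IsSelfAdjoint x) {g : ℝ → ℝ} (hg : Continuous g)
    (hg0 : ∀ s, 0 ≤ g s) (hgs : ∀ s, g s ^ 2 ≤ s ^ 2) : cfcₙ g x ∈ P :=
  hP.mem_of_mem_Her (mul_mem hx hx) hsa.mul_self_nonneg (cfc_mem_Her_sq hsa hg hg0 hgs)
    (cfcₙ_nonneg fun s _ => hg0 s)

theorem dense_of_cfc_mem {J : Submodule ℂ D}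
    (hJ : ∀ a : D, 0 ≤ a → ∀ δ : ℝ, 0 < δ → cfcₙ (fun t : ℝ => max (t - δ) 0) a ∈ J) :
    Dense (J : Set D) := by
  rw [Submodule.dense_iff_topologicalClosure_eq_top, eq_top_iff, ← CStarAlgebra.span_nonneg,
    Submodule.span_le]
  intro a (ha : 0 ≤ a)
  refine Metric.mem_closure_iff.2 fun ε hε => ?_
  have hsa : IsSelfAdjoint a := IsSelfAdjoint.of_nonneg ha
  refine ⟨_, hJ a ha (ε / 2) (half_pos hε), ?_⟩
  rw [dist_eq_norm]
  conv_lhs => enter [1, 1]; rw [← cfcₙ_id' ℝ a hsa]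
  rw [← cfcₙ_sub (fun x : ℝ => x) (fun t : ℝ => max (t - ε / 2) 0) a (by fun_prop) rfl
    (by fun_prop) (max_eq_right (by linarith))]
  refine (norm_cfcₙ_le fun t ht => ?_).trans_lt (half_lt_self hε)
  have ht0 : 0 ≤ t := quasispectrum_nonneg_of_nonneg a ha t ht
  rw [Real.norm_eq_abs, abs_le]
  rcases le_total (t - ε / 2) 0 with h | h
  · rw [max_eq_right h]; constructor <;> linarith
  · rw [max_eq_left h]; constructor <;> linarith

/-- `f_{δ/2}(a)` is a local unit for every `g(a)` such that `g` vanishes below `δ`. -/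
theorem mul_cfc_eq_self {δ : ℝ} (hδ : 0 < δ) {g : ℝ → ℝ} (hgc : Continuous g)
    (hg : ∀ t ≤ δ, g t = 0) (a : D) : cfcₙ (cutoff (δ / 2)) a * cfcₙ g a = cfcₙ g a := by
  have h0 : g 0 = 0 := hg 0 hδ.le
  rw [← cfcₙ_mul ..]
  refine cfcₙ_congr fun t _ => ?_
  rcases le_total t δ with h | h
  · simp [hg t h]
  · simp [cutoff_eq_one (half_pos hδ) (show 2 * (δ / 2) ≤ t by linarith)]

/-- Polarization turns the squares with local units into products `x⋆ y`, so that their span is an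
ideal; it contains the functional calculus that makes an ideal dense. -/
theorem isDenseIdeal_span (P : NonUnitalStarSubalgebra ℂ D)
    (hP : ∀ a : D, 0 ≤ a → ∀ δ : ℝ, 0 < δ → cfcₙ (cutoff δ) a ∈ P) :
    IsDenseIdeal (Submodule.span ℂ (unitalSquares P)) where
  mul_mem_left a x hx := by
    induction hx using Submodule.span_induction with
    | mem x hx =>
      obtain ⟨u, rfl, h, hh, hu⟩ := hx
      have : a * (star u * u) = star (u * star a) * u := by
        rw [star_mul, star_star, mul_assoc]
      rw [this]
      exact star_mul_mem_span hh (by rw [← mul_assoc, hu]) hu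
    | zero => simp
    | add x y _ _ hx hy => rw [mul_add]; exact add_mem hx hy
    | smul c x _ hx => rw [mul_smul_comm]; exact Submodule.smul_mem _ _ hx
  mul_mem_right a x hx := by
    induction hx using Submodule.span_induction with
    | mem x hx =>
      obtain ⟨u, rfl, h, hh, hu⟩ := hx
      rw [mul_assoc]
      exact star_mul_mem_span hh hu (by rw [← mul_assoc, hu])
    | zero => simp
    | add x y _ _ hx hy => rw [add_mul]; exact add_mem hx hy
    | smul c x _ hx => rw [smul_mul_assoc]; exact Submodule.smul_mem _ _ hx
  dense := dense_of_cfc_mem fun a ha δ hδ => by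
    have h0 : √(max (0 - δ) 0) = 0 := by rw [max_eq_right (by linarith), Real.sqrt_zero]
    refine Submodule.subset_span ⟨cfcₙ (fun t : ℝ => √(max (t - δ) 0)) a, ?_,
      cfcₙ (cutoff (δ / 2)) a, hP a ha _ (half_pos hδ), ?_⟩
    · rw [(cfcₙ_predicate (R := ℝ) _ a).star_eq, ← cfcₙ_mul ..]
      congr 1; ext t
      exact Real.mul_self_sqrt (le_max_right _ _)
    · exact mul_cfc_eq_self hδ (by fun_prop) (fun t ht => by
        rw [max_eq_right (by linarith), Real.sqrt_zero]) a

end Order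

theorem dense_Ped : Dense (Ped D : Set D) := by
  let _ : PartialOrder D := CStarAlgebra.spectralOrder D
  have : StarOrderedRing D := CStarAlgebra.spectralOrderedRing D
  exact dense_of_cfc_mem (J := (Ped D).toNonUnitalSubalgebra.toSubmodule) fun a _ δ hδ =>
    cfc_mem_Ped hδ (fun t ht => max_eq_right (by linarith)) a

theorem isPedLike_Ped : IsPedLike (Ped D) where
  ideal := ⟨fun a _ hx J hJ => hJ.mul_mem_left _ _ (hx J hJ),
    fun a _ hx J hJ => hJ.mul_mem_right _ _ (hx J hJ), dense_Ped⟩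
  gen x hx := by
    let _ : PartialOrder D := CStarAlgebra.spectralOrder D
    have : StarOrderedRing D := CStarAlgebra.spectralOrderedRing D
    exact hx _ (isDenseIdeal_span (Ped D) fun a _ δ hδ =>
      cfc_mem_Ped hδ (fun t ht => cutoff_eq_zero hδ ht) a)

end PedLike

/-! ### Matrices of size two -/

section Matrix

variable {D : Type u} [NonUnitalCStarAlgebra D] [PartialOrder D] [StarOrderedRing D]

variable (D) in
/-- The C⋆-algebra `M₂(D)`. -/
def M₂ : Type u := CStarMatrix (Fin 2) (Fin 2) D

-- The type is not reducible: the real scalar multiplication on `CStarMatrix` is not syntactically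
-- the one that the C⋆-structure induces, and the functional calculus needs the latter.
instance : NonUnitalCStarAlgebra (M₂ D) :=
  inferInstanceAs (NonUnitalCStarAlgebra (CStarMatrix (Fin 2) (Fin 2) D))
instance : PartialOrder (M₂ D) := inferInstanceAs (PartialOrder (CStarMatrix (Fin 2) (Fin 2) D))
instance : StarOrderedRing (M₂ D) :=
  inferInstanceAs (StarOrderedRing (CStarMatrix (Fin 2) (Fin 2) D))

/-- The entries of a matrix. -/
def M₂.entry (x : M₂ D) (i j : Fin 2) : D := (show CStarMatrix (Fin 2) (Fin 2) D from x) i j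

theorem M₂.ext {x y : M₂ D} (h : ∀ i j, x.entry i j = y.entry i j) : x = y := CStarMatrix.ext h

theorem M₂.add_entry (x y : M₂ D) (i j : Fin 2) : (x + y).entry i j = x.entry i j + y.entry i j :=
  rfl

@[simp] theorem M₂.zero_entry (i j : Fin 2) : (0 : M₂ D).entry i j = 0 := rfl

theorem M₂.mul_entry (x y : M₂ D) (i j : Fin 2) :
    (x * y).entry i j = ∑ k, x.entry i k * y.entry k j := CStarMatrix.mul_apply

theorem M₂.star_entry (x : M₂ D) (i j : Fin 2) : (star x).entry i j = star (x.entry j i) := rfl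

/-- The matrix with the single entry `x` in place `(i, j)`. -/
def unit₂ (i j : Fin 2) : D →ₗ[ℂ] M₂ D where
  toFun x := CStarMatrix.ofMatrix (Matrix.single i j x)
  map_add' x y := by rw [Matrix.single_add]; rfl
  map_smul' c x := by
    refine CStarMatrix.ext fun k l => ?_
    show Matrix.single i j (c • x) k l = c • Matrix.single i j x k l
    simp [Matrix.single_apply]

theorem unit₂_entry (i j : Fin 2) (x : D) (k l : Fin 2) :
    (unit₂ i j x).entry k l = if i = k ∧ j = l then x else 0 := rfl

theorem unit₂_mul_same (i j l : Fin 2) (x y : D) : unit₂ i j x * unit₂ j l y = unit₂ i l (x * y) :=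
  Matrix.single_mul_single_same (c := x) i j l y

theorem unit₂_mul_of_ne (i l : Fin 2) {j k : Fin 2} (h : j ≠ k) (x y : D) :
    unit₂ i j x * unit₂ k l y = 0 :=
  Matrix.single_mul_single_of_ne (c := x) i j k h y

theorem star_unit₂ (i j : Fin 2) (x : D) : star (unit₂ i j x) = unit₂ j i (star x) := by
  refine M₂.ext fun k l => ?_
  rw [M₂.star_entry, unit₂_entry, unit₂_entry]
  simp only [and_comm (a := i = l)]
  split_ifs <;> simp

theorem eq_sum_unit₂ (x : M₂ D) : x = ∑ i, ∑ j, unit₂ i j (x.entry i j) :=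
  Matrix.matrix_eq_sum_single (show Matrix (Fin 2) (Fin 2) D from x)

/-- The embedding of `D` into `M₂(D)` as a diagonal corner. -/
def diag₂ (i : Fin 2) : D →⋆ₙₐ[ℂ] M₂ D where
  toFun := unit₂ i i
  map_smul' := (unit₂ i i).map_smul
  map_zero' := map_zero _
  map_add' := map_add _
  map_mul' x y := (unit₂_mul_same i i i x y).symm
  map_star' x := (star_unit₂ i i x).symm

theorem diag₂_apply (i : Fin 2) (x : D) : diag₂ i x = unit₂ i i x := rfl

/-- The matrices with entries in `P`. -/
def mat₂ (P : NonUnitalStarSubalgebra ℂ D) : NonUnitalStarSubalgebra ℂ (M₂ D) where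
  carrier := {x | ∀ i j, x.entry i j ∈ P}
  add_mem' hx hy i j := add_mem (hx i j) (hy i j)
  zero_mem' _ _ := zero_mem P
  mul_mem' {x y} hx hy i j := by
    rw [M₂.mul_entry]
    exact sum_mem fun k _ => mul_mem (hx i k) (hy k j)
  smul_mem' c x hx i j := SMulMemClass.smul_mem c (hx i j)
  star_mem' {x} hx i j := by
    rw [M₂.star_entry]; exact star_mem (hx j i)

theorem unit₂_mem {P : NonUnitalStarSubalgebra ℂ D} (i j : Fin 2) {x : D} (hx : x ∈ P) :
    unit₂ i j x ∈ mat₂ P := fun k l => by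
  rw [unit₂_entry]; split_ifs
  · exact hx
  · exact zero_mem P

/-- The local unit of `u` serves for all the matrices that have `u` in their first row. -/
theorem IsPedLike.mat₂ {P : NonUnitalStarSubalgebra ℂ D} (hP : IsPedLike P) :
    IsPedLike (CStarStab.mat₂ P) where
  ideal := by
    refine ⟨fun a x hx i j => ?_, fun a x hx i j => ?_, ?_⟩
    · rw [M₂.mul_entry]
      exact sum_mem fun k _ => hP.mul_mem_left _ (hx k j)
    · rw [M₂.mul_entry]
      exact sum_mem fun k _ => hP.mul_mem_right _ (hx i k)
    · have h : Dense (Set.pi Set.univ fun _ : Fin 2 => Set.pi Set.univ fun _ : Fin 2 => (P : Set D)) :=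
        dense_pi _ fun i _ => dense_pi _ fun j _ => hP.ideal.dense
      refine Dense.mono (fun x hx => ?_) h
      exact fun i j => hx i trivial j trivial
  gen x hx := by
    rw [eq_sum_unit₂ x]
    refine sum_mem fun i _ => sum_mem fun j _ => ?_
    have h := Submodule.mem_map_of_mem (f := unit₂ i j) (hP.gen _ (hx i j))
    rw [Submodule.map_span] at h
    refine Submodule.span_le.2 ?_ h
    rintro _ ⟨_, ⟨u, rfl, k, hk, hu⟩, rfl⟩
    have : unit₂ i j (star u * u) = star (unit₂ 0 i u) * unit₂ 0 j u := by
      rw [star_unit₂, unit₂_mul_same]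
    rw [this]
    refine star_mul_mem_span (unit₂_mem 0 0 hk) ?_ ?_ <;> rw [unit₂_mul_same, hu]

end Matrix

/-! ### Comparison of elements under a quasitrace -/

section LocalTrace

variable {D : Type u} [NonUnitalCStarAlgebra D]

/-- The function `k(s) = (f_η(s) / (s - c))^{1/2}`; it solves `k(s)² (s - c) = f_η(s)`. -/
theorem exists_cutoff_root {c η : ℝ} (hc : 0 ≤ c) (hη : c < η) :
    ∃ k : ℝ → ℝ, Continuous k ∧ (∀ s ≤ η, k s = 0) ∧
      ∀ s, k s * s * k s - c * (k s * k s) = cutoff η s := by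
  have hη0 : 0 < η := hc.trans_lt hη
  have hpos (s : ℝ) : 0 < max s η - c := sub_pos.2 (hη.trans_le (le_max_right _ _))
  have hk0 : ∀ s ≤ η, √(cutoff η s / (max s η - c)) = 0 := fun s hs => by
    simp [cutoff_eq_zero hη0 hs]
  refine ⟨fun s => √(cutoff η s / (max s η - c)),
    ((continuous_cutoff η).div (by fun_prop) fun s => (hpos s).ne').sqrt, hk0, fun s => ?_⟩
  dsimp only
  rcases le_total s η with h | h
  · rw [hk0 s h, cutoff_eq_zero hη0 h]; ring
  · have h3 := Real.mul_self_sqrt (div_nonneg (cutoff_nonneg η s) (hpos s).le)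
    rw [max_eq_left h] at h3
    have h4 : s - c ≠ 0 := by have := hpos s; rw [max_eq_left h] at this; exact this.ne'
    rw [max_eq_left h]
    calc _ = (√(cutoff η s / (s - c)) * √(cutoff η s / (s - c))) * (s - c) := by ring
      _ = _ := by rw [h3]; field_simp

section Intertwine

variable [PartialOrder D] [StarOrderedRing D]

theorem cfc_diag₂ (a b : D) (ha : 0 ≤ a) (hb : 0 ≤ b) {f : ℝ → ℝ} (hf : Continuous f)
    (hf0 : f 0 = 0) :
    cfcₙ f (diag₂ 0 a + diag₂ 1 b) = diag₂ 0 (cfcₙ f a) + diag₂ 1 (cfcₙ f b) := by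
  have ha' := IsSelfAdjoint.of_nonneg ha
  have hb' := IsSelfAdjoint.of_nonneg hb
  rw [cfcₙ_add_of_mul_eq_zero (map_nonneg (diag₂ 0) ha) (map_nonneg (diag₂ 1) hb)
    (unit₂_mul_of_ne 0 1 (by decide) a b) hf hf0,
    NonUnitalStarAlgHomClass.map_cfcₙ (diag₂ 0) f a hf.continuousOn hf0 (map_continuous _) ha'
      (ha'.map _),
    NonUnitalStarAlgHomClass.map_cfcₙ (diag₂ 1) f b hf.continuousOn hf0 (map_continuous _) hb'
      (hb'.map _)]

/-- The relation `x f(x⋆ x) = f(x x⋆) x`. -/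
theorem mul_cfc_star_mul_self (x : D) {f : ℝ → ℝ} (hf : Continuous f) (hf0 : f 0 = 0) :
    x * cfcₙ f (star x * x) = cfcₙ f (x * star x) * x := by
  -- The matrix with off-diagonal entries `x⋆` and `x` commutes with functions of its square.
  let T : M₂ D := unit₂ 0 1 (star x) + unit₂ 1 0 x
  have h01 : (0 : Fin 2) ≠ 1 := by decide
  have h10 : (1 : Fin 2) ≠ 0 := by decide
  have hT : T * T = diag₂ 0 (star x * x) + diag₂ 1 (x * star x) := by
    simp only [T, diag₂_apply, add_mul, mul_add, unit₂_mul_same, unit₂_mul_of_ne _ _ h01,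
      unit₂_mul_of_ne _ _ h10]
    simp [add_comm]
  have hc : Commute (T * T) T := (Commute.refl T).mul_left (Commute.refl T)
  have h := hc.cfcₙ_real f
  rw [hT, cfc_diag₂ _ _ (star_mul_self_nonneg x) (mul_star_self_nonneg x) hf hf0] at h
  have h2 := congrArg (fun M : M₂ D => M.entry 1 0) h.eq
  simp only [T, diag₂_apply, add_mul, mul_add, unit₂_mul_same, unit₂_mul_of_ne _ _ h01,
    unit₂_mul_of_ne _ _ h10, M₂.add_entry, unit₂_entry] at h2
  simpa using h2.symm

end Intertwine

/-- The part of the axioms of a quasitrace on `P` that concerns the real parts of its values;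
`t` is a function on all of `D`, but only its values on `P` matter. -/
structure IsLocalTrace (P : NonUnitalStarSubalgebra ℂ D) (t : D → ℝ) : Prop where
  nonneg_star_mul : ∀ x ∈ P, 0 ≤ t (star x * x)
  tracial : ∀ x ∈ P, t (star x * x) = t (x * star x)
  add : ∀ a ∈ P, ∀ b ∈ P, IsSelfAdjoint a → IsSelfAdjoint b → Commute a b → t (a + b) = t a + t b
  smul : ∀ r : ℝ, ∀ a ∈ P, IsSelfAdjoint a → t (r • a) = r * t a

/-- The dimension `d_t(a) = sup_n t(f_{1/(n+1)}(a))`, as an element of `[0, ∞]`. -/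
def dim (t : D → ℝ) (a : D) : ℝ≥0∞ := ⨆ n : ℕ, ENNReal.ofReal (t (cfcₙ (cutoff (1 / (n + 1))) a))

namespace IsLocalTrace

variable [PartialOrder D] [StarOrderedRing D]
variable {P : NonUnitalStarSubalgebra ℂ D} {t : D → ℝ}

theorem nonneg (ht : IsLocalTrace P t) (hP : IsPedLike P) {x : D} (hx : x ∈ P) (hx0 : 0 ≤ x) :
    0 ≤ t x := by
  have := ht.nonneg_star_mul _ (hP.sqrt_mem hx hx0)
  rwa [(sqrt_isSelfAdjoint x).star_eq, CFC.sqrt_mul_sqrt_self x hx0] at this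

theorem mono (ht : IsLocalTrace P t) (hP : IsPedLike P) {a b : D} (ha : a ∈ P) (hb : b ∈ P)
    (hsa : IsSelfAdjoint a) (hsb : IsSelfAdjoint b) (hc : Commute a b) (hab : a ≤ b) :
    t a ≤ t b := by
  have h := ht.add a ha (b - a) (sub_mem hb ha) hsa (hsb.sub hsa) (hc.sub_right (Commute.refl a))
  rw [add_sub_cancel] at h
  have := ht.nonneg hP (sub_mem hb ha) (sub_nonneg.2 hab)
  linarith

theorem cfc_mono (ht : IsLocalTrace P t) (hP : IsPedLike P) {a : D} {f g : ℝ → ℝ}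
    (hfP : cfcₙ f a ∈ P) (hgP : cfcₙ g a ∈ P) (hf : Continuous f) (hg : Continuous g)
    (hf0 : f 0 = 0) (hg0 : g 0 = 0) (h : ∀ s ∈ quasispectrum ℝ a, f s ≤ g s) :
    t (cfcₙ f a) ≤ t (cfcₙ g a) :=
  ht.mono hP hfP hgP (cfcₙ_predicate f a) (cfcₙ_predicate g a) (cfcₙ_commute_cfcₙ f g a)
    (cfcₙ_mono h)

theorem cfc_add (ht : IsLocalTrace P t) {a : D} {f g : ℝ → ℝ}
    (hfP : cfcₙ f a ∈ P) (hgP : cfcₙ g a ∈ P) (hf : Continuous f) (hg : Continuous g)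
    (hf0 : f 0 = 0) (hg0 : g 0 = 0) :
    t (cfcₙ (fun s => f s + g s) a) = t (cfcₙ f a) + t (cfcₙ g a) := by
  rw [cfcₙ_add .., ht.add _ hfP _ hgP (cfcₙ_predicate f a) (cfcₙ_predicate g a)
    (cfcₙ_commute_cfcₙ f g a)]

theorem cfc_const_mul (ht : IsLocalTrace P t) {a : D} {f : ℝ → ℝ} (c : ℝ)
    (hfP : cfcₙ f a ∈ P) (hf : Continuous f) (hf0 : f 0 = 0) :
    t (cfcₙ (fun s => c * f s) a) = c * t (cfcₙ f a) := by
  rw [cfcₙ_const_mul .., ht.smul _ _ hfP (cfcₙ_predicate f a)]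

theorem cutoff_mono (ht : IsLocalTrace P t) (hP : IsPedLike P) {ε δ : ℝ} (hε : 0 < ε) (h : ε ≤ δ)
    (a : D) : t (cfcₙ (cutoff δ) a) ≤ t (cfcₙ (cutoff ε) a) :=
  ht.cfc_mono hP (hP.cutoff_mem (hε.trans_le h) a) (hP.cutoff_mem hε a) (by fun_prop) (by fun_prop)
    (by simp) (by simp) fun s _ => cutoff_le_cutoff hε h s

theorem cutoff_nonneg (ht : IsLocalTrace P t) (hP : IsPedLike P) {ε : ℝ} (hε : 0 < ε) (a : D) :
    0 ≤ t (cfcₙ (cutoff ε) a) :=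
  ht.nonneg hP (hP.cutoff_mem hε a) (cfcₙ_nonneg fun s _ => CStarStab.cutoff_nonneg ε s)

theorem cutoff_le_dim (ht : IsLocalTrace P t) (hP : IsPedLike P) {ε : ℝ} (hε : 0 < ε) (a : D) :
    ENNReal.ofReal (t (cfcₙ (cutoff ε) a)) ≤ dim t a := by
  obtain ⟨n, hn⟩ := exists_nat_one_div_lt hε
  exact le_trans (ENNReal.ofReal_le_ofReal (ht.cutoff_mono hP (by positivity) hn.le a))
    (le_iSup (fun n : ℕ => ENNReal.ofReal (t (cfcₙ (cutoff (1 / (n + 1))) a))) n)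

theorem dim_le {t : D → ℝ} {a : D} {C : ℝ≥0∞}
    (h : ∀ ε : ℝ, 0 < ε → ENNReal.ofReal (t (cfcₙ (cutoff ε) a)) ≤ C) : dim t a ≤ C :=
  iSup_le fun n => h _ (by positivity)

/-- For `k(s)² s = f_ε(s)` and `y = x k(x⋆ x)` one has `y⋆ y = f_ε(x⋆ x)` and `y y⋆ = f_ε(x x⋆)`. -/
theorem cutoff_star_mul (ht : IsLocalTrace P t) (hP : IsPedLike P) {ε : ℝ} (hε : 0 < ε) (x : D) :
    t (cfcₙ (cutoff ε) (star x * x)) = t (cfcₙ (cutoff ε) (x * star x)) := by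
  obtain ⟨k, hk, hk0, hks'⟩ := exists_cutoff_root le_rfl hε
  have hks (s : ℝ) : s * (k s * k s) = cutoff ε s := by rw [← hks']; ring
  have hk00 : k 0 = 0 := hk0 0 hε.le
  have hyP : x * cfcₙ k (star x * x) ∈ P :=
    hP.mul_mem_left _ (hP.cfc_mem hε hk0 _)
  have hid (a : D) (ha : IsSelfAdjoint a) : a * cfcₙ (fun s => k s * k s) a = cfcₙ (cutoff ε) a := by
    have e : a * cfcₙ (fun s => k s * k s) a =
      cfcₙ (fun s : ℝ => s) a * cfcₙ (fun s => k s * k s) a := by rw [cfcₙ_id' ℝ a]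
    rw [e, ← cfcₙ_mul ..]
    simp only [hks]
  have h1 : star (x * cfcₙ k (star x * x)) * (x * cfcₙ k (star x * x)) =
      cfcₙ (cutoff ε) (star x * x) := by
    have hc : Commute (cfcₙ k (star x * x)) (star x * x) :=
      ((Commute.refl (star x * x)).cfcₙ_real k)
    rw [star_mul, (cfcₙ_predicate k (star x * x)).star_eq, mul_assoc, ← mul_assoc (star x),
      ← mul_assoc, hc.eq, mul_assoc, ← cfcₙ_mul .., hid _ (IsSelfAdjoint.star_mul_self x)]
  have h2 : (x * cfcₙ k (star x * x)) * star (x * cfcₙ k (star x * x)) =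
      cfcₙ (cutoff ε) (x * star x) := by
    rw [star_mul, (cfcₙ_predicate k (star x * x)).star_eq, ← mul_assoc, mul_assoc x,
      ← cfcₙ_mul .., mul_cfc_star_mul_self x (by fun_prop) (by simp [hk00]), mul_assoc,
      ← hid _ (IsSelfAdjoint.mul_star_self x)]
    exact ((Commute.refl (x * star x)).cfcₙ_real _).eq
  rw [← h1, ht.tracial _ hyP, h2]

theorem dim_star_mul (ht : IsLocalTrace P t) (hP : IsPedLike P) (x : D) :
    dim t (star x * x) = dim t (x * star x) := by
  simp only [dim]
  congr 1; ext n
  rw [ht.cutoff_star_mul hP (by positivity)]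

/-- If `a` is dominated by `z⋆ z` up to an error of norm less than `η`, then `f_η(a)` is equivalent to
an element dominated by any local unit of `z`. Indeed `f_η(a) ≤ (z k)⋆ (z k)` for a function `k` of
`a`, so that `f_η(a) = y⋆ y` where `y` has the same left local units as `z`. -/
theorem cutoff_le_of_le_star_mul (ht : IsLocalTrace P t) (hP : IsPedLike P) {a z r h : D} {η : ℝ}
    (ha : IsSelfAdjoint a) (hr : IsSelfAdjoint r) (hle : a ≤ star z * z + r) (hη : ‖r‖ < η)
    (hh : h ∈ P) (hh0 : 0 ≤ h) (hh1 : ‖h‖ ≤ 1) (hz : h * z = z) :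
    t (cfcₙ (cutoff η) a) ≤ t h := by
  have hη0 : 0 < η := (norm_nonneg r).trans_lt hη
  obtain ⟨k, hk, hk0, hks⟩ := exists_cutoff_root (norm_nonneg r) hη
  have hk00 : k 0 = 0 := hk0 0 hη0.le
  set K := cfcₙ k a with hK
  have hKsa : star K = K := (cfcₙ_predicate k a).star_eq
  set g := cfcₙ (cutoff η) a with hg
  have hg0 : 0 ≤ g := cfcₙ_nonneg fun s _ => CStarStab.cutoff_nonneg η s
  have hgK : g = K * a * K - ‖r‖ • (K * K) := by
    have e : K * a * K = K * cfcₙ (fun s : ℝ => s) a * K := by rw [cfcₙ_id' ℝ a]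
    rw [e, hK, ← cfcₙ_mul .., ← cfcₙ_mul .., ← cfcₙ_mul .., ← cfcₙ_smul .., ← cfcₙ_sub .., hg]
    simp only [smul_eq_mul, hks]
  have hgle : g ≤ star (z * K) * (z * K) := by
    rw [hgK, sub_le_iff_le_add]
    calc K * a * K = star K * a * K := by rw [hKsa]
      _ ≤ star K * (star z * z + r) * K := star_left_conjugate_le_conjugate hle K
      _ = star (z * K) * (z * K) + star K * r * K := by rw [star_mul]; noncomm_ring
      _ ≤ star (z * K) * (z * K) + ‖r‖ • (star K * K) :=
        add_le_add le_rfl (CStarAlgebra.star_left_conjugate_le_norm_smul hr)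
      _ = _ := by rw [hKsa]
  obtain ⟨y, hy, hyh⟩ := exists_star_mul_eq hg0 hgle
  have hhy : h * y = y := hyh h (by rw [← mul_assoc, hz])
  have hyP : y ∈ P := by rw [← hhy]; exact hP.mul_mem_right _ hh
  have hhsa := IsSelfAdjoint.of_nonneg hh0
  have hhy' : star y * h = star y := by
    rw [← star_inj, star_mul, star_star, hhsa.star_eq, hhy]
  have hle2 : y * star y ≤ h := by
    have hn : ‖y * star y‖ ≤ 1 := by
      rw [CStarRing.norm_self_mul_star, ← CStarRing.norm_star_mul_self, hy]
      exact norm_cutoff_le _ _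
    calc y * star y = star h * (y * star y) * h := by
          rw [hhsa.star_eq, ← mul_assoc, hhy, mul_assoc, hhy']
      _ ≤ ‖y * star y‖ • (star h * h) :=
          CStarAlgebra.star_left_conjugate_le_norm_smul (IsSelfAdjoint.mul_star_self y)
      _ ≤ (1 : ℝ) • (star h * h) :=
          smul_le_smul_of_nonneg_right hn (star_mul_self_nonneg h)
      _ = h * h := by rw [one_smul, hhsa.star_eq]
      _ ≤ h := mul_self_le_self hh0 hh1
  rw [← hy, ht.tracial y hyP]
  refine ht.mono hP (mul_mem hyP (star_mem hyP)) hh (IsSelfAdjoint.mul_star_self y) hhsa ?_ hle2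
  show y * star y * h = h * (y * star y)
  rw [mul_assoc, hhy', ← mul_assoc, hhy]

end IsLocalTrace

end LocalTrace

/-! ### The dimension function of a quasitrace -/

section Dimension

variable {D : Type u} [NonUnitalCStarAlgebra D] [PartialOrder D] [StarOrderedRing D]

theorem norm_sub_cutdown_le {X : D} (hX : 0 ≤ X) {ε : ℝ} (hε : 0 < ε) :
    ‖X - cfcₙ (fun s : ℝ => max (s - ε) 0) X‖ ≤ ε := by
  have h0 : max (0 - ε) 0 = 0 := max_eq_right (by linarith)
  have e : X - cfcₙ (fun s : ℝ => max (s - ε) 0) X =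
      cfcₙ (fun s : ℝ => s - max (s - ε) 0) X := by
    rw [cfcₙ_sub (fun s : ℝ => s) (fun s : ℝ => max (s - ε) 0) .., cfcₙ_id' ℝ X]
  rw [e]
  refine norm_cfcₙ_le fun s hs => ?_
  have hs0 : 0 ≤ s := quasispectrum_nonneg_of_nonneg X hX s hs
  rw [Real.norm_eq_abs, abs_le]
  rcases le_total (s - ε) 0 with h | h
  · rw [max_eq_right h]; constructor <;> linarith
  · rw [max_eq_left h]; constructor <;> linarith

namespace IsLocalTrace

variable {P : NonUnitalStarSubalgebra ℂ D} {t : D → ℝ}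

/-- `cutoff_le_of_le_star_mul` for `z = (X - ε)₊^{1/2}`, which has the local unit `f_{ε/2}(X)`. -/
theorem cutoff_le_of_le_add (ht : IsLocalTrace P t) (hP : IsPedLike P) {a X r : D} {ε η : ℝ}
    (ha : IsSelfAdjoint a) (hX : 0 ≤ X) (hr : IsSelfAdjoint r) (hle : a ≤ X + r) (hε : 0 < ε)
    (hη : ‖r‖ + ε < η) : t (cfcₙ (cutoff η) a) ≤ t (cfcₙ (cutoff (ε / 2)) X) := by
  have hXsa := IsSelfAdjoint.of_nonneg hX
  have hz : star (cfcₙ (fun s : ℝ => √(max (s - ε) 0)) X) * cfcₙ (fun s : ℝ => √(max (s - ε) 0)) X =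
      cfcₙ (fun s : ℝ => max (s - ε) 0) X := by
    have h0 : √(max (0 - ε) 0) = 0 := by rw [max_eq_right (by linarith), Real.sqrt_zero]
    rw [(cfcₙ_predicate (R := ℝ) _ X).star_eq, ← cfcₙ_mul ..]
    congr 1; ext s
    exact Real.mul_self_sqrt (le_max_right _ _)
  have hXr := norm_sub_cutdown_le hX hε
  refine ht.cutoff_le_of_le_star_mul hP (z := cfcₙ (fun s : ℝ => √(max (s - ε) 0)) X)
    (r := X - cfcₙ (fun s : ℝ => max (s - ε) 0) X + r) ha
    ((hXsa.sub (cfcₙ_predicate _ X)).add hr) ?_ ?_ (hP.cutoff_mem (half_pos hε) X)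
    (cfcₙ_nonneg fun s _ => CStarStab.cutoff_nonneg _ s) (norm_cutoff_le _ _)
    (mul_cfc_eq_self hε (by fun_prop) (fun s hs => by
      rw [max_eq_right (by linarith), Real.sqrt_zero]) X)
  · rw [hz, ← add_assoc, add_sub_cancel]; exact hle
  · refine (norm_add_le _ _).trans_lt ?_
    linarith

theorem cutoff_le_dim_of_le_add (ht : IsLocalTrace P t) (hP : IsPedLike P) {a X r : D} {η : ℝ}
    (ha : IsSelfAdjoint a) (hX : 0 ≤ X) (hr : IsSelfAdjoint r) (hle : a ≤ X + r) (hη : ‖r‖ < η) :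
    ENNReal.ofReal (t (cfcₙ (cutoff η) a)) ≤ dim t X := by
  have hε : 0 < (η - ‖r‖) / 2 := by linarith
  exact (ENNReal.ofReal_le_ofReal (ht.cutoff_le_of_le_add hP ha hX hr hle hε (by linarith))).trans
    (ht.cutoff_le_dim hP (half_pos hε) X)

/-- `d_t` is monotone with respect to the inclusion of hereditary subalgebras. -/
theorem dim_le_of_mem_Her (ht : IsLocalTrace P t) (hP : IsPedLike P) {g X : D} (hX : 0 ≤ X)
    (hg0 : 0 ≤ g) (hg : g ∈ Her X) : dim t g ≤ dim t X := by
  refine dim_le fun ε hε => ?_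
  have hgsa := IsSelfAdjoint.of_nonneg hg0
  -- `g` is approximated by `l g l ≤ ‖g‖ l²` for cut-offs `l` of `X`, which have local units
  have h1 := tendsto_apx_mul hX hg
  have h2 : Tendsto (fun n => g * apx X n) atTop (𝓝 g) := by
    have := h1.star
    simpa [star_mul, (apx_isSelfAdjoint X _).star_eq, hgsa.star_eq] using this
  have h3 : Tendsto (fun n => apx X n * g * apx X n) atTop (𝓝 g) := by
    have h4 : Tendsto (fun n => ‖apx X n * g - g‖ + ‖g * apx X n - g‖) atTop (𝓝 0) := by
      simpa using (tendsto_iff_norm_sub_tendsto_zero.1 h1).add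
        (tendsto_iff_norm_sub_tendsto_zero.1 h2)
    refine tendsto_iff_norm_sub_tendsto_zero.2 (squeeze_zero (fun _ => norm_nonneg _)
      (fun n => ?_) h4)
    have e : apx X n * g * apx X n - g = (apx X n * g - g) * apx X n + (g * apx X n - g) := by
      noncomm_ring
    rw [e]
    refine (norm_add_le _ _).trans (add_le_add ((norm_mul_le _ _).trans ?_) le_rfl)
    exact mul_le_of_le_one_right (norm_nonneg _) (norm_cutoff_le _ _)
  obtain ⟨n, hn⟩ := ((tendsto_iff_norm_sub_tendsto_zero.1 h3).eventually_lt_const hε).exists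
  set l := apx X n with hl
  have hlsa : star l = l := (apx_isSelfAdjoint X n).star_eq
  have hn0 : (0 : ℝ) < 1 / (n + 1) := by positivity
  have hz : star (√‖g‖ • l) * (√‖g‖ • l) = ‖g‖ • (star l * l) := by
    rw [star_smul, smul_mul_assoc, mul_smul_comm, smul_smul, star_trivial,
      Real.mul_self_sqrt (norm_nonneg g)]
  refine (ENNReal.ofReal_le_ofReal (ht.cutoff_le_of_le_star_mul hP (z := √‖g‖ • l)
    (r := g - l * g * l) (h := cfcₙ (cutoff (1 / (n + 1) / 2)) X) hgsa ?_ ?_ ?_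
    (hP.cutoff_mem (half_pos hn0) X) (cfcₙ_nonneg fun s _ => CStarStab.cutoff_nonneg _ s)
    (norm_cutoff_le _ _) ?_)).trans (ht.cutoff_le_dim hP (half_pos hn0) X)
  · refine hgsa.sub ?_
    have := hgsa.conjugate l
    rwa [hlsa] at this
  · rw [hz, ← sub_le_iff_le_add, sub_sub_cancel]
    nth_rw 1 [← hlsa]
    exact CStarAlgebra.star_left_conjugate_le_norm_smul hgsa
  · rwa [norm_sub_rev]
  · rw [mul_smul_comm, hl, apx, mul_cfc_eq_self hn0 (by fun_prop) fun s hs => cutoff_eq_zero hn0 hs]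

theorem cutoff_add_of_mul_eq_zero (ht : IsLocalTrace P t) (hP : IsPedLike P) {x y : D} (hx : 0 ≤ x)
    (hy : 0 ≤ y) (hxy : x * y = 0) {ε : ℝ} (hε : 0 < ε) :
    t (cfcₙ (cutoff ε) (x + y)) = t (cfcₙ (cutoff ε) x) + t (cfcₙ (cutoff ε) y) := by
  have hc : Commute x y := hxy.trans (mul_eq_zero_symm (IsSelfAdjoint.of_nonneg hx)
    (IsSelfAdjoint.of_nonneg hy) hxy).symm
  rw [cfcₙ_add_of_mul_eq_zero hx hy hxy (by fun_prop) (by simp)]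
  exact ht.add _ (hP.cutoff_mem hε x) _ (hP.cutoff_mem hε y) (cfcₙ_predicate _ x)
    (cfcₙ_predicate _ y) ((hc.cfcₙ_real _).symm.cfcₙ_real _).symm

theorem monotone_cutoff (ht : IsLocalTrace P t) (hP : IsPedLike P) (a : D) :
    Monotone fun n : ℕ => ENNReal.ofReal (t (cfcₙ (cutoff (1 / (n + 1))) a)) := fun n m h =>
  ENNReal.ofReal_le_ofReal (ht.cutoff_mono hP (by positivity)
    (one_div_le_one_div_of_le (by positivity) (by gcongr)) a)

theorem dim_add_of_mul_eq_zero (ht : IsLocalTrace P t) (hP : IsPedLike P) {x y : D} (hx : 0 ≤ x)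
    (hy : 0 ≤ y) (hxy : x * y = 0) : dim t (x + y) = dim t x + dim t y := by
  rw [dim, dim, dim, ENNReal.iSup_add_iSup_of_monotone (ht.monotone_cutoff hP x)
    (ht.monotone_cutoff hP y)]
  congr 1; ext n
  rw [ht.cutoff_add_of_mul_eq_zero hP hx hy hxy (by positivity),
    ENNReal.ofReal_add (ht.cutoff_nonneg hP (by positivity) x)
      (ht.cutoff_nonneg hP (by positivity) y)]

theorem dim_add_dim_le (ht : IsLocalTrace P t) (hP : IsPedLike P) {a x y : D} (ha : 0 ≤ a)
    (hx : 0 ≤ x) (hy : 0 ≤ y) (hxy : x * y = 0) (hxa : x ∈ Her a) (hya : y ∈ Her a) :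
    dim t x + dim t y ≤ dim t a := by
  rw [← ht.dim_add_of_mul_eq_zero hP hx hy hxy]
  exact ht.dim_le_of_mem_Her hP ha (add_nonneg hx hy) (add_mem hxa hya)

/-- The estimate `t(x) ≤ ‖x‖ d_t(x)`, although `t` is not assumed to be continuous. -/
theorem le_norm_mul_dim (ht : IsLocalTrace P t) (hP : IsPedLike P) {x : D} (hxP : x ∈ P)
    (hx : 0 ≤ x) : ENNReal.ofReal (t x) ≤ ENNReal.ofReal ‖x‖ * dim t x := by
  have hxsa := IsSelfAdjoint.of_nonneg hx
  have hsq : cfcₙ Real.sqrt x ∈ P := by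
    rw [← CFC.sqrt_eq_real_sqrt x hx]; exact hP.sqrt_mem hxP hx
  have hidP : cfcₙ (fun s : ℝ => s) x ∈ P := by rwa [cfcₙ_id' ℝ x]
  -- `s ≤ ‖x‖ f_δ(s) + √(2δ) √s` on the spectrum of `x`, and `√x` belongs to `P`
  have key (n : ℕ) : ENNReal.ofReal (t x) ≤ ENNReal.ofReal ‖x‖ * dim t x +
      ENNReal.ofReal (√(2 * (1 / ((n : ℝ) + 1))) * t (cfcₙ Real.sqrt x)) := by
    have hn0 : (0 : ℝ) < 1 / (n + 1) := by positivity
    have hcP := hP.cutoff_mem hn0 x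
    have h1P : cfcₙ (fun s => ‖x‖ * cutoff (1 / (n + 1)) s) x ∈ P := by
      rw [cfcₙ_const_mul ..]; exact SMulMemClass.smul_mem (‖x‖ : ℂ) hcP
    have h2P : cfcₙ (fun s => √(2 * (1 / ((n : ℝ) + 1))) * √s) x ∈ P := by
      rw [cfcₙ_const_mul ..]; exact SMulMemClass.smul_mem (√(2 * (1 / ((n : ℝ) + 1))) : ℂ) hsq
    have h12P : cfcₙ (fun s => ‖x‖ * cutoff (1 / (n + 1)) s +
        √(2 * (1 / ((n : ℝ) + 1))) * √s) x ∈ P := by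
      rw [cfcₙ_add ..]; exact add_mem h1P h2P
    have h3 : t x ≤ ‖x‖ * t (cfcₙ (cutoff (1 / (n + 1))) x) +
        √(2 * (1 / ((n : ℝ) + 1))) * t (cfcₙ Real.sqrt x) := by
      rw [← ht.cfc_const_mul _ hcP (by fun_prop) (by simp),
        ← ht.cfc_const_mul _ hsq (by fun_prop) (by simp),
        ← ht.cfc_add h1P h2P (by fun_prop) (by fun_prop) (by simp) (by simp)]
      conv_lhs => rw [← cfcₙ_id' ℝ x]
      refine ht.cfc_mono hP hidP h12P (by fun_prop) (by fun_prop) rfl (by simp) fun s hs => ?_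
      have hs0 : 0 ≤ s := quasispectrum_nonneg_of_nonneg x hx s hs
      rcases le_total (2 * (1 / ((n : ℝ) + 1))) s with h | h
      · have hsx : s ≤ ‖x‖ := by
          have := norm_apply_le_norm_cfcₙ (fun s : ℝ => s) x hs
          rw [cfcₙ_id' ℝ x, Real.norm_of_nonneg hs0] at this
          exact this
        rw [cutoff_eq_one hn0 h]
        have : 0 ≤ √(2 * (1 / ((n : ℝ) + 1))) * √s := by positivity
        linarith
      · have h4 : √s ≤ √(2 * (1 / ((n : ℝ) + 1))) := Real.sqrt_le_sqrt h
        have h5 := Real.mul_self_sqrt hs0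
        have h6 := CStarStab.cutoff_nonneg (1 / ((n : ℝ) + 1)) s
        have h7 : √s * √s ≤ √(2 * (1 / ((n : ℝ) + 1))) * √s := by gcongr
        have h8 : 0 ≤ ‖x‖ * cutoff (1 / ((n : ℝ) + 1)) s := by positivity
        linarith
    refine (ENNReal.ofReal_le_ofReal h3).trans (ENNReal.ofReal_add_le.trans ?_)
    rw [ENNReal.ofReal_mul (norm_nonneg x)]
    gcongr
    exact ht.cutoff_le_dim hP hn0 x
  have hlim : Tendsto (fun n : ℕ => ENNReal.ofReal ‖x‖ * dim t x +
      ENNReal.ofReal (√(2 * (1 / ((n : ℝ) + 1))) * t (cfcₙ Real.sqrt x))) atTop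
      (𝓝 (ENNReal.ofReal ‖x‖ * dim t x + ENNReal.ofReal (√(2 * 0) * t (cfcₙ Real.sqrt x)))) := by
    refine tendsto_const_nhds.add (ENNReal.tendsto_ofReal (Tendsto.mul_const _ ?_))
    exact (Real.continuous_sqrt.tendsto _).comp
      ((tendsto_one_div_add_atTop_nhds_zero_nat (𝕜 := ℝ)).const_mul 2)
  simpa using ge_of_tendsto' hlim key

end IsLocalTrace

/-- A local trace that extends to a local trace on the `2 × 2` matrices. -/
def IsLocalTwoTrace (P : NonUnitalStarSubalgebra ℂ D) (t : D → ℝ) : Prop :=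
  IsLocalTrace P t ∧ ∃ t₂ : M₂ D → ℝ, IsLocalTrace (mat₂ P) t₂ ∧ ∀ x ∈ P, t₂ (unit₂ 0 0 x) = t x

section TwoTrace

variable {P : NonUnitalStarSubalgebra ℂ D} {t : D → ℝ} {t₂ : M₂ D → ℝ}

theorem IsLocalTrace.unit₂_one_one (ht₂ : IsLocalTrace (mat₂ P) t₂)
    (h : ∀ x ∈ P, t₂ (unit₂ 0 0 x) = t x) (hP : IsPedLike P) {x : D} (hx : x ∈ P) (hx0 : 0 ≤ x) :
    t₂ (unit₂ 1 1 x) = t x := by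
  have h1 := ht₂.tracial _ (unit₂_mem 0 1 (hP.sqrt_mem hx hx0))
  rwa [star_unit₂, unit₂_mul_same, unit₂_mul_same, (sqrt_isSelfAdjoint x).star_eq,
    CFC.sqrt_mul_sqrt_self x hx0, h x hx] at h1

theorem IsLocalTrace.dim_diag₂ (ht₂ : IsLocalTrace (mat₂ P) t₂)
    (h : ∀ x ∈ P, t₂ (unit₂ 0 0 x) = t x) (hP : IsPedLike P) {a b : D} (ha : 0 ≤ a) (hb : 0 ≤ b) :
    dim t₂ (diag₂ 0 a + diag₂ 1 b) = dim t a + dim t b := by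
  have hm (i : Fin 2) {x : D} (hx : 0 ≤ x) (n : ℕ) : t₂ (cfcₙ (cutoff (1 / (n + 1))) (diag₂ i x)) =
      t (cfcₙ (cutoff (1 / (n + 1))) x) := by
    have hxsa := IsSelfAdjoint.of_nonneg hx
    rw [← NonUnitalStarAlgHomClass.map_cfcₙ (diag₂ i) _ x (by fun_prop) (by simp)
      (map_continuous _) hxsa (hxsa.map _), diag₂_apply]
    have hxP := hP.cutoff_mem (δ := 1 / ((n : ℝ) + 1)) (by positivity) x
    fin_cases i
    · exact h _ hxP
    · exact ht₂.unit₂_one_one h hP hxP (cfcₙ_nonneg fun s _ => CStarStab.cutoff_nonneg _ s)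
  rw [ht₂.dim_add_of_mul_eq_zero hP.mat₂ (map_nonneg (diag₂ 0) ha) (map_nonneg (diag₂ 1) hb)
    (unit₂_mul_of_ne 0 1 (by decide) a b)]
  simp only [dim, hm _ ha, hm _ hb]

theorem dim_diag₂_zero
    (h : ∀ x ∈ P, t₂ (unit₂ 0 0 x) = t x) (hP : IsPedLike P) {a : D} (ha : 0 ≤ a) :
    dim t₂ (diag₂ 0 a) = dim t a := by
  have hsa := IsSelfAdjoint.of_nonneg ha
  simp only [dim]
  congr 1; ext n
  rw [← NonUnitalStarAlgHomClass.map_cfcₙ (diag₂ 0) _ a (by fun_prop) (by simp)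
      (map_continuous _) hsa (hsa.map _), diag₂_apply, h _ (hP.cutoff_mem (by positivity) a)]

/-- Subadditivity of the dimension. A quasitrace need not be additive, and the proof uses the extension
to `2 × 2` matrices. -/
theorem IsLocalTwoTrace.dim_add_le (ht : IsLocalTwoTrace P t) (hP : IsPedLike P) {a b : D}
    (ha : 0 ≤ a) (hb : 0 ≤ b) : dim t (a + b) ≤ dim t a + dim t b := by
  obtain ⟨ht, t₂, ht₂, h⟩ := ht
  have h01 : (0 : Fin 2) ≠ 1 := by decide
  have h10 : (1 : Fin 2) ≠ 0 := by decide
  -- `a + b` is `z⋆ z` for the column `z` with entries `√a, √b`, and `z z⋆ + v v⋆ = 2 diag(a, b)`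
  let z : M₂ D := unit₂ 0 0 (CFC.sqrt a) + unit₂ 1 0 (CFC.sqrt b)
  let v : M₂ D := unit₂ 0 0 (CFC.sqrt a) - unit₂ 1 0 (CFC.sqrt b)
  have hz : star z * z = diag₂ 0 (a + b) := by
    simp only [z, star_add, star_unit₂, add_mul, mul_add, unit₂_mul_same, unit₂_mul_of_ne _ _ h01,
      unit₂_mul_of_ne _ _ h10, (sqrt_isSelfAdjoint _).star_eq, CFC.sqrt_mul_sqrt_self a ha,
      CFC.sqrt_mul_sqrt_self b hb, diag₂_apply, map_add]
    abel
  have hzv : z * star z + v * star v = (2 : ℝ) • (diag₂ 0 a + diag₂ 1 b) := by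
    simp only [z, v, star_add, star_sub, star_unit₂, add_mul, mul_add, sub_mul, mul_sub,
      unit₂_mul_same, (sqrt_isSelfAdjoint _).star_eq, CFC.sqrt_mul_sqrt_self a ha,
      CFC.sqrt_mul_sqrt_self b hb, diag₂_apply, two_smul]
    abel
  have hd : 0 ≤ diag₂ 0 a + diag₂ 1 b :=
    add_nonneg (map_nonneg (diag₂ 0) ha) (map_nonneg (diag₂ 1) hb)
  rw [← dim_diag₂_zero h hP (add_nonneg ha hb), ← hz, ht₂.dim_star_mul hP.mat₂,
    ← ht₂.dim_diag₂ h hP ha hb]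
  refine ht₂.dim_le_of_mem_Her hP.mat₂ hd (mul_star_self_nonneg z) ?_
  refine (isHereditary_Her _).mem_of_le _ _ (mul_star_self_nonneg z)
    (le_of_le_of_eq (le_add_of_nonneg_right (mul_star_self_nonneg v)) hzv) ?_
  exact SMulMemClass.smul_mem (2 : ℂ) (mem_Her_self _)

theorem IsLocalTwoTrace.cutoff_le_dim_add (ht : IsLocalTwoTrace P t) (hP : IsPedLike P)
    {a x y r : D} {η : ℝ} (ha : IsSelfAdjoint a) (hx : 0 ≤ x) (hy : 0 ≤ y) (hr : IsSelfAdjoint r)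
    (hle : a ≤ x + y + r) (hη : ‖r‖ < η) :
    ENNReal.ofReal (t (cfcₙ (cutoff η) a)) ≤ dim t x + dim t y :=
  (ht.1.cutoff_le_dim_of_le_add hP ha (add_nonneg hx hy) hr hle hη).trans (ht.dim_add_le hP hx hy)

end TwoTrace

end Dimension

/-! ### Quasitraces as real functions on the C⋆-algebra -/

section Comparison

theorem IsQuasitrace.comp {R S : Type u} [NonUnitalRing R] [StarRing R] [Module ℂ R]
    [NonUnitalRing S] [StarRing S] [Module ℂ S] {τ : S → ℂ} (hτ : IsQuasitrace τ)
    (φ : R →⋆ₙₐ[ℂ] S) : IsQuasitrace (fun x => τ (φ x)) where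
  nonneg x := by rw [map_mul, map_star]; exact hτ.nonneg _
  tracial x := by rw [map_mul, map_mul, map_star]; exact hτ.tracial _
  linear B hB := by
    have h := hτ.linear (B.map φ) (by
      rintro _ ⟨x, hx, rfl⟩ _ ⟨y, hy, rfl⟩
      show φ x * φ y = φ y * φ x
      rw [← map_mul, hB x hx y hy, map_mul])
    refine ⟨fun x hx y hy => ?_, fun c x hx => ?_⟩
    · rw [map_add]; exact h.1 _ ⟨x, hx, rfl⟩ _ ⟨y, hy, rfl⟩
    · rw [map_smul]; exact h.2 c _ ⟨x, hx, rfl⟩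
  re_im a b ha hb := by
    rw [map_add, map_smul]; exact hτ.re_im _ _ (ha.map φ) (hb.map φ)

variable {D : Type u} [NonUnitalCStarAlgebra D]

open Classical in
/-- The real part of a function on `P`, extended by `0` to all of `D`. -/
def reExt {P : NonUnitalStarSubalgebra ℂ D} (σ : P → ℂ) (x : D) : ℝ :=
  if h : x ∈ P then (σ ⟨x, h⟩).re else 0

theorem reExt_of_mem {P : NonUnitalStarSubalgebra ℂ D} (σ : P → ℂ) {x : D} (h : x ∈ P) :
    reExt σ x = (σ ⟨x, h⟩).re := dif_pos h

theorem reExt_coe {P : NonUnitalStarSubalgebra ℂ D} (σ : P → ℂ) (x : P) :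
    reExt σ (x : D) = (σ x).re := dif_pos x.2

/-- Linearity on commutative subalgebras, for two commuting self-adjoint elements. -/
theorem IsQuasitrace.add_of_commute {R : Type u} [NonUnitalRing R] [StarRing R] [Module ℂ R]
    [IsScalarTower ℂ R R] [SMulCommClass ℂ R R] [StarModule ℂ R]
    {σ : R → ℂ} (hσ : IsQuasitrace σ) {a b : R} (ha : IsSelfAdjoint a) (hb : IsSelfAdjoint b)
    (hc : Commute a b) : σ (a + b) = σ a + σ b ∧ ∀ c : ℂ, σ (c • a) = c * σ a := by
  have := NonUnitalStarAlgebra.isMulCommutative_adjoin ℂ (s := ({a, b} : Set R))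
    (by rintro x (rfl | rfl) y (rfl | rfl) <;> simp [hc.eq])
    (by rintro x (rfl | rfl) y (rfl | rfl) <;> simp [hc.eq, ha.star_eq, hb.star_eq])
  have h := hσ.linear (NonUnitalStarAlgebra.adjoin ℂ ({a, b} : Set R))
    fun x hx y hy => setLike_mul_comm hx hy
  have ha' := NonUnitalStarAlgebra.subset_adjoin ℂ ({a, b} : Set R) (Set.mem_insert a {b})
  exact ⟨h.1 _ ha' _ (NonUnitalStarAlgebra.subset_adjoin ℂ ({a, b} : Set R)
    (Set.mem_insert_of_mem a rfl)), fun c => h.2 c _ ha'⟩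

theorem IsQuasitrace.isLocalTrace {P : NonUnitalStarSubalgebra ℂ D} {σ : P → ℂ}
    (hσ : IsQuasitrace σ) : IsLocalTrace P (reExt σ) where
  nonneg_star_mul x hx := by
    rw [reExt_of_mem σ (mul_mem (star_mem hx) hx)]
    exact (Complex.nonneg_iff.1 (hσ.nonneg ⟨x, hx⟩)).1
  tracial x hx := by
    rw [reExt_of_mem σ (mul_mem (star_mem hx) hx), reExt_of_mem σ (mul_mem hx (star_mem hx))]
    exact congrArg Complex.re (hσ.tracial ⟨x, hx⟩)
  add a ha b hb hsa hsb hc := by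
    rw [reExt_of_mem σ ha, reExt_of_mem σ hb, reExt_of_mem σ (add_mem ha hb), ← Complex.add_re]
    exact congrArg Complex.re (hσ.add_of_commute (a := ⟨a, ha⟩) (b := ⟨b, hb⟩) (Subtype.ext hsa)
      (Subtype.ext hsb) (Subtype.ext hc)).1
  smul r a ha hsa := by
    have hra : r • a ∈ P := SMulMemClass.smul_mem (r : ℂ) ha
    rw [reExt_of_mem σ ha, reExt_of_mem σ hra]
    have h2 := congrArg Complex.re ((hσ.add_of_commute (a := (⟨a, ha⟩ : P)) (b := ⟨a, ha⟩) (Subtype.ext hsa)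
      (Subtype.ext hsa) (Commute.refl _)).2 r)
    rw [Complex.re_ofReal_mul] at h2
    exact h2

variable [PartialOrder D] [StarOrderedRing D]

/-- The matrices with entries in `P`, as matrices over the ring `P`. -/
def mat₂Equiv (P : NonUnitalStarSubalgebra ℂ D) : mat₂ P →⋆ₙₐ[ℂ] Matrix (Fin 2) (Fin 2) P where
  toFun x := Matrix.of fun i j => ⟨x.1.entry i j, x.2 i j⟩
  map_smul' c x := by ext i j; rfl
  map_zero' := by ext i j; rfl
  map_add' x y := by ext i j; rfl
  map_mul' x y := by
    ext i j
    rw [Matrix.mul_apply]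
    simp only [Matrix.of_apply, AddSubmonoidClass.coe_finsetSum, MulMemClass.coe_mul]
    exact M₂.mul_entry _ _ i j
  map_star' x := by ext i j; rfl

namespace DQT

/-- The real part of a densely defined quasitrace, as a function on the whole C⋆-algebra. -/
def re (τ : DQT D) : D → ℝ := reExt τ.1

theorem isLocalTwoTrace (τ : DQT D) : IsLocalTwoTrace (Ped D) τ.re := by
  obtain ⟨h1, τ₂, h2, h3⟩ := τ.2
  refine ⟨h1.isLocalTrace, _, (h2.comp (mat₂Equiv (Ped D))).isLocalTrace, fun x hx => ?_⟩
  rw [reExt_of_mem _ (unit₂_mem 0 0 hx), re, reExt_of_mem _ hx, ← h3]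
  congr 2
  ext i j
  show ((unit₂ 0 0 x).entry i j : D) = ((Matrix.single 0 0 (⟨x, hx⟩ : Ped D) : Matrix _ _ _) i j : Ped D)
  rw [unit₂_entry, Matrix.single_apply]
  split_ifs <;> rfl

theorem isLocalTrace (τ : DQT D) : IsLocalTrace (Ped D) τ.re := τ.isLocalTwoTrace.1

theorem eval_eq (τ : DQT D) (x : Ped D) : τ.eval x = ENNReal.ofReal (τ.re x) := by
  rw [re, reExt_coe]; rfl

theorem dimFun_eq (τ : DQT D) (a : D) : dimFun τ a = dim τ.re a := by
  simp only [dimFun, dim, eval_eq]; rfl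

theorem continuous_re {x : D} (hx : x ∈ Ped D) : Continuous fun τ : DQT D => τ.re x := by
  simp only [re, reExt_of_mem _ hx]
  exact Complex.continuous_re.comp ((continuous_apply _).comp continuous_subtype_val)

end DQT

variable {P : NonUnitalStarSubalgebra ℂ D} {σ : P → ℂ}

theorem IsPedLike.posPart_mem (hP : IsPedLike P) {x : D} (hx : x ∈ P) (hsa : IsSelfAdjoint x) :
    x⁺ ∈ P :=
  hP.cfc_mem_of_sq_le hx hsa (g := fun s => s⁺) (by fun_prop) (fun s => posPart_nonneg s) fun s => by
    rcases le_total s 0 with h | h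
    · simp [posPart_eq_zero.2 h, sq_nonneg]
    · simp [posPart_eq_self.2 h]

theorem IsPedLike.negPart_mem (hP : IsPedLike P) {x : D} (hx : x ∈ P) (hsa : IsSelfAdjoint x) :
    x⁻ ∈ P :=
  hP.cfc_mem_of_sq_le hx hsa (g := fun s => s⁻) (by fun_prop) (fun s => negPart_nonneg s) fun s => by
    rcases le_total s 0 with h | h
    · simp [negPart_eq_neg.2 h]
    · simp [negPart_eq_zero.2 h, sq_nonneg]

theorem IsQuasitrace.norm_of_nonneg (hσ : IsQuasitrace σ) (hP : IsPedLike P) {x : P}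
    (hx : 0 ≤ (x : D)) : ‖σ x‖ = reExt σ x := by
  have h := hσ.nonneg ⟨CFC.sqrt (x : D), hP.sqrt_mem x.2 hx⟩
  have e : star (⟨CFC.sqrt (x : D), hP.sqrt_mem x.2 hx⟩ : P) * ⟨CFC.sqrt (x : D), hP.sqrt_mem x.2 hx⟩ =
      x := Subtype.ext (by
    show star (CFC.sqrt (x : D)) * CFC.sqrt (x : D) = x
    rw [(sqrt_isSelfAdjoint _).star_eq, CFC.sqrt_mul_sqrt_self _ hx])
  rw [e] at h
  rw [reExt_coe, ← Complex.norm_of_nonneg' h, Complex.ofReal_re]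
  simp

theorem IsQuasitrace.norm_le_of_isSelfAdjoint (hσ : IsQuasitrace σ) (hP : IsPedLike P) {x : P}
    (hx : IsSelfAdjoint (x : D)) :
    ‖σ x‖ ≤ reExt σ ((x : D)⁺) + reExt σ ((x : D)⁻) := by
  have hp := hP.posPart_mem x.2 hx
  have hn := hP.negPart_mem x.2 hx
  let p : P := ⟨(x : D)⁺, hp⟩
  let n : P := ⟨(x : D)⁻, hn⟩
  have hpx : x + n = p := Subtype.ext (by
    show (x : D) + (x : D)⁻ = (x : D)⁺
    nth_rw 1 [← CFC.posPart_sub_negPart (x : D) hx]; simp)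
  have hcomm : Commute (x : D) ((x : D)⁻) := (Commute.refl (x : D)).cfcₙ_real _ |>.symm
  have h := (hσ.add_of_commute (a := x) (b := n) (Subtype.ext hx)
    (Subtype.ext (IsSelfAdjoint.of_nonneg (CFC.negPart_nonneg _)).star_eq) (Subtype.ext hcomm)).1
  have h1 : σ x = σ p - σ n := by rw [← hpx, h]; ring
  rw [h1]
  refine (norm_sub_le _ _).trans (le_of_eq ?_)
  rw [hσ.norm_of_nonneg hP (x := p) (CFC.posPart_nonneg _),
    hσ.norm_of_nonneg hP (x := n) (CFC.negPart_nonneg _)]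

/-- If the values of the quasitraces of a family are bounded at every positive element, then they
are bounded at every element. -/
theorem exists_norm_le_of_forall_nonneg (hP : IsPedLike P) {S : Set (P → ℂ)}
    (hS : ∀ σ ∈ S, IsQuasitrace σ)
    (h : ∀ x ∈ P, 0 ≤ x → ∃ C : ℝ, ∀ σ ∈ S, reExt σ x ≤ C) (x : P) :
    ∃ C : ℝ, ∀ σ ∈ S, ‖σ x‖ ≤ C := by
  have hsa (y : P) (hy : IsSelfAdjoint (y : D)) : ∃ C : ℝ, ∀ σ ∈ S, ‖σ y‖ ≤ C := by
    obtain ⟨C₁, h₁⟩ := h _ (hP.posPart_mem y.2 hy) (CFC.posPart_nonneg _)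
    obtain ⟨C₂, h₂⟩ := h _ (hP.negPart_mem y.2 hy) (CFC.negPart_nonneg _)
    exact ⟨C₁ + C₂, fun σ hσ => ((hS σ hσ).norm_le_of_isSelfAdjoint hP hy).trans
      (add_le_add (h₁ σ hσ) (h₂ σ hσ))⟩
  let a : P := (2⁻¹ : ℂ) • (x + star x)
  let b : P := (-(Complex.I * 2⁻¹)) • (x - star x)
  have ha : IsSelfAdjoint a := by
    simp only [a, IsSelfAdjoint, star_smul, star_add, star_star, add_comm (star x)]
    simp
  have hb : IsSelfAdjoint b := by
    simp only [b, IsSelfAdjoint, star_smul, star_sub, star_star, Complex.star_def, map_neg, map_mul,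
      Complex.conj_I, map_inv₀, map_ofNat]
    module
  have hx : x = a + Complex.I • b := by
    simp only [a, b, smul_smul]
    have : Complex.I * -(Complex.I * 2⁻¹) = (2⁻¹ : ℂ) := by
      rw [mul_neg, ← mul_assoc, Complex.I_mul_I]; ring
    rw [this]
    module
  obtain ⟨C₁, h₁⟩ := hsa a (congrArg Subtype.val ha)
  obtain ⟨C₂, h₂⟩ := hsa b (congrArg Subtype.val hb)
  refine ⟨C₁ + C₂, fun σ hσ => ?_⟩
  have e : σ x = σ a + Complex.I * σ b := by rw [← (hS σ hσ).re_im a b ha hb, ← hx]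
  rw [e]
  refine (norm_add_le _ _).trans (add_le_add (h₁ σ hσ) ?_)
  rw [norm_mul, Complex.norm_I, one_mul]
  exact h₂ σ hσ

end Comparison

/-! ### Dimensions that are bounded on a set of quasitraces -/

section Bounded

variable {D : Type u} [NonUnitalCStarAlgebra D] [PartialOrder D] [StarOrderedRing D]

theorem IsLocalTrace.dim_le_of_le_smul {P : NonUnitalStarSubalgebra ℂ D} {t : D → ℝ}
    (ht : IsLocalTrace P t) (hP : IsPedLike P) {a b : D} (c : ℝ) (ha : 0 ≤ a) (hb : 0 ≤ b)
    (h : a ≤ c • b) : dim t a ≤ dim t b :=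
  ht.dim_le_of_mem_Her hP hb ha ((isHereditary_Her b).mem_of_le _ _ ha h
    (SMulMemClass.smul_mem (c : ℂ) (mem_Her_self b)))

theorem star_add_mul_add_le (x y : D) :
    star (x + y) * (x + y) ≤ (2 : ℝ) • (star x * x + star y * y) := by
  rw [← sub_nonneg]
  have e : (2 : ℝ) • (star x * x + star y * y) - star (x + y) * (x + y) =
      star (x - y) * (x - y) := by
    rw [two_smul, star_add, star_sub]; noncomm_ring
  rw [e]; exact star_mul_self_nonneg _

/-- The elements `x` such that `d_τ(x⋆ x)` is bounded for `τ ∈ T`. They form a subspace because the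
dimension is subadditive. -/
def boundedIdeal (T : Set (DQT D)) : Submodule ℂ D where
  carrier := {x | ∃ C : ℝ≥0∞, C ≠ ⊤ ∧ ∀ τ ∈ T, dim τ.re (star x * x) ≤ C}
  add_mem' := by
    rintro x y ⟨C, hC, hx⟩ ⟨C', hC', hy⟩
    refine ⟨C + C', ENNReal.add_ne_top.2 ⟨hC, hC'⟩, fun τ hτ => ?_⟩
    refine (τ.isLocalTrace.dim_le_of_le_smul isPedLike_Ped 2 (star_mul_self_nonneg _)
      (add_nonneg (star_mul_self_nonneg x) (star_mul_self_nonneg y))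
      (star_add_mul_add_le x y)).trans ?_
    exact (τ.isLocalTwoTrace.dim_add_le isPedLike_Ped (star_mul_self_nonneg x)
      (star_mul_self_nonneg y)).trans (add_le_add (hx τ hτ) (hy τ hτ))
  zero_mem' := ⟨0, by simp, fun τ _ => IsLocalTrace.dim_le fun ε _ => by
    have := τ.isLocalTrace.smul 0 0 (zero_mem _) (.zero _)
    simp only [smul_zero, zero_mul] at this
    simp [this]⟩
  smul_mem' := by
    rintro c x ⟨C, hC, hx⟩
    refine ⟨C, hC, fun τ hτ => le_trans ?_ (hx τ hτ)⟩
    refine τ.isLocalTrace.dim_le_of_mem_Her isPedLike_Ped (star_mul_self_nonneg x)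
      (star_mul_self_nonneg _) ?_
    rw [star_smul, smul_mul_assoc, mul_smul_comm]
    exact SMulMemClass.smul_mem _ (SMulMemClass.smul_mem _ (mem_Her_self _))

theorem boundedIdeal_mul_left (T : Set (DQT D)) (a : D) {x : D} (hx : x ∈ boundedIdeal T) :
    a * x ∈ boundedIdeal T := by
  obtain ⟨C, hC, hx⟩ := hx
  refine ⟨C, hC, fun τ hτ => le_trans ?_ (hx τ hτ)⟩
  refine τ.isLocalTrace.dim_le_of_le_smul isPedLike_Ped ‖star a * a‖ (star_mul_self_nonneg _)
    (star_mul_self_nonneg x) ?_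
  have e : star (a * x) * (a * x) = star x * (star a * a) * x := by
    rw [star_mul]; simp only [mul_assoc]
  rw [e]
  exact CStarAlgebra.star_left_conjugate_le_norm_smul (IsSelfAdjoint.star_mul_self a)

theorem boundedIdeal_star (T : Set (DQT D)) {x : D} (hx : x ∈ boundedIdeal T) :
    star x ∈ boundedIdeal T := by
  obtain ⟨C, hC, hx⟩ := hx
  refine ⟨C, hC, fun τ hτ => ?_⟩
  rw [star_star, ← τ.isLocalTrace.dim_star_mul isPedLike_Ped]
  exact hx τ hτ

theorem boundedIdeal_mul_right (T : Set (DQT D)) (a : D) {x : D} (hx : x ∈ boundedIdeal T) :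
    x * a ∈ boundedIdeal T := by
  have := boundedIdeal_star T (boundedIdeal_mul_left T (star a) (boundedIdeal_star T hx))
  rwa [star_mul, star_star, star_star] at this

end Bounded

/-! ### Matrix units of the stabilization -/

section MatrixUnits

variable {A : Type u} [NonUnitalCStarAlgebra A] [PartialOrder A] [StarOrderedRing A]

theorem toStab_eq_of_eventually {x y : FinMat A} (h : ∀ᶠ n in atTop, x.entry n = y.entry n) :
    toStab x = toStab y := by
  obtain ⟨n, h1, h2⟩ := (h.and (x - y).norm_eq).exists
  rw [← sub_eq_zero, ← map_sub, ← norm_eq_zero, LinearIsometry.norm_map, ← h2]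
  have : (x - y).entry n = x.entry n - y.entry n := by
    rw [sub_eq_add_neg, FinMat.entry_add, FinMat.entry_neg, sub_eq_add_neg]
  rw [this, h1, sub_self, norm_zero]

/-- The `n × n` matrix with entry `a` in place `(i, j)`. -/
def unitMat (i j n : ℕ) (a : A) : Mat A n :=
  CStarMatrix.ofMatrix fun p q => if p.val = i ∧ q.val = j then a else 0

theorem unitMat_apply (i j n : ℕ) (a : A) (p q : Fin n) :
    unitMat i j n a p q = if p.val = i ∧ q.val = j then a else 0 := rfl

theorem unitMat_succ {i j n : ℕ} (hi : i < n) (hj : j < n) (a : A) :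
    unitMat i j (n + 1) a = pad n (unitMat i j n a) := by
  ext p q
  show unitMat i j (n + 1) a p q = padFun (unitMat i j n a) p q
  induction p using Fin.lastCases <;> induction q using Fin.lastCases <;>
    simp [unitMat_apply, hi.ne', hj.ne']

/-- The element `a ⊗ e_{i,j}` of the algebraic inductive limit. -/
def unitSeq (i j : ℕ) (a : A) : FinMat A :=
  ⟨fun n => unitMat i j n a, eventually_atTop.2 ⟨max i j + 1, fun _ hn =>
    unitMat_succ (by omega) (by omega) a⟩⟩

theorem unitSeq_entry (i j n : ℕ) (a : A) : (unitSeq i j a).entry n = unitMat i j n a := rfl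

theorem toStab_unitSeq_mul (i j k : ℕ) (a b : A) :
    toStab (unitSeq i j a) * toStab (unitSeq j k b) = toStab (unitSeq i k (a * b)) := by
  rw [← toStab_mul]
  refine toStab_eq_of_eventually (eventually_atTop.2 ⟨j + 1, fun n hn => ?_⟩)
  rw [FinMat.entry_mul, unitSeq_entry, unitSeq_entry, unitSeq_entry]
  ext p q
  rw [CStarMatrix.mul_apply, Finset.sum_eq_single (⟨j, by omega⟩ : Fin n)]
  · simp only [unitMat_apply]
    by_cases h1 : p.val = i <;> by_cases h2 : q.val = k <;> simp [h1, h2]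
  · intro l _ hl
    have : l.val ≠ j := fun h => hl (Fin.ext h)
    simp [unitMat_apply, this]
  · simp

theorem unitSeq_add (i j : ℕ) (a b : A) : unitSeq i j (a + b) = unitSeq i j a + unitSeq i j b := by
  refine cornerSeq_ext fun n => ?_
  ext p q
  show unitMat i j n (a + b) p q = unitMat i j n a p q + unitMat i j n b p q
  simp only [unitMat_apply]; split_ifs <;> simp

theorem unitSeq_smul (i j : ℕ) (c : ℂ) (a : A) : unitSeq i j (c • a) = c • unitSeq i j a := by
  refine cornerSeq_ext fun n => ?_
  ext p q
  show unitMat i j n (c • a) p q = c • unitMat i j n a p q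
  simp only [unitMat_apply]; split_ifs <;> simp

/-- The `n`-th entry as an additive map. -/
def entryHom (n : ℕ) : FinMat A →+ Mat A n where
  toFun := FinMat.entry n
  map_zero' := rfl
  map_add' _ _ := rfl

/-- Every finite matrix is the sum of its entries times matrix units. -/
theorem toStab_eq_sum (x : FinMat A) : ∃ N : ℕ, ∃ c : Fin N → Fin N → A,
    toStab x = ∑ p : Fin N, ∑ q : Fin N, toStab (unitSeq p.val q.val (c p q)) := by
  obtain ⟨N, hN⟩ := eventually_atTop.1 (show ∀ᶠ n in atTop, x.1 (n + 1) = pad n (x.1 n) from x.2)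
  refine ⟨N, fun p q => x.entry N p q, ?_⟩
  simp only [← map_sum]
  refine toStab_eq_of_eventually (eventually_atTop.2 ⟨N, fun n hn => ?_⟩)
  have he (m : ℕ) : (∑ p : Fin N, ∑ q : Fin N, unitSeq p.val q.val (x.entry N p q)).entry m =
      ∑ p : Fin N, ∑ q : Fin N, unitMat p.val q.val m (x.entry N p q) := by
    show entryHom m _ = _
    simp only [map_sum]
    rfl
  rw [he]
  induction n, hn using Nat.le_induction with
  | base =>
    ext r s
    have : ∀ y : Fin N → Fin N → Mat A N, (∑ p, ∑ q, y p q) r s = ∑ p, ∑ q, y p q r s := by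
      intro y
      have hs : ∀ {ι : Type} (S : Finset ι) (z : ι → Mat A N),
          (∑ i ∈ S, z i) r s = ∑ i ∈ S, z i r s := fun S z => by
        classical
        induction S using Finset.induction_on with
        | empty => rfl
        | insert i S hi ih => rw [Finset.sum_insert hi, Finset.sum_insert hi, ← ih]; rfl
      simp only [hs]
    rw [this, Finset.sum_eq_single r, Finset.sum_eq_single s]
    · simp [unitMat_apply]
    · intro q _ hq
      have : s.val ≠ q.val := fun h => hq (Fin.ext h.symm)
      simp [unitMat_apply, this]
    · simp
    · intro p _ hp
      have : r.val ≠ p.val := fun h => hp (Fin.ext h.symm)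
      simp [unitMat_apply, this]
    · simp
  | succ n hn ih =>
    have h1 : x.entry (n + 1) = pad n (x.entry n) := hN n hn
    rw [h1, ih]
    simp only [map_sum]
    refine Finset.sum_congr rfl fun p _ => Finset.sum_congr rfl fun q _ => ?_
    exact (unitMat_succ (by omega) (by omega) _).symm

/-- A two-sided ideal of `A ⊗ 𝕂` that contains `A` is dense. -/
theorem dense_of_corner_mem {J : Submodule ℂ (Stab A)} (hl : ∀ a : Stab A, ∀ x ∈ J, a * x ∈ J)
    (hr : ∀ a : Stab A, ∀ x ∈ J, x * a ∈ J) (hc : ∀ a : A, corner a ∈ J) :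
    Dense (J : Set (Stab A)) := by
  have h1 (i j : ℕ) (a : A) : toStab (unitSeq i j a) ∈ J := by
    have ha : a ∈ Submodule.span ℂ {a : A | 0 ≤ a} := by
      rw [CStarAlgebra.span_nonneg]; trivial
    induction ha using Submodule.span_induction with
    | mem a ha =>
      obtain ⟨s, rfl⟩ : ∃ s : A, s * (s * s) * s = a := by
        refine ⟨CFC.sqrt (CFC.sqrt a), ?_⟩
        have h := CFC.sqrt_mul_sqrt_self _ (CFC.sqrt_nonneg a)
        rw [mul_assoc, mul_assoc, h, ← mul_assoc, h, CFC.sqrt_mul_sqrt_self a ha]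
      rw [← toStab_unitSeq_mul i 0 j, ← toStab_unitSeq_mul i 0 0]
      exact hr _ _ (hl _ _ (hc _))
    | zero =>
      have : unitSeq i j (0 : A) = 0 := by
        have := unitSeq_smul i j 0 (0 : A)
        simpa using this
      rw [this, map_zero]; exact zero_mem J
    | add a b _ _ ha hb => rw [unitSeq_add, map_add]; exact add_mem ha hb
    | smul c a _ ha => rw [unitSeq_smul, toStab_smul]; exact J.smul_mem c ha
  refine denseRange_toStab.mono ?_
  rintro _ ⟨x, rfl⟩
  obtain ⟨N, c, h⟩ := toStab_eq_sum x
  rw [h]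
  exact sum_mem fun p _ => sum_mem fun q _ => h1 _ _ _

end MatrixUnits

/-! ### Boundedness of the dimensions on `QT(A)` -/

section QT

variable {A : Type u} [NonUnitalCStarAlgebra A] [PartialOrder A] [StarOrderedRing A]

/-- On `QT(A)` the trace of a positive contraction of `Ped(A)` is at most `1`, and `f_{ε/2}(b)` is a local
unit of `f_ε(b)`. -/
theorem corner_cutoff_mem_boundedIdeal (b : A) {ε : ℝ} (hε : 0 < ε) :
    corner (cfcₙ (cutoff ε) b) ∈ boundedIdeal (QT A) := by
  refine ⟨1, by simp, fun τ hτ => IsLocalTrace.dim_le fun δ hδ => ?_⟩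
  have hP := isPedLike_Ped (D := A)
  set h : A := cfcₙ (cutoff (ε / 2)) b with hh
  have hh0 : 0 ≤ h := cfcₙ_nonneg fun s _ => cutoff_nonneg _ s
  have hhP : h ∈ Ped A := hP.cutoff_mem (half_pos hε) b
  have hn : ‖h‖ ≤ 1 := norm_cutoff_le _ _
  have h1 := τ.isLocalTrace.cutoff_le_of_le_star_mul isPedLike_Ped (η := δ)
    (a := star (corner (cfcₙ (cutoff ε) b)) * corner (cfcₙ (cutoff ε) b))
    (z := corner (cfcₙ (cutoff ε) b)) (r := 0) (h := corner h) (IsSelfAdjoint.star_mul_self _)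
    (.zero _) (by rw [add_zero]) (by simpa using hδ) (corner_mem_Ped hhP) (map_nonneg corner hh0)
    ((NonUnitalStarAlgHom.norm_apply_le corner h).trans hn)
    (by rw [← map_mul, hh, mul_cfc_eq_self hε (by fun_prop) fun s hs => cutoff_eq_zero hε hs])
  refine (ENNReal.ofReal_le_ofReal h1).trans ?_
  have h2 : ‖τ.1 ⟨corner h, corner_mem_Ped hhP⟩‖ₑ ≤ 1 := by
    have h3 : normOn τ = 1 := hτ
    rw [← h3]
    exact le_iSup (fun b : {b : Ped A // 0 ≤ (b : A) ∧ ‖(b : A)‖ ≤ 1} =>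
      ‖τ.1 ⟨corner (b.1 : A), corner_mem_Ped b.1.2⟩‖ₑ) ⟨⟨h, hhP⟩, hh0, hn⟩
  refine le_trans ?_ h2
  rw [DQT.re, reExt_of_mem _ (corner_mem_Ped hhP), ← ofReal_norm]
  exact ENNReal.ofReal_le_ofReal (Complex.re_le_norm _)

/-- This is where algebraic simplicity enters: the elements of `A` whose dimensions are bounded
on `QT(A)` form a nonzero ideal. -/
theorem corner_mem_boundedIdeal (hsimple : IsSimpleRing A) (a : A) :
    corner a ∈ boundedIdeal (QT A) := by
  let I : TwoSidedIdeal A := TwoSidedIdeal.mk' {a | corner a ∈ boundedIdeal (QT A)}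
    (by simp) (fun {x y} hx hy => by
      show corner (x + y) ∈ boundedIdeal (QT A)
      rw [map_add]; exact add_mem hx hy)
    (fun {x} hx => by
      show corner (-x) ∈ boundedIdeal (QT A)
      rw [map_neg]; exact neg_mem hx)
    (fun {x y} hy => by
      show corner (x * y) ∈ boundedIdeal (QT A)
      rw [map_mul]; exact boundedIdeal_mul_left _ _ hy)
    (fun {x y} hx => by
      show corner (x * y) ∈ boundedIdeal (QT A)
      rw [map_mul]; exact boundedIdeal_mul_right _ _ hx)
  have hI (x : A) : x ∈ I ↔ corner x ∈ boundedIdeal (QT A) := TwoSidedIdeal.mem_mk' ..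
  have := hsimple.simple
  rw [← hI]
  rcases eq_bot_or_eq_top I with h | h
  · have h0 (n : ℕ) : apx (star a * a) n = 0 := by
      have h1 : apx (star a * a) n ∈ I := (hI _).2
        (corner_cutoff_mem_boundedIdeal _ (by positivity))
      rwa [h, TwoSidedIdeal.mem_bot] at h1
    have h1 := tendsto_apx_mul (star_mul_self_nonneg a) (mem_Her_self (star a * a))
    simp only [h0, zero_mul] at h1
    have h2 := tendsto_nhds_unique h1 tendsto_const_nhds
    rw [CStarRing.star_mul_self_eq_zero_iff] at h2
    rw [h2]; exact zero_mem I
  · rw [h]; trivial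

/-- The ideal of elements with bounded dimension is dense in `A ⊗ 𝕂`, so that it contains the Pedersen
ideal. -/
theorem exists_dim_le (hsimple : IsSimpleRing A) {x : Stab A} (hx : x ∈ Ped (Stab A))
    (hx0 : 0 ≤ x) : ∃ C : ℝ≥0∞, C ≠ ⊤ ∧ ∀ τ ∈ QT A, dim τ.re x ≤ C := by
  have hJ : IsDenseIdeal (boundedIdeal (QT A)) :=
    ⟨fun a _ h => boundedIdeal_mul_left _ a h, fun a _ h => boundedIdeal_mul_right _ a h,
      dense_of_corner_mem (fun a _ h => boundedIdeal_mul_left _ a h)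
        (fun a _ h => boundedIdeal_mul_right _ a h) (corner_mem_boundedIdeal hsimple)⟩
  have h := isPedLike_Ped.sqrt_mem hx hx0 _ hJ
  obtain ⟨C, hC, h⟩ := h
  rw [(sqrt_isSelfAdjoint x).star_eq, CFC.sqrt_mul_sqrt_self x hx0] at h
  exact ⟨C, hC, h⟩

/-- The bound passes to the closure, since `τ(f_ε(x))` depends continuously on `τ`. -/
theorem exists_dim_le_closure (hsimple : IsSimpleRing A) {x : Stab A} (hx : x ∈ Ped (Stab A))
    (hx0 : 0 ≤ x) : ∃ C : ℝ≥0∞, C ≠ ⊤ ∧ ∀ τ ∈ closure (QT A), dim τ.re x ≤ C := by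
  obtain ⟨C, hC, h⟩ := exists_dim_le hsimple hx hx0
  refine ⟨C, hC, fun τ hτ => IsLocalTrace.dim_le fun ε hε => ?_⟩
  have hcl : IsClosed {τ : DQT (Stab A) | ENNReal.ofReal (τ.re (cfcₙ (cutoff ε) x)) ≤ C} :=
    isClosed_le (ENNReal.continuous_ofReal.comp
      (DQT.continuous_re (isPedLike_Ped.cutoff_mem hε x))) continuous_const
  exact closure_minimal (fun τ hτ =>
    (τ.isLocalTrace.cutoff_le_dim isPedLike_Ped hε x).trans (h τ hτ)) hcl hτ

end QT

/-! ### Compactness of the closure of `QT(A)` -/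

section Compactness

variable {D : Type u} [NonUnitalCStarAlgebra D] [PartialOrder D] [StarOrderedRing D]

/-- The `j`-th column of a matrix, the other column being `0`. -/
def M₂.col (S : M₂ D) (j : Fin 2) : M₂ D := unit₂ 0 j (S.entry 0 j) + unit₂ 1 j (S.entry 1 j)

theorem M₂.col_add_col (S : M₂ D) : S.col 0 + S.col 1 = S := by
  conv_rhs => rw [eq_sum_unit₂ S]
  simp only [M₂.col, Fin.sum_univ_two]
  abel

theorem M₂.star_mul_entry (S : M₂ D) (i j : Fin 2) :
    (star S * S).entry i j = star (S.entry 0 i) * S.entry 0 j + star (S.entry 1 i) * S.entry 1 j := by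
  rw [M₂.mul_entry, Fin.sum_univ_two, M₂.star_entry, M₂.star_entry]

theorem M₂.star_col_mul_col (S : M₂ D) (j : Fin 2) :
    star (S.col j) * S.col j = diag₂ j ((star S * S).entry j j) := by
  have h01 : (0 : Fin 2) ≠ 1 := by decide
  have h10 : (1 : Fin 2) ≠ 0 := by decide
  simp only [M₂.col, star_add, star_unit₂, add_mul, mul_add, unit₂_mul_same,
    unit₂_mul_of_ne _ _ h01, unit₂_mul_of_ne _ _ h10, diag₂_apply, M₂.star_mul_entry, map_add,
    add_zero, zero_add]

theorem M₂.entry_self_nonneg {X : M₂ D} (hX : 0 ≤ X) (j : Fin 2) : 0 ≤ X.entry j j := by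
  have h := CFC.sqrt_mul_sqrt_self X hX
  rw [← h]
  nth_rw 1 [← (sqrt_isSelfAdjoint X).star_eq]
  rw [M₂.star_mul_entry]
  exact add_nonneg (star_mul_self_nonneg _) (star_mul_self_nonneg _)

/-- The dimension of a positive matrix is at most the sum of those of its diagonal entries. -/
theorem IsLocalTrace.dim_le_dim_entry {P : NonUnitalStarSubalgebra ℂ D} {t : D → ℝ}
    {t₂ : M₂ D → ℝ} (ht₂ : IsLocalTrace (mat₂ P) t₂) (h : ∀ x ∈ P, t₂ (unit₂ 0 0 x) = t x)
    (hP : IsPedLike P) {X : M₂ D} (hX : 0 ≤ X) :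
    dim t₂ X ≤ dim t (X.entry 0 0) + dim t (X.entry 1 1) := by
  have hX0 := M₂.entry_self_nonneg hX
  rw [← ht₂.dim_diag₂ h hP (hX0 0) (hX0 1)]
  refine ht₂.dim_le_of_le_smul hP.mat₂ 2 hX
    (add_nonneg (map_nonneg _ (hX0 0)) (map_nonneg _ (hX0 1))) ?_
  have e : star (CFC.sqrt X) * CFC.sqrt X = X := by
    rw [(sqrt_isSelfAdjoint X).star_eq, CFC.sqrt_mul_sqrt_self X hX]
  have h2 := star_add_mul_add_le ((CFC.sqrt X).col 0) ((CFC.sqrt X).col 1)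
  rwa [M₂.col_add_col, M₂.star_col_mul_col, M₂.star_col_mul_col, e] at h2

theorem mat₂Equiv_surjective (P : NonUnitalStarSubalgebra ℂ D) :
    Function.Surjective (mat₂Equiv P) := fun M =>
  ⟨⟨CStarMatrix.ofMatrix fun i j => (M i j : D), fun i j => (M i j).2⟩, rfl⟩

theorem mat₂Equiv_unit₂ {P : NonUnitalStarSubalgebra ℂ D} {x : D} (hx : x ∈ P) :
    mat₂Equiv P ⟨unit₂ 0 0 x, unit₂_mem 0 0 hx⟩ = Matrix.single 0 0 ⟨x, hx⟩ := by
  ext i j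
  show ((unit₂ 0 0 x).entry i j : D) = ((Matrix.single 0 0 (⟨x, hx⟩ : P) : Matrix _ _ _) i j : P)
  rw [unit₂_entry, Matrix.single_apply]
  split_ifs <;> rfl

/-- The upper left corner embedding of a ring into its `2 × 2` matrices. -/
def singleHom (R : Type u) [NonUnitalRing R] [StarRing R] [Module ℂ R] :
    R →⋆ₙₐ[ℂ] Matrix (Fin 2) (Fin 2) R where
  toFun := Matrix.single 0 0
  map_smul' c x := (Matrix.smul_single c 0 0 x).symm
  map_zero' := Matrix.single_zero 0 0
  map_add' x y := Matrix.single_add 0 0 x y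
  map_mul' x y := (Matrix.single_mul_single_same (c := x) 0 0 0 y).symm
  map_star' x := by rw [Matrix.star_eq_conjTranspose, Matrix.conjTranspose_single]

theorem isClosed_isQuasitrace (R : Type u) [NonUnitalRing R] [StarRing R] [Module ℂ R] :
    IsClosed {τ : R → ℂ | IsQuasitrace τ} := by
  have e : {τ : R → ℂ | IsQuasitrace τ} =
      {τ | ∀ x, 0 ≤ τ (star x * x)} ∩ {τ | ∀ x, τ (star x * x) = τ (x * star x)} ∩
      {τ | ∀ B : NonUnitalStarSubalgebra ℂ R, (∀ x ∈ B, ∀ y ∈ B, x * y = y * x) →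
        (∀ x ∈ B, ∀ y ∈ B, τ (x + y) = τ x + τ y) ∧ ∀ c : ℂ, ∀ x ∈ B, τ (c • x) = c * τ x} ∩
      {τ | ∀ a b : R, IsSelfAdjoint a → IsSelfAdjoint b →
        τ (a + Complex.I • b) = τ a + Complex.I * τ b} :=
    Set.ext fun τ => ⟨fun h => ⟨⟨⟨h.1, h.2⟩, h.3⟩, h.4⟩, fun h => ⟨h.1.1.1, h.1.1.2, h.1.2, h.2⟩⟩
  rw [e]
  simp only [Set.ofPred_forall, Set.ofPred_and]
  refine (((isClosed_iInter fun x => ?_).inter (isClosed_iInter fun x => ?_)).inter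
    (isClosed_iInter fun B => isClosed_iInter fun _ => (isClosed_iInter fun x =>
      isClosed_iInter fun _ => isClosed_iInter fun y => isClosed_iInter fun _ => ?_).inter
      (isClosed_iInter fun c => isClosed_iInter fun x => isClosed_iInter fun _ => ?_))).inter
    (isClosed_iInter fun a => isClosed_iInter fun b => isClosed_iInter fun _ =>
      isClosed_iInter fun _ => ?_)
  · exact isClosed_le continuous_const (continuous_apply _)
  all_goals exact isClosed_eq (by fun_prop) (by fun_prop)

instance : T2Space (DQT D) := inferInstanceAs (T2Space {τ : Ped D → ℂ // IsTwoQuasitrace τ})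

/-- The bounds on `S` pass to the extensions to `2 × 2` matrices, and the quasitraces on the
matrices that satisfy these bounds form a compact set by Tychonoff's theorem. The restrictions to
the corner form a compact set that contains `S`. -/
theorem isCompact_closure_of_dim_bounded {S : Set (DQT D)}
    (hS : ∀ x ∈ Ped D, 0 ≤ x → ∃ C : ℝ≥0∞, C ≠ ⊤ ∧ ∀ τ ∈ S, dim τ.re x ≤ C) :
    IsCompact (closure S) := by
  have hP := isPedLike_Ped (D := D)
  have hb (M : Matrix (Fin 2) (Fin 2) (Ped D)) : ∃ C : ℝ, ∀ τ ∈ S,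
      ∀ τ₂ : Matrix (Fin 2) (Fin 2) (Ped D) → ℂ, IsQuasitrace τ₂ →
      (∀ x, τ₂ (Matrix.single 0 0 x) = τ.1 x) → ‖τ₂ M‖ ≤ C := by
    obtain ⟨X, rfl⟩ := mat₂Equiv_surjective _ M
    obtain ⟨C, hC⟩ := exists_norm_le_of_forall_nonneg hP.mat₂
      (S := {σ | IsQuasitrace σ ∧ ∃ τ ∈ S, ∀ (x : D) (hx : x ∈ Ped D),
        σ ⟨unit₂ 0 0 x, unit₂_mem 0 0 hx⟩ = τ.1 ⟨x, hx⟩}) (fun σ hσ => hσ.1) (fun x hx hx0 => by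
        have hx0' := M₂.entry_self_nonneg hx0
        obtain ⟨C₀, hC₀, h₀⟩ := hS _ (hx 0 0) (hx0' 0)
        obtain ⟨C₁, hC₁, h₁⟩ := hS _ (hx 1 1) (hx0' 1)
        refine ⟨(ENNReal.ofReal ‖x‖ * (C₀ + C₁)).toReal, ?_⟩
        rintro σ ⟨hσ, τ, hτ, h⟩
        have ht := hσ.isLocalTrace
        refine (ENNReal.ofReal_le_iff_le_toReal (ENNReal.mul_ne_top ENNReal.ofReal_ne_top
          (ENNReal.add_ne_top.2 ⟨hC₀, hC₁⟩))).1 ((ht.le_norm_mul_dim hP.mat₂ hx hx0).trans ?_)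
        gcongr
        refine (ht.dim_le_dim_entry (t := τ.re) (fun y hy => ?_) hP hx0).trans
          (add_le_add (h₀ τ hτ) (h₁ τ hτ))
        rw [reExt_of_mem _ (unit₂_mem 0 0 hy), h y hy, DQT.re, reExt_of_mem _ hy]) X
    refine ⟨C, fun τ hτ τ₂ hτ₂ h => hC _ ⟨hτ₂.comp (mat₂Equiv (Ped D)), τ, hτ, fun x hx => ?_⟩⟩
    rw [mat₂Equiv_unit₂ hx, h]
  choose C hC using hb
  let K : Set (Matrix (Fin 2) (Fin 2) (Ped D) → ℂ) :=
    Set.univ.pi (fun M => Metric.closedBall 0 (C M)) ∩ {τ₂ | IsQuasitrace τ₂}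
  have hK : IsCompact K := (isCompact_univ_pi fun M => isCompact_closedBall 0 (C M)).inter_right
    (isClosed_isQuasitrace _)
  let F : K → DQT D := fun τ₂ => ⟨fun x => τ₂.1 (Matrix.single 0 0 x),
    τ₂.2.2.comp (singleHom (Ped D)), τ₂.1, τ₂.2.2, fun _ => rfl⟩
  have hF : Continuous F := continuous_induced_rng.2 (continuous_pi fun x =>
    (continuous_apply (Matrix.single 0 0 x)).comp continuous_subtype_val)
  have := isCompact_iff_compactSpace.1 hK
  refine (isCompact_range hF).closure_of_subset fun τ hτ => ?_
  obtain ⟨_, τ₂, h2, h3⟩ := τ.2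
  exact ⟨⟨τ₂, fun M _ => by simpa using hC M τ hτ τ₂ h2 h3, h2⟩, Subtype.ext (funext h3)⟩

end Compactness

theorem isCompact_closure_QT {A : Type u} [NonUnitalCStarAlgebra A] [PartialOrder A]
    [StarOrderedRing A] (hsimple : IsSimpleRing A) : IsCompact (closure (QT A)) :=
  isCompact_closure_of_dim_bounded fun _ hx hx0 => exists_dim_le hsimple hx hx0

/-! ### Oscillation, the `2`-norm, and cutting off one element -/

section Step

/-- Cutting off `f_s` at `1/2` amounts to a cut-off at a value between `s` and `2 s`. -/
theorem cutoff_two_mul_le {s : ℝ} (hs : 0 < s) (x : ℝ) :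
    cutoff (2 * s) x ≤ cutoff (1 / 2) (cutoff s x) := by
  rcases le_total x (2 * s) with h | h
  · rw [cutoff_eq_zero (by linarith) h]; exact cutoff_nonneg _ _
  · rw [cutoff_eq_one hs h, cutoff_eq_one (ε := 1 / 2) (t := 1) (by norm_num) (by norm_num)]; exact cutoff_le_one _ _

variable {D : Type u} [NonUnitalCStarAlgebra D] [PartialOrder D] [StarOrderedRing D]
variable {P : NonUnitalStarSubalgebra ℂ D} {t : D → ℝ}

theorem cutoff_half_cutoff {a : D} (ha : IsSelfAdjoint a) (s : ℝ) :
    cfcₙ (cutoff (1 / 2)) (cfcₙ (cutoff s) a) = cfcₙ (fun x => cutoff (1 / 2) (cutoff s x)) a := by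
  rw [← cfcₙ_comp' (cutoff (1 / 2)) (cutoff s) a]

theorem IsLocalTrace.cutoff_two_mul_le (ht : IsLocalTrace P t) (hP : IsPedLike P) {a : D}
    (ha : IsSelfAdjoint a) {s : ℝ} (hs : 0 < s) :
    t (cfcₙ (cutoff (2 * s)) a) ≤ t (cfcₙ (cutoff (1 / 2)) (cfcₙ (cutoff s) a)) := by
  have h := hP.cutoff_mem (δ := 1 / 2) (by norm_num) (cfcₙ (cutoff s) a)
  rw [cutoff_half_cutoff ha] at h ⊢
  exact ht.cfc_mono hP (hP.cutoff_mem (by linarith) a) h (by fun_prop) (by fun_prop) (by simp)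
    (by simp) fun x _ => CStarStab.cutoff_two_mul_le hs x

theorem cfcₙ_mul_self {x : D} (hx : IsSelfAdjoint x) {f : ℝ → ℝ} (hf : Continuous f)
    (hf0 : f 0 = 0) : cfcₙ f (x * x) = cfcₙ (fun s => f (s * s)) x := by
  have e : x * x = cfcₙ (fun s : ℝ => s * s) x := by
    rw [cfcₙ_mul (fun s : ℝ => s) (fun s : ℝ => s) x, cfcₙ_id' ℝ x]
  rw [e, ← cfcₙ_comp' f (fun s : ℝ => s * s) x]

/-- Compression by `1 - p` loses at most the dimension of `p a p`. -/
theorem IsLocalTwoTrace.cutoff_le_compress_add (ht : IsLocalTwoTrace P t) (hP : IsPedLike P) {a p : D}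
    (ha : 0 ≤ a) (hp : IsSelfAdjoint p) {η : ℝ} (hη : 0 < η) :
    ENNReal.ofReal (t (cfcₙ (cutoff η) a)) ≤
      ENNReal.ofReal (t (cfcₙ (cutoff (η / 8)) (compress p a))) + dim t (p * a * p) := by
  have hasa := IsSelfAdjoint.of_nonneg ha
  have hr := sqrt_isSelfAdjoint a
  have hrr := CFC.sqrt_mul_sqrt_self a ha
  have hv : star (CFC.sqrt a * p) * (CFC.sqrt a * p) = p * a * p := by
    rw [star_mul, hp.star_eq, hr.star_eq, mul_assoc, ← mul_assoc (CFC.sqrt a), hrr, ← mul_assoc]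
  have hv0 : 0 ≤ p * a * p := hv ▸ star_mul_self_nonneg _
  have hle := star_add_mul_add_le (CFC.sqrt a - CFC.sqrt a * p) (CFC.sqrt a * p)
  rw [sub_add_cancel, hr.star_eq, hrr, hv, compress_eq_star_mul hp hr hrr, smul_add] at hle
  obtain ⟨Z, hZ⟩ : ∃ Z, Z = compress p a := ⟨_, rfl⟩
  rw [← hZ] at hle ⊢
  have hZ0 : 0 ≤ Z := hZ ▸ compress_nonneg hp ha
  have hZsa := IsSelfAdjoint.of_nonneg hZ0
  -- `f_{η/8}(Z)` is a unit for `(2 Z - η/2)₊`, which differs from `2 Z` by at most `η/2 < η`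
  obtain ⟨g, hg⟩ : ∃ g : ℝ → ℝ, g = fun s => max (2 * s - η / 2) 0 := ⟨_, rfl⟩
  have hgc : Continuous g := by rw [hg]; fun_prop
  have hg0 : g 0 = 0 := by rw [hg]; exact max_eq_right (by linarith)
  have hgnn : 0 ≤ cfcₙ g Z := cfcₙ_nonneg fun s _ => by simp [hg]
  have e : (2 : ℝ) • Z = cfcₙ (fun s : ℝ => 2 * s) Z := by
    rw [cfcₙ_const_mul .., cfcₙ_id' ℝ Z]
  have h1 := ht.cutoff_le_dim_add hP hasa hgnn (smul_nonneg (by norm_num : (0 : ℝ) ≤ 2) hv0)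
    (r := (2 : ℝ) • Z - cfcₙ g Z) (η := η)
    (((IsSelfAdjoint.all (2 : ℝ)).smul hZsa).sub (cfcₙ_predicate g Z))
    (hle.trans (le_of_eq (by abel))) (by
      rw [e, ← cfcₙ_sub ..]
      refine (norm_cfcₙ_le (c := η / 2) fun s hs => ?_).trans_lt (half_lt_self hη)
      have hs0 : 0 ≤ s := quasispectrum_nonneg_of_nonneg Z hZ0 s hs
      rw [Real.norm_eq_abs, abs_le, hg]
      beta_reduce
      rcases le_total (2 * s - η / 2) 0 with h | h
      · rw [max_eq_right h]; constructor <;> linarith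
      · rw [max_eq_left h]; constructor <;> linarith)
  refine h1.trans (add_le_add (IsLocalTrace.dim_le fun ε hε => ENNReal.ofReal_le_ofReal ?_)
    (ht.1.dim_le_of_le_smul hP 2 (smul_nonneg (by norm_num) hv0) hv0 le_rfl))
  have hm := hP.cutoff_mem hε (cfcₙ g Z)
  rw [← cfcₙ_comp' (cutoff ε) g Z] at hm ⊢
  refine ht.1.cfc_mono hP hm (hP.cutoff_mem (by linarith) Z) (by fun_prop) (by fun_prop)
    (by simp [hg0]) (by simp) fun s _ => ?_
  rcases le_total s (η / 4) with h | h
  · have : g s = 0 := by rw [hg]; exact max_eq_right (by linarith)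
    rw [this, cutoff_zero]; exact cutoff_nonneg _ _
  · rw [cutoff_eq_one (by linarith) (show 2 * (η / 8) ≤ s by linarith)]; exact cutoff_le_one _ _

theorem eval_cutdown_le_twoNormAt_sq (τ : DQT D) (x : D) {ε : ℝ} (hε : 0 < ε) :
    ENNReal.ofReal (τ.re (cfcₙ (fun s : ℝ => max (s - ε) 0) (star x * x))) ≤ twoNormAt τ x ^ 2 := by
  have h := le_iSup (fun ε : Set.Ioi (0 : ℝ) =>
    τ.eval (cutdownPed ε.2 (star x * x)) ^ (1 / 2 : ℝ)) ⟨ε, hε⟩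
  have h2 := ENNReal.rpow_le_rpow h (show (0 : ℝ) ≤ 2 by norm_num)
  rw [← ENNReal.rpow_mul, DQT.eval_eq] at h2
  norm_num at h2
  exact h2

/-- Two positive elements that are close in the `2`-norm have nearly the same dimension, up to a
cut-off. -/
theorem cutoff_le_dim_add_twoNormAt (τ : DQT D) {f c : D} (hf : 0 ≤ f) (hc : 0 ≤ c) :
    ENNReal.ofReal (τ.re (cfcₙ (cutoff (1 / 2)) f)) ≤
      dim τ.re c + 32 * twoNormAt τ (f - c) ^ 2 := by
  have hP := isPedLike_Ped (D := D)
  have ht := τ.isLocalTwoTrace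
  have hfsa := IsSelfAdjoint.of_nonneg hf
  obtain ⟨x, hx⟩ : ∃ x, x = f - c := ⟨_, rfl⟩
  have hxsa : IsSelfAdjoint x := hx ▸ hfsa.sub (IsSelfAdjoint.of_nonneg hc)
  rw [← hx]
  -- `f = c + x ≤ c + (x - 1/4)₊ + min(|x|, 1/4)`, the last term has norm less than `1/2`, and the
  -- characteristic function of `s > 1/4` is at most `32 (s² - 1/32)₊`
  obtain ⟨g, hg⟩ : ∃ g : ℝ → ℝ, g = fun s => max (s - 1 / 4) 0 := ⟨_, rfl⟩
  have hgc : Continuous g := by rw [hg]; fun_prop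
  have hg0 : g 0 = 0 := by simp [hg]
  have hgnn : 0 ≤ cfcₙ g x := cfcₙ_nonneg fun s _ => by simp [hg]
  obtain ⟨k, hk⟩ : ∃ k : ℝ → ℝ, k = fun s => min |s| (1 / 4) := ⟨_, rfl⟩
  have hkc : Continuous k := by rw [hk]; fun_prop
  have hk0 : k 0 = 0 := by simp [hk]
  have hle : f ≤ c + cfcₙ g x + cfcₙ k x := by
    have : x ≤ cfcₙ g x + cfcₙ k x := by
      rw [← cfcₙ_add ..]
      nth_rw 1 [← cfcₙ_id' ℝ x]
      refine cfcₙ_mono fun s _ => ?_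
      rw [hg, hk]
      rcases le_total |s| (1 / 4) with h | h
      · simp only [min_eq_left h]
        have := le_abs_self s; have := le_max_right (s - 1 / 4) 0; linarith
      · simp only [min_eq_right h]
        have := le_max_left (s - 1 / 4) 0; linarith
    rw [hx] at this ⊢
    rw [sub_le_iff_le_add] at this
    exact this.trans (le_of_eq (by abel))
  have h1 := ht.cutoff_le_dim_add hP (η := 1 / 2) hfsa hc hgnn (cfcₙ_predicate k x) hle
    ((norm_cfcₙ_le (c := 1 / 4) fun s _ => by
      rw [hk, Real.norm_of_nonneg (le_min (abs_nonneg s) (by norm_num))]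
      exact min_le_right _ _).trans_lt (by norm_num))
  refine h1.trans (add_le_add le_rfl (IsLocalTrace.dim_le fun ε hε => ?_))
  have h2 := eval_cutdown_le_twoNormAt_sq τ x (ε := 1 / 32) (by norm_num)
  refine le_trans ?_ (mul_le_mul_right h2 32)
  rw [show (32 : ℝ≥0∞) = ENNReal.ofReal 32 by simp, ← ENNReal.ofReal_mul (by norm_num)]
  refine ENNReal.ofReal_le_ofReal ?_
  have hm := hP.cutoff_mem hε (cfcₙ g x)
  obtain ⟨l, hl⟩ : ∃ l : ℝ → ℝ, l = fun s => max (s - 1 / 32) 0 := ⟨_, rfl⟩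
  have hlc : Continuous l := by rw [hl]; fun_prop
  have hl0 : l 0 = 0 := by simp [hl]
  have hmm : cfcₙ l (star x * x) ∈ Ped D :=
    hP.cfc_mem (δ := 1 / 32) (by norm_num) (fun s hs => by rw [hl]; exact max_eq_right (by linarith)) _
  rw [← hl]
  rw [hxsa.star_eq, cfcₙ_mul_self hxsa hlc hl0] at hmm ⊢
  rw [← cfcₙ_comp' (cutoff ε) g x] at hm ⊢
  rw [← ht.1.cfc_const_mul 32 hmm (by fun_prop) (by simp [hl0])]
  refine ht.1.cfc_mono hP hm ?_ (by fun_prop) (by fun_prop) (by simp [hg0]) (by simp [hl0])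
    fun s _ => ?_
  · rw [cfcₙ_const_mul ..]; exact SMulMemClass.smul_mem ((32 : ℝ) : ℂ) hmm
  · rcases le_total s (1 / 4) with h | h
    · have : g s = 0 := by rw [hg]; exact max_eq_right (by linarith)
      rw [this, cutoff_zero, hl]
      simp
    · refine (cutoff_le_one _ _).trans ?_
      have := le_max_left (s * s - 1 / 32) 0
      rw [hl]
      simp only
      nlinarith

variable {A : Type u} [NonUnitalCStarAlgebra A] [PartialOrder A] [StarOrderedRing A]

/-- Small oscillation means that, uniformly in `τ`, a single cut-off captures the dimension. -/
theorem exists_dim_le_of_osc_lt {c : Stab A} {ε : ℝ≥0∞} (h : osc c < ε) :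
    ∃ n : ℕ, ∀ τ ∈ closure (QT A),
      dim τ.re c ≤ ENNReal.ofReal (τ.re (cfcₙ (cutoff (1 / (n + 1))) c)) + ε := by
  obtain ⟨n, hn⟩ := iInf_lt_iff.1 h
  refine ⟨n, fun τ hτ => ?_⟩
  have h1 := (le_iSup₂ (f := fun (τ : DQT (Stab A)) (_ : τ ∈ closure (QT A)) => dimFun τ c -
    τ.eval (cutoffPed (Nat.one_div_pos_of_nat (α := ℝ) (n := n)) c)) τ hτ).trans hn.le
  rw [DQT.dimFun_eq, DQT.eval_eq, tsub_le_iff_left] at h1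
  exact h1

theorem osc_le_of_forall {c : Stab A} {ε : ℝ≥0∞} {σ : ℝ} (hσ : 0 < σ)
    (h : ∀ τ ∈ closure (QT A), dim τ.re c ≤ ENNReal.ofReal (τ.re (cfcₙ (cutoff σ) c)) + ε) :
    osc c ≤ ε := by
  obtain ⟨n, hn⟩ := exists_nat_one_div_lt hσ
  refine (iInf_le _ n).trans (iSup₂_le fun τ hτ => ?_)
  rw [DQT.dimFun_eq, DQT.eval_eq, tsub_le_iff_left]
  exact (h τ hτ).trans (add_le_add (ENNReal.ofReal_le_ofReal
    (τ.isLocalTrace.cutoff_mono isPedLike_Ped (by positivity) hn.le c)) le_rfl)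

/-- One step of the exhaustion of `e`: an element `b` of small oscillation that captures the trace
of `f_δ(e)`, and a local unit `p` for `b` such that the compression of `e` by `1 - p` captures
what is left. -/
theorem HasTAOZ.exists_step (h : HasTAOZ A) {e : Stab A} (he : 0 ≤ e) {δ : ℝ} (hδ : 0 < δ)
    {ε : NNReal} (hε : 0 < ε) :
    ∃ b p : Stab A, (b ∈ Her e ∧ b ∈ Ped (Stab A) ∧ 0 ≤ b ∧ ‖b‖ ≤ 1 ∧ osc b ≤ ε) ∧
      p ∈ Her e ∧ IsSelfAdjoint p ∧ b * p = b ∧ ∀ τ ∈ closure (QT A),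
        ENNReal.ofReal (τ.re (cfcₙ (cutoff δ) e)) ≤ ENNReal.ofReal (τ.re b) + ε ∧
        ∀ η : ℝ, 0 < η → ENNReal.ofReal (τ.re (cfcₙ (cutoff η) e)) ≤
          ENNReal.ofReal (τ.re (cfcₙ (cutoff (η / 8)) (compress p e))) +
            (ENNReal.ofReal (τ.re b) + ε) := by
  have hP := isPedLike_Ped (D := Stab A)
  have hesa := IsSelfAdjoint.of_nonneg he
  have hε' : (0 : ℝ) < ε := hε
  obtain ⟨f, hf⟩ : ∃ f, f = cfcₙ (cutoff (δ / 2)) e := ⟨_, rfl⟩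
  have hf0 : 0 ≤ f := hf ▸ cfcₙ_nonneg fun s _ => cutoff_nonneg _ s
  have hfP : f ∈ Ped (Stab A) := hf ▸ hP.cutoff_mem (half_pos hδ) e
  have hfe : f ∈ Her e := hf ▸ cfc_mem_Her (mem_Her_self e) _
  -- `ε₁` is so small that `ε₁ + 32 ε₁² ≤ ε`
  obtain ⟨ε₁, hε₁, hε₁1, hε₁ε⟩ : ∃ ε₁ : ℝ, 0 < ε₁ ∧ ε₁ ≤ 1 ∧ 64 * ε₁ ≤ ε :=
    ⟨min 1 (ε / 64), by positivity, min_le_left _ _, by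
      have := min_le_right (1 : ℝ) (ε / 64); linarith⟩
  obtain ⟨c, hc, hc0, hcn, -, hco⟩ := h f hfP hf0 ε₁ hε₁
  have hcsa := IsSelfAdjoint.of_nonneg hc0
  obtain ⟨m, hm⟩ := exists_dim_le_of_osc_lt hco
  obtain ⟨s, hs, hsm⟩ : ∃ s : ℝ, 0 < s ∧ 2 * s = 1 / (m + 1) :=
    ⟨1 / (m + 1) / 2, by positivity, by ring⟩
  rw [← hsm] at hm
  have hle : ENNReal.ofReal ε₁ + 32 * ENNReal.ofReal ε₁ ^ 2 ≤ ε := by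
    rw [show (32 : ℝ≥0∞) = ENNReal.ofReal 32 by simp, ← ENNReal.ofReal_pow hε₁.le,
      ← ENNReal.ofReal_mul (by norm_num), ← ENNReal.ofReal_add hε₁.le (by positivity),
      ← ENNReal.ofReal_coe_nnreal]
    exact ENNReal.ofReal_le_ofReal (by nlinarith)
  have hle1 : ENNReal.ofReal ε₁ ≤ ε := le_self_add.trans hle
  have hbc : cfcₙ (cutoff s) c ∈ Her c := cfc_mem_Her (mem_Her_self c) _
  have hb0 : 0 ≤ cfcₙ (cutoff s) c := cfcₙ_nonneg fun x _ => cutoff_nonneg _ x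
  have hbe := Her_mono hfe (Her_mono hc hbc)
  obtain ⟨p, hp⟩ : ∃ p, p = cfcₙ (cutoff (s / 2)) c := ⟨_, rfl⟩
  have hpc : p ∈ Her c := hp ▸ cfc_mem_Her (mem_Her_self c) _
  have hpsa : IsSelfAdjoint p := hp ▸ cfcₙ_predicate _ _
  have hdc (τ) (hτ : τ ∈ closure (QT A)) :
      dim τ.re c ≤ ENNReal.ofReal (τ.re (cfcₙ (cutoff s) c)) + ENNReal.ofReal ε₁ :=
    (hm τ hτ).trans (add_le_add (ENNReal.ofReal_le_ofReal
      (τ.isLocalTrace.cutoff_mono hP hs (by linarith) c)) le_rfl)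
  refine ⟨cfcₙ (cutoff s) c, p, ⟨hbe, hP.cutoff_mem hs c, hb0, norm_cutoff_le _ _, ?_⟩,
    Her_mono hfe (Her_mono hc hpc), hpsa, ?_, fun τ hτ => ⟨?_, fun η hη => ?_⟩⟩
  · refine osc_le_of_forall (σ := 1 / 2) (by norm_num) fun τ hτ => ?_
    refine (τ.isLocalTrace.dim_le_of_mem_Her hP hc0 hb0 hbc).trans ((hm τ hτ).trans ?_)
    exact add_le_add (ENNReal.ofReal_le_ofReal (τ.isLocalTrace.cutoff_two_mul_le hP hcsa hs)) hle1
  · have := mul_cfc_eq_self hs (continuous_cutoff s) (fun t ht => cutoff_eq_zero hs ht) c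
    rw [← hp] at this
    have h2 := congrArg star this
    rwa [star_mul, hpsa.star_eq, (IsSelfAdjoint.of_nonneg hb0).star_eq] at h2
  · have h1 : ENNReal.ofReal (τ.re (cfcₙ (cutoff δ) e)) ≤
        ENNReal.ofReal (τ.re (cfcₙ (cutoff (1 / 2)) f)) := by
      have := τ.isLocalTrace.cutoff_two_mul_le hP hesa (half_pos hδ)
      rw [mul_div_cancel₀ _ (two_ne_zero)] at this
      rw [hf]; exact ENNReal.ofReal_le_ofReal this
    have h2 : twoNormAt τ (f - c) ≤ ENNReal.ofReal ε₁ :=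
      (le_iSup₂ (f := fun (τ : DQT (Stab A)) (_ : τ ∈ closure (QT A)) => twoNormAt τ (f - c))
        τ hτ).trans (le_of_lt (by assumption))
    calc _ ≤ dim τ.re c + 32 * twoNormAt τ (f - c) ^ 2 :=
          h1.trans (cutoff_le_dim_add_twoNormAt τ hf0 hc0)
      _ ≤ ENNReal.ofReal (τ.re (cfcₙ (cutoff s) c)) + ENNReal.ofReal ε₁ +
          32 * ENNReal.ofReal ε₁ ^ 2 := by
        gcongr
        exact hdc τ hτ
      _ ≤ _ := by rw [add_assoc]; gcongr
  · refine (τ.isLocalTwoTrace.cutoff_le_compress_add hP he hpsa hη).trans (add_le_add le_rfl ?_)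
    refine (τ.isLocalTrace.dim_le_of_mem_Her hP hc0 ?_ ?_).trans ((hdc τ hτ).trans
      (add_le_add le_rfl hle1))
    · have := star_left_conjugate_nonneg he p
      rwa [hpsa.star_eq] at this
    · have h1 : p * e * p ≤ ‖e‖ • (p * p) := by
        have := CStarAlgebra.star_left_conjugate_le_norm_smul (a := p) (b := e) hesa
        rwa [hpsa.star_eq] at this
      refine (isHereditary_Her c).mem_of_le _ _ ?_ h1
        (SMulMemClass.smul_mem (‖e‖ : ℂ) (mul_mem hpc hpc))
      have := star_left_conjugate_nonneg he p
      rwa [hpsa.star_eq] at this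

end Step

/-! ### Exhaustion by elements of small oscillation -/

section Exhaustion

variable {A : Type u} [NonUnitalCStarAlgebra A] [PartialOrder A] [StarOrderedRing A]

theorem mul_compress_eq_zero {D : Type u} [NonUnitalCStarAlgebra D] {b p : D} (h : b * p = b) (a : D) :
    b * compress p a = 0 := by
  simp only [compress, mul_add, mul_sub, ← mul_assoc, h]
  simp

/-- The dimension is additive on orthogonal sums. -/
theorem IsLocalTrace.dim_sum {D : Type u} [NonUnitalCStarAlgebra D] [PartialOrder D]
    [StarOrderedRing D] {P : NonUnitalStarSubalgebra ℂ D} {t : D → ℝ} (ht : IsLocalTrace P t)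
    (hP : IsPedLike P) {b : ℕ → D} (hb0 : ∀ n, 0 ≤ b n) (hb : ∀ m n, m ≠ n → b m * b n = 0)
    (N : ℕ) : dim t (∑ n ∈ Finset.range N, b n) = ∑ n ∈ Finset.range N, dim t (b n) := by
  induction N with
  | zero =>
    refine le_antisymm (dim_le fun ε _ => ?_) (by simp)
    have := ht.smul 0 0 (zero_mem _) (.zero _)
    simp only [smul_zero, zero_mul] at this
    simp [this]
  | succ N ih =>
    rw [Finset.sum_range_succ, Finset.sum_range_succ, ← ih]
    refine ht.dim_add_of_mul_eq_zero hP (Finset.sum_nonneg fun n _ => hb0 n) (hb0 N) ?_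
    rw [Finset.sum_mul]
    exact Finset.sum_eq_zero fun n hn => hb n N (Finset.mem_range.1 hn).ne

/-- Pairwise orthogonal elements of `Her(a)` have total dimension at most that of `a`. -/
theorem IsLocalTrace.tsum_dim_le {D : Type u} [NonUnitalCStarAlgebra D] [PartialOrder D]
    [StarOrderedRing D] {P : NonUnitalStarSubalgebra ℂ D} {t : D → ℝ} (ht : IsLocalTrace P t)
    (hP : IsPedLike P) {a : D} (ha : 0 ≤ a) {b : ℕ → D} (hba : ∀ n, b n ∈ Her a)
    (hb0 : ∀ n, 0 ≤ b n) (hb : ∀ m n, m ≠ n → b m * b n = 0) : ∑' n, dim t (b n) ≤ dim t a :=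
  ENNReal.tsum_le_of_sum_range_le fun N => by
    rw [← ht.dim_sum hP hb0 hb]
    exact ht.dim_le_of_mem_Her hP ha (Finset.sum_nonneg fun n _ => hb0 n)
      (sum_mem fun n _ => hba n)

/-- A positive contraction has trace at most its dimension. -/
theorem DQT.eval_le_dimFun {D : Type u} [NonUnitalCStarAlgebra D] [PartialOrder D]
    [StarOrderedRing D] (τ : DQT D) {b : Ped D} (hb : 0 ≤ (b : D)) (hb1 : ‖(b : D)‖ ≤ 1) :
    τ.eval b ≤ dimFun τ b := by
  rw [DQT.eval_eq, DQT.dimFun_eq]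
  refine (τ.isLocalTrace.le_norm_mul_dim isPedLike_Ped b.2 hb).trans ?_
  calc _ ≤ ENNReal.ofReal 1 * dim τ.re b := by gcongr
    _ = _ := by simp

/-- Repeated application of `HasTAOZ.exists_step` to `e`, `(1 - p₀) e (1 - p₀)`, and so on. The elements
`b_n` are orthogonal because `p_n` is a unit for `b_n`. -/
theorem HasTAOZ.exists_exhaustion (h : HasTAOZ A) (hsimple : IsSimpleRing A) {e : Stab A}
    (heP : e ∈ Ped (Stab A)) (he : 0 ≤ e) {ε : ℝ} (hε : 0 < ε) :
    ∃ b : ℕ → Ped (Stab A),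
      (∀ n, (b n : Stab A) ∈ Her e ∧ 0 ≤ (b n : Stab A) ∧ ‖(b n : Stab A)‖ ≤ 1) ∧
      (∀ m n, m ≠ n → (b m : Stab A) * (b n : Stab A) = 0) ∧
      (∑' n, osc (b n : Stab A)) < ENNReal.ofReal ε ∧
      ∀ τ ∈ closure (QT A), dimFun τ e < (∑' n, τ.eval (b n)) + ENNReal.ofReal ε := by
  have hP := isPedLike_Ped (D := Stab A)
  obtain ⟨ε', hε', hsum⟩ := ENNReal.exists_pos_sum_of_countable
    (ENNReal.ofReal_pos.2 hε).ne' ℕ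
  -- the thresholds decay faster than the factors `1 / 8` that the compressions cost
  have hδ (n : ℕ) : (0 : ℝ) < 1 / 8 ^ n / (n + 1) := by positivity
  choose b p hb hpe hpsa hbp hτ using fun (x : {x : Stab A // 0 ≤ x}) (n : ℕ) =>
    h.exists_step x.2 (hδ n) (hε' n)
  let E : ℕ → {x : Stab A // 0 ≤ x} := fun n => Nat.rec ⟨e, he⟩
    (fun n x => ⟨compress (p x n) x, compress_nonneg (hpsa x n) x.2⟩) n
  have hE (n : ℕ) : (E (n + 1)).1 = compress (p (E n) n) (E n).1 := rfl
  have hHer {m n : ℕ} (hmn : m ≤ n) : Her (E n).1 ≤ Her (E m).1 := by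
    induction n, hmn using Nat.le_induction with
    | base => exact le_rfl
    | succ n hn ih =>
      refine le_trans (Her_mono ?_) ih
      rw [hE]; exact compress_mem_Her (hpe _ _)
  let B : ℕ → Ped (Stab A) := fun n => ⟨b (E n) n, (hb _ _).2.1⟩
  have hB0 (n : ℕ) : 0 ≤ (B n : Stab A) := (hb (E n) n).2.2.1
  have hBe (n : ℕ) : (B n : Stab A) ∈ Her e := hHer (Nat.zero_le n) (hb (E n) n).1
  have hlt {m n : ℕ} (hmn : m < n) : (B m : Stab A) * (B n : Stab A) = 0 := by
    refine mul_eq_zero_of_mem_Her (IsSelfAdjoint.of_nonneg (hB0 m))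
      (IsSelfAdjoint.of_nonneg (E (m + 1)).2) ?_ (hHer hmn (hb (E n) n).1)
    rw [hE]; exact mul_compress_eq_zero (hbp _ _) _
  have horth (m n : ℕ) (hmn : m ≠ n) : (B m : Stab A) * (B n : Stab A) = 0 := by
    rcases hmn.lt_or_gt with h | h
    · exact hlt h
    · exact mul_eq_zero_symm (IsSelfAdjoint.of_nonneg (hB0 n)) (IsSelfAdjoint.of_nonneg (hB0 m))
        (hlt h)
  have hB1 (n : ℕ) : ‖(B n : Stab A)‖ ≤ 1 := (hb (E n) n).2.2.2.1
  refine ⟨B, fun n => ⟨hBe n, hB0 n, hB1 n⟩, horth,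
    (ENNReal.tsum_le_tsum fun n => (hb (E n) n).2.2.2.2).trans_lt hsum, fun τ hτ' => ?_⟩
  have hchain (n : ℕ) : ∀ η : ℝ, 0 < η → ENNReal.ofReal (τ.re (cfcₙ (cutoff η) e)) ≤
      ENNReal.ofReal (τ.re (cfcₙ (cutoff (η / 8 ^ n)) (E n).1)) +
        ∑ i ∈ Finset.range n, (τ.eval (B i) + ε' i) := by
    intro η hη
    induction n with
    | zero => simp [E]
    | succ n ih =>
      refine ih.trans ?_
      have h1 := (hτ (E n) n τ hτ').2 (η / 8 ^ n) (by positivity)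
      rw [div_div, ← pow_succ, ← hE] at h1
      rw [Finset.sum_range_succ, DQT.eval_eq τ (B n), add_comm (∑ i ∈ _, _), ← add_assoc]
      exact add_le_add h1 le_rfl
  have hdim : dim τ.re e ≤ ∑' n, (τ.eval (B n) + ε' n) := by
    refine IsLocalTrace.dim_le fun η hη => ?_
    obtain ⟨n, hn⟩ := exists_nat_one_div_lt hη
    have h1 : 1 / 8 ^ n / ((n : ℝ) + 1) ≤ η / 8 ^ n := by
      rw [div_right_comm]; gcongr
    have h2 := (ENNReal.ofReal_le_ofReal (τ.isLocalTrace.cutoff_mono hP (hδ n) h1 (E n).1)).trans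
      (hτ (E n) n τ hτ').1
    refine ((hchain n η hη).trans (add_le_add h2 le_rfl)).trans ?_
    rw [show ENNReal.ofReal (τ.re (b (E n) n)) = τ.eval (B n) from (DQT.eval_eq τ (B n)).symm,
      add_comm, ← Finset.sum_range_succ (fun i => τ.eval (B i) + (ε' i : ℝ≥0∞))]
    exact ENNReal.sum_le_tsum _
  obtain ⟨C, hC, hCe⟩ := exists_dim_le_closure hsimple heP he
  have hfin : ∑' n, τ.eval (B n) ≠ ⊤ := by
    refine ne_top_of_le_ne_top hC (le_trans ?_ (hCe τ hτ'))
    refine le_trans (ENNReal.tsum_le_tsum fun n => ?_)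
      (τ.isLocalTrace.tsum_dim_le hP he hBe hB0 horth)
    rw [← DQT.dimFun_eq]
    exact τ.eval_le_dimFun (hB0 n) (hB1 n)
  rw [DQT.dimFun_eq]
  refine hdim.trans_lt ?_
  rw [ENNReal.tsum_add]
  exact ENNReal.add_lt_add_left hfin hsum

end Exhaustion

/-! ### An approximant of small oscillation -/

section Compression

variable {D : Type u} [NonUnitalCStarAlgebra D] [PartialOrder D] [StarOrderedRing D]

theorem smul_add_smul_sub_star_mul {κ : ℝ} (hκ : 0 < κ) (u v : D) :
    (1 + κ) • (star u * u) + (1 + κ⁻¹) • (star v * v) - star (u + v) * (u + v) =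
      star (√κ • u - (√κ)⁻¹ • v) * (√κ • u - (√κ)⁻¹ • v) := by
  have h0 : √κ ≠ 0 := (Real.sqrt_pos.2 hκ).ne'
  have h1 : √κ * √κ = κ := Real.mul_self_sqrt hκ.le
  have h2 : (√κ)⁻¹ * (√κ)⁻¹ = κ⁻¹ := by rw [← mul_inv, h1]
  have h3 : √κ * (√κ)⁻¹ = 1 := mul_inv_cancel₀ h0
  have h4 : (√κ)⁻¹ * √κ = 1 := inv_mul_cancel₀ h0
  have hm (r s : ℝ) (x y : D) : (r • x) * (s • y) = (r * s) • (x * y) := by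
    rw [smul_mul_assoc, mul_smul_comm, smul_smul]
  have hs (r : ℝ) (x : D) : star (r • x) = r • star x := by rw [star_smul, star_trivial]
  simp only [star_sub, star_add, hs, sub_mul, mul_sub, add_mul, mul_add, hm, h1, h2, h3, h4]
  module

theorem star_add_mul_add_le_smul {κ : ℝ} (hκ : 0 < κ) (u v : D) :
    star (u + v) * (u + v) ≤ (1 + κ) • (star u * u) + (1 + κ⁻¹) • (star v * v) := by
  rw [← sub_nonneg, smul_add_smul_sub_star_mul hκ]
  exact star_mul_self_nonneg _

theorem smul_le_star_add_mul_add {κ : ℝ} (hκ : 0 < κ) (u v : D) :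
    (1 - κ) • (star u * u) + (1 - κ⁻¹) • (star v * v) ≤ star (u + v) * (u + v) := by
  have h := star_add_mul_add_le_smul hκ u (-v)
  have e : star (u + v) * (u + v) - ((1 - κ) • (star u * u) + (1 - κ⁻¹) • (star v * v)) =
      (1 + κ) • (star u * u) + (1 + κ⁻¹) • (star (-v) * -v) - star (u + -v) * (u + -v) := by
    simp only [star_add, star_neg, add_mul, mul_add, neg_mul, mul_neg, neg_neg]
    module
  rw [← sub_nonneg, e, sub_nonneg]
  exact h

/-- The element `(1 - κ) p a p + κ ‖a‖ p`, which lies between `κ ‖a‖ p` and a multiple of `p`. -/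
def compression (κ : ℝ) (p a : D) : D := (1 - κ) • (p * a * p) + (κ * ‖a‖) • p

variable {κ : ℝ} {p a : D}

theorem mul_mul_self_nonneg (hp : 0 ≤ p) (ha : 0 ≤ a) : 0 ≤ p * a * p := by
  have := star_left_conjugate_nonneg ha p
  rwa [(IsSelfAdjoint.of_nonneg hp).star_eq] at this

theorem norm_mul_mul_self_le (hp1 : ‖p‖ ≤ 1) (a : D) : ‖p * a * p‖ ≤ ‖a‖ := by
  refine (norm_mul_le _ _).trans ?_
  have h := norm_mul_le p a
  have := norm_nonneg p; have := norm_nonneg a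
  nlinarith [norm_nonneg (p * a)]

/-- This lower bound makes the oscillation of the compression as small as that of `p`. -/
theorem smul_le_compression (hκ1 : κ ≤ 1) (hp : 0 ≤ p) (ha : 0 ≤ a) :
    (κ * ‖a‖) • p ≤ compression κ p a :=
  le_add_of_nonneg_left (smul_nonneg (by linarith) (mul_mul_self_nonneg hp ha))

theorem compression_nonneg (hκ : 0 ≤ κ) (hκ1 : κ ≤ 1) (hp : 0 ≤ p) (ha : 0 ≤ a) :
    0 ≤ compression κ p a :=
  (smul_nonneg (by positivity) hp).trans (smul_le_compression hκ1 hp ha)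

theorem real_smul_mem_Her {x b : D} (r : ℝ) (hx : x ∈ Her b) : r • x ∈ Her b :=
  SMulMemClass.smul_mem (r : ℂ) hx

theorem mul_mul_self_mem_Her (hp : 0 ≤ p) (ha : 0 ≤ a) : p * a * p ∈ Her p := by
  have h1 : p * a * p ≤ ‖a‖ • (p * p) := by
    have := CStarAlgebra.star_left_conjugate_le_norm_smul (a := p) (b := a)
      (IsSelfAdjoint.of_nonneg ha)
    rwa [(IsSelfAdjoint.of_nonneg hp).star_eq] at this
  exact (isHereditary_Her p).mem_of_le _ _ (mul_mul_self_nonneg hp ha) h1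
    (real_smul_mem_Her _ (mul_mem (mem_Her_self p) (mem_Her_self p)))

theorem compression_mem_Her (hp : 0 ≤ p) (ha : 0 ≤ a) : compression κ p a ∈ Her p :=
  add_mem (real_smul_mem_Her _ (mul_mul_self_mem_Her hp ha)) (real_smul_mem_Her _ (mem_Her_self p))

theorem norm_compression_le (hκ : 0 ≤ κ) (hκ1 : κ ≤ 1) (hp1 : ‖p‖ ≤ 1) (a : D) :
    ‖compression κ p a‖ ≤ ‖a‖ := by
  refine (norm_add_le _ _).trans ?_
  rw [norm_smul, norm_smul, Real.norm_of_nonneg (by linarith), Real.norm_of_nonneg (by positivity)]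
  have h1 := mul_le_mul_of_nonneg_left (norm_mul_mul_self_le hp1 a) (sub_nonneg.2 hκ1)
  have h2 := mul_le_mul_of_nonneg_left hp1 (mul_nonneg hκ (norm_nonneg a))
  linarith

theorem exists_add_star_mul_self (hp : IsSelfAdjoint p) (ha : 0 ≤ a) : ∃ u v : D,
    star (u + v) * (u + v) = a ∧ star u * u = p * a * p ∧ star v * v = compress p a := by
  have hr := sqrt_isSelfAdjoint a
  have hrr := CFC.sqrt_mul_sqrt_self a ha
  refine ⟨CFC.sqrt a * p, CFC.sqrt a - CFC.sqrt a * p, ?_, ?_, compress_eq_star_mul hp hr hrr⟩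
  · rw [add_sub_cancel, hr.star_eq, hrr]
  · rw [star_mul, hp.star_eq, hr.star_eq, mul_assoc, ← mul_assoc (CFC.sqrt a), hrr, ← mul_assoc]

/-- Together with `compression_sub_le`: up to an error of order `κ`, the difference of `a` and its
compression is dominated by a multiple of `(1 - p) a (1 - p)`. -/
theorem sub_compression_le (hκ : 0 < κ) (hp : 0 ≤ p) (ha : 0 ≤ a) :
    a - compression κ p a ≤ (1 + κ⁻¹) • compress p a + (2 * κ) • (p * a * p) := by
  obtain ⟨u, v, h, hu, hv⟩ := exists_add_star_mul_self (IsSelfAdjoint.of_nonneg hp) ha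
  have h1 := star_add_mul_add_le_smul hκ u v
  rw [h, hu, hv] at h1
  have h2 : 0 ≤ (κ * ‖a‖) • p := smul_nonneg (by positivity) hp
  calc a - compression κ p a
      ≤ (1 + κ) • (p * a * p) + (1 + κ⁻¹) • compress p a - (1 - κ) • (p * a * p) := by
        rw [compression]
        exact sub_le_sub h1 (le_add_of_nonneg_right h2)
    _ = _ := by module

theorem compression_sub_le (hκ : 0 < κ) (hp : 0 ≤ p) (ha : 0 ≤ a) :
    compression κ p a - a ≤ (1 + κ⁻¹) • compress p a + (κ * ‖a‖) • p := by
  obtain ⟨u, v, h, hu, hv⟩ := exists_add_star_mul_self (IsSelfAdjoint.of_nonneg hp) ha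
  have h1 := smul_le_star_add_mul_add hκ u v
  rw [h, hu, hv] at h1
  have h2 : 0 ≤ (2 : ℝ) • compress p a :=
    smul_nonneg (by norm_num) (compress_nonneg (IsSelfAdjoint.of_nonneg hp) ha)
  calc compression κ p a - a ≤ compression κ p a -
        ((1 - κ) • (p * a * p) + (1 - κ⁻¹) • compress p a) + (2 : ℝ) • compress p a :=
        (sub_le_sub_left h1 _).trans (le_add_of_nonneg_right h2)
    _ = _ := by rw [compression]; module

/-- `r (1 - P)² r` decreases when an orthogonal summand is added to `P`. -/
theorem star_mul_sub_le {r P q : D} (hr : IsSelfAdjoint r) (hP : IsSelfAdjoint P) (hq : 0 ≤ q)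
    (hq1 : ‖q‖ ≤ 1) (hPq : P * q = 0) :
    star (r - (P + q) * r) * (r - (P + q) * r) ≤ star (r - P * r) * (r - P * r) := by
  have hqsa := IsSelfAdjoint.of_nonneg hq
  have hqP := mul_eq_zero_symm hP hqsa hPq
  have h0 : 0 ≤ q + (q - q * q) := add_nonneg hq (sub_nonneg.2 (mul_self_le_self hq hq1))
  have h1 := star_left_conjugate_nonneg h0 r
  rw [hr.star_eq] at h1
  rw [← sub_nonneg]
  have e : star (r - P * r) * (r - P * r) - star (r - (P + q) * r) * (r - (P + q) * r) =
      r * (q + (q - q * q)) * r - r * (P * q) * r - r * (q * P) * r := by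
    simp only [star_sub, star_mul, star_add, hr.star_eq, hP.star_eq, hqsa.star_eq]
    noncomm_ring
  rw [e, hPq, hqP]
  simpa using h1

theorem cfcₙ_cutoff_smul {x : D} (hx : IsSelfAdjoint x) {k s : ℝ} (hk : 0 < k) :
    cfcₙ (cutoff (s * k)) (k • x) = cfcₙ (cutoff s) x := by
  have e : k • x = cfcₙ (fun y : ℝ => k * y) x := by rw [cfcₙ_const_mul .., cfcₙ_id' ℝ x]
  rw [e, ← cfcₙ_comp' (cutoff (s * k)) (fun y : ℝ => k * y) x]
  congr 1; ext y
  rw [cutoff, cutoff, show k * y - s * k = (y - s) * k by ring, mul_div_mul_right _ _ hk.ne']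

end Compression

/-! ### Estimates for orthogonal sums and for the `2`-norm -/

section Trace

variable {D : Type u} [NonUnitalCStarAlgebra D] [PartialOrder D] [StarOrderedRing D]
variable {P : NonUnitalStarSubalgebra ℂ D} {t : D → ℝ}

/-- The trace of `x²` is controlled by the cut-offs of `x` and `-x` at a threshold `σ`: on the spectrum,
`s² ≤ min(s², 4σ²) + L² (f_σ(s) + f_σ(-s))`. -/
theorem IsLocalTrace.mul_self_le (ht : IsLocalTrace P t) (hP : IsPedLike P) {a x : D}
    (haP : a ∈ P) (ha : 0 ≤ a) (hxP : x ∈ P) (hx : x ∈ Her a) (hsa : IsSelfAdjoint x)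
    {L C σ ρ : ℝ} (hσ : 0 < σ) (hL : ‖x‖ ≤ L) (hC : dim t a ≤ ENNReal.ofReal C) (hC0 : 0 ≤ C)
    (h1 : t (cfcₙ (cutoff σ) x) ≤ ρ) (h2 : t (cfcₙ (cutoff σ) (-x)) ≤ ρ) :
    t (x * x) ≤ 4 * σ ^ 2 * C + 2 * L ^ 2 * ρ := by
  obtain ⟨g, hg⟩ : ∃ g : ℝ → ℝ, g = fun s => min (s * s) (4 * σ ^ 2) := ⟨_, rfl⟩
  have hgc : Continuous g := by rw [hg]; fun_prop
  have hg0 : g 0 = 0 := by rw [hg]; simp; positivity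
  have hgs (s : ℝ) : 0 ≤ g s := by rw [hg]; exact le_min (mul_self_nonneg s) (by positivity)
  have hgnn : 0 ≤ cfcₙ g x := cfcₙ_nonneg fun s _ => hgs s
  have hgH : cfcₙ g x ∈ Her a := cfc_mem_Her hx g
  have hgP : cfcₙ g x ∈ P := hP.mem_of_mem_Her haP ha hgH hgnn
  have hgn : ‖cfcₙ g x‖ ≤ 4 * σ ^ 2 := norm_cfcₙ_le fun s _ => by
    rw [Real.norm_of_nonneg (hgs s), hg]; exact min_le_right _ _
  have hg1 : t (cfcₙ g x) ≤ 4 * σ ^ 2 * C := by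
    refine (ENNReal.ofReal_le_ofReal_iff (by positivity)).1 ?_
    rw [ENNReal.ofReal_mul (by positivity)]
    refine (ht.le_norm_mul_dim hP hgP hgnn).trans ?_
    gcongr
    exact (ht.dim_le_of_mem_Her hP ha hgnn hgH).trans hC
  have hneg : cfcₙ (cutoff σ) (-x) = cfcₙ (fun s => cutoff σ (-s)) x := by
    rw [← cfcₙ_comp_neg (cutoff σ) x]
  have hm1 := hP.cutoff_mem hσ x
  have hm2 := hP.cutoff_mem hσ (-x)
  rw [hneg] at h2 hm2
  have e : x * x = cfcₙ (fun s : ℝ => s * s) x := by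
    rw [cfcₙ_mul (fun s : ℝ => s) (fun s : ℝ => s) x, cfcₙ_id' ℝ x]
  have hxx : cfcₙ (fun s : ℝ => s * s) x ∈ P := e ▸ mul_mem hxP hxP
  obtain ⟨k, hk⟩ : ∃ k : ℝ → ℝ, k = fun s => cutoff σ s + cutoff σ (-s) := ⟨_, rfl⟩
  have hkc : Continuous k := by rw [hk]; fun_prop
  have hk0 : k 0 = 0 := by simp [hk]
  have hkP : cfcₙ k x ∈ P := by
    rw [hk, cfcₙ_add (cutoff σ) (fun s => cutoff σ (-s)) x]; exact add_mem hm1 hm2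
  have hkt : t (cfcₙ k x) ≤ 2 * ρ := by
    rw [hk, ht.cfc_add hm1 hm2 (by fun_prop) (by fun_prop) (by simp) (by simp)]; linarith
  have hlP : cfcₙ (fun s => L ^ 2 * k s) x ∈ P := by
    rw [cfcₙ_const_mul ..]; exact SMulMemClass.smul_mem ((L ^ 2 : ℝ) : ℂ) hkP
  have hsum : cfcₙ (fun s => g s + L ^ 2 * k s) x ∈ P := by
    rw [cfcₙ_add g (fun s => L ^ 2 * k s) x]; exact add_mem hgP hlP
  have hle : t (cfcₙ (fun s : ℝ => s * s) x) ≤ t (cfcₙ (fun s => g s + L ^ 2 * k s) x) := by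
    refine ht.cfc_mono hP hxx hsum (by fun_prop) (by fun_prop) (by simp) (by simp [hg0, hk0])
      fun s hs => ?_
    have hsL : |s| ≤ L := by
      have := norm_apply_le_norm_cfcₙ (fun s : ℝ => s) x hs
      rw [cfcₙ_id' ℝ x, Real.norm_eq_abs] at this
      exact this.trans hL
    have hkn : 0 ≤ k s := by rw [hk]; exact add_nonneg (CStarStab.cutoff_nonneg _ _) (CStarStab.cutoff_nonneg _ _)
    rcases le_total |s| (2 * σ) with h | h
    · have h3 : s * s ≤ 4 * σ ^ 2 := by
        rw [← abs_mul_abs_self]; nlinarith [abs_nonneg s]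
      have : g s = s * s := by rw [hg]; exact min_eq_left h3
      rw [this]
      have := mul_nonneg (sq_nonneg L) hkn
      linarith
    · have hk1 : 1 ≤ k s := by
        rw [hk]
        rcases le_abs.1 h with h | h
        · have := CStarStab.cutoff_nonneg σ (-s)
          simp only [cutoff_eq_one hσ h]; linarith
        · have := CStarStab.cutoff_nonneg σ s
          simp only [cutoff_eq_one hσ h]; linarith
      have h3 : s * s ≤ L ^ 2 := by
        rw [← abs_mul_abs_self]; nlinarith [abs_nonneg s]
      nlinarith [hgs s, sq_nonneg L]
  rw [e]
  refine hle.trans ?_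
  rw [ht.cfc_add hgP hlP hgc (by fun_prop) hg0 (by simp [hk0]),
    ht.cfc_const_mul _ hkP hkc hk0]
  nlinarith [sq_nonneg L]

theorem IsLocalTrace.sum_cutoff (ht : IsLocalTrace P t)
    (hP : IsPedLike P) {b : ℕ → D} (hb0 : ∀ n, 0 ≤ b n) (hb : ∀ m n, m ≠ n → b m * b n = 0)
    {σ : ℝ} (hσ : 0 < σ) (N : ℕ) : t (cfcₙ (cutoff σ) (∑ n ∈ Finset.range N, b n)) =
      ∑ n ∈ Finset.range N, t (cfcₙ (cutoff σ) (b n)) := by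
  induction N with
  | zero =>
    have := ht.smul 0 0 (zero_mem _) (.zero _)
    simp only [smul_zero, zero_mul] at this
    simp [this]
  | succ N ih =>
    rw [Finset.sum_range_succ, Finset.sum_range_succ, ← ih]
    refine ht.cutoff_add_of_mul_eq_zero hP (Finset.sum_nonneg fun n _ => hb0 n) (hb0 N) ?_ hσ
    rw [Finset.sum_mul]
    exact Finset.sum_eq_zero fun n hn => hb n N (Finset.mem_range.1 hn).ne

theorem norm_sum_le_one {b : ℕ → D} (hb0 : ∀ n, 0 ≤ b n) (hb1 : ∀ n, ‖b n‖ ≤ 1)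
    (hb : ∀ m n, m ≠ n → b m * b n = 0) (N : ℕ) : ‖∑ n ∈ Finset.range N, b n‖ ≤ 1 := by
  obtain ⟨S, hS⟩ : ∃ S, S = ∑ n ∈ Finset.range N, b n := ⟨_, rfl⟩
  have hS0 : 0 ≤ S := hS ▸ Finset.sum_nonneg fun n _ => hb0 n
  -- `S² = ∑ b_n² ≤ ∑ b_n = S`
  have h : S * S ≤ S := by
    have : S * S = ∑ n ∈ Finset.range N, b n * b n := by
      rw [hS, Finset.sum_mul_sum]
      refine Finset.sum_congr rfl fun n hn => ?_
      exact Finset.sum_eq_single n (fun m _ hm => hb n m hm.symm) fun h => absurd hn h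
    rw [this, hS]
    exact Finset.sum_le_sum fun n _ => mul_self_le_self (hb0 n) (hb1 n)
  have h2 : ‖S * S‖ ≤ ‖S‖ := CStarAlgebra.norm_le_norm_of_nonneg_of_le
    ((IsSelfAdjoint.of_nonneg hS0).mul_self_nonneg) h
  rw [(IsSelfAdjoint.of_nonneg hS0).norm_mul_self] at h2
  rw [← hS]
  nlinarith [norm_nonneg S]

/-- A version of Dini's theorem. The order `R (n + 1) ≤ R n` gives the monotonicity of `τ(f_ν(R n))`
only up to a change of the cut-off, which costs the factor `4`. -/
theorem exists_cutoff_lt_of_isCompact {T : Set (DQT D)} (hT : IsCompact T) {R : ℕ → D}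
    (hR0 : ∀ n, 0 ≤ R n) (hR : Antitone R) {C : ℝ≥0∞}
    (h : ∀ τ ∈ T, ∃ n, dim τ.re (R n) < C) {ν : ℝ} (hν : 0 < ν) :
    ∃ n, ∀ τ ∈ T, ENNReal.ofReal (τ.re (cfcₙ (cutoff ν) (R n))) < C := by
  have hP := isPedLike_Ped (D := D)
  have hν4 : 0 < ν / 4 := by positivity
  obtain ⟨F, hF⟩ := hT.elim_finite_subcover
    (fun n : ℕ => {τ : DQT D | ENNReal.ofReal (τ.re (cfcₙ (cutoff (ν / 4)) (R n))) < C})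
    (fun n => isOpen_lt (ENNReal.continuous_ofReal.comp
      (DQT.continuous_re (hP.cutoff_mem hν4 (R n)))) continuous_const)
    (fun τ hτ => by
      obtain ⟨n, hn⟩ := h τ hτ
      exact Set.mem_iUnion.2 ⟨n, (τ.isLocalTrace.cutoff_le_dim hP hν4 (R n)).trans_lt hn⟩)
  refine ⟨F.sup id, fun τ hτ => ?_⟩
  obtain ⟨n, hn, hn'⟩ := Set.mem_iUnion₂.1 (hF hτ)
  refine lt_of_le_of_lt (ENNReal.ofReal_le_ofReal ?_) hn'
  have hle : R (F.sup id) ≤ R n + 0 := by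
    rw [add_zero]; exact hR (Finset.le_sup (f := id) hn)
  have := τ.isLocalTrace.cutoff_le_of_le_add hP (ε := ν / 2) (η := ν)
    (IsSelfAdjoint.of_nonneg (hR0 _)) (hR0 n) (.zero _) hle (by positivity)
    (by rw [norm_zero]; linarith)
  rwa [div_div, show (2 : ℝ) * 2 = 4 by norm_num] at this

end Trace

/-! ### Oscillation zero from an exhaustion -/

section Converse

theorem mul_eq_zero_of_mem_Her_of_mem_Her {D : Type u} [NonUnitalCStarAlgebra D] [PartialOrder D]
    [StarOrderedRing D] {a b x y : D} (ha : IsSelfAdjoint a) (hb : IsSelfAdjoint b)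
    (hab : a * b = 0) (hx : x ∈ Her a) (hy : y ∈ Her b) (hysa : IsSelfAdjoint y)
    (hxsa : IsSelfAdjoint x) : x * y = 0 :=
  mul_eq_zero_symm hysa hxsa (mul_eq_zero_of_mem_Her hysa ha
    (mul_eq_zero_symm ha hysa (mul_eq_zero_of_mem_Her ha hb hab hy)) hx)

variable {A : Type u} [NonUnitalCStarAlgebra A] [PartialOrder A] [StarOrderedRing A]

theorem twoNorm_le_of_forall {x : Stab A} (hxP : x ∈ Ped (Stab A)) (hx : IsSelfAdjoint x) {δ : ℝ}
    (hδ : 0 ≤ δ) (h : ∀ τ ∈ closure (QT A), τ.re (x * x) ≤ δ ^ 2) :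
    twoNorm x ≤ ENNReal.ofReal δ := by
  refine iSup₂_le fun τ hτ => iSup_le fun ε => ?_
  have hε : (0 : ℝ) < ε := ε.2
  have hP := isPedLike_Ped (D := Stab A)
  have h0 : 0 ≤ x * x := hx.mul_self_nonneg
  have hxxP := mul_mem hxP hxP
  have hxsa := IsSelfAdjoint.of_nonneg h0
  rw [DQT.eval_eq, hx.star_eq]
  have h1 : τ.re (cfcₙ (fun s : ℝ => max (s - ε) 0) (x * x)) ≤ δ ^ 2 := by
    refine le_trans ?_ (h τ hτ)
    have hid : cfcₙ (fun s : ℝ => s) (x * x) ∈ Ped (Stab A) := by rwa [cfcₙ_id' ℝ (x * x)]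
    have h2 := τ.isLocalTrace.cfc_mono hP (f := fun s : ℝ => max (s - ε) 0) (g := fun s => s)
      (cfc_mem_Ped hε (fun s hs => max_eq_right (by linarith)) (x * x)) hid (by fun_prop)
      (by fun_prop) (max_eq_right (by linarith)) rfl fun s hs =>
        max_le (by linarith) (quasispectrum_nonneg_of_nonneg (x * x) h0 s hs)
    rwa [cfcₙ_id' ℝ (x * x)] at h2
  calc _ ≤ ENNReal.ofReal (δ ^ 2) ^ (1 / 2 : ℝ) :=
        ENNReal.rpow_le_rpow (ENNReal.ofReal_le_ofReal h1) (by norm_num)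
    _ = ENNReal.ofReal δ := by
      rw [ENNReal.ofReal_rpow_of_nonneg (by positivity) (by norm_num), ← Real.sqrt_eq_rpow,
        Real.sqrt_sq hδ]

/-- Local units `p n` and spectral cut-offs `q n` of a sequence of orthogonal elements of `Her(a)`
of small oscillation that exhausts the dimension of `a`. -/
theorem exists_orthogonal_cutoffs {a : Stab A} {b : ℕ → Stab A} (hba : ∀ n, b n ∈ Her a)
    (hb0 : ∀ n, 0 ≤ b n) (hb : ∀ m n, m ≠ n → b m * b n = 0) {ε : ℝ≥0∞}
    (hosc : ∑' n, osc (b n) < ε)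
    (hdim : ∀ τ ∈ closure (QT A), dimFun τ a < (∑' n, dimFun τ (b n)) + ε) :
    ∃ (p q : ℕ → Stab A) (ω : ℕ → ℝ≥0∞),
      (∀ n, p n ∈ Her a ∧ 0 ≤ p n ∧ ‖p n‖ ≤ 1) ∧
      (∀ n, q n ∈ Her a ∧ q n ∈ Ped (Stab A) ∧ 0 ≤ q n ∧ ‖q n‖ ≤ 1 ∧ p n * q n = q n) ∧
      (∀ m n, m ≠ n → p m * p n = 0) ∧ (∀ m n, m ≠ n → p m * q n = 0) ∧
      (∀ m n, m ≠ n → q m * q n = 0) ∧ ∑' n, ω n ≤ ε ∧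
      (∀ τ ∈ closure (QT A), ∀ n, dim τ.re (p n) ≤ ENNReal.ofReal (τ.re (q n)) + ω n ∧
        τ.re (q n) ≤ τ.re (cfcₙ (cutoff (1 / 2)) (p n))) ∧
      ∀ τ ∈ closure (QT A), dim τ.re a < ∑' n, ENNReal.ofReal (τ.re (q n)) + 2 * ε := by
  have hP := isPedLike_Ped (D := Stab A)
  obtain ⟨ω', hω', hsum⟩ := ENNReal.exists_pos_sum_of_countable (tsub_pos_of_lt hosc).ne' ℕ
  have hfin (n : ℕ) : osc (b n) ≠ ⊤ :=
    ne_top_of_le_ne_top (hosc.trans_le le_top).ne (ENNReal.le_tsum n)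
  choose m hm using fun n => exists_dim_le_of_osc_lt (c := b n) (ε := osc (b n) + ω' n)
    (ENNReal.lt_add_right (hfin n) (by exact_mod_cast (hω' n).ne'))
  obtain ⟨s, hs⟩ : ∃ s : ℕ → ℝ, ∀ n, 0 < s n ∧ 2 * s n = 1 / (m n + 1) :=
    ⟨fun n => 1 / (m n + 1) / 2, fun n => ⟨by positivity, by ring⟩⟩
  have hbsa (n : ℕ) := IsSelfAdjoint.of_nonneg (hb0 n)
  have hpb (n : ℕ) : cfcₙ (cutoff (s n)) (b n) ∈ Her (b n) := cfc_mem_Her (mem_Her_self _) _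
  have hqb (n : ℕ) : cfcₙ (cutoff (2 * s n)) (b n) ∈ Her (b n) := cfc_mem_Her (mem_Her_self _) _
  have hp0 (n : ℕ) : 0 ≤ cfcₙ (cutoff (s n)) (b n) := cfcₙ_nonneg fun x _ => cutoff_nonneg _ x
  have hq0 (n : ℕ) : 0 ≤ cfcₙ (cutoff (2 * s n)) (b n) := cfcₙ_nonneg fun x _ => cutoff_nonneg _ x
  have horth {m n : ℕ} (hmn : m ≠ n) {x y : Stab A} (hx : x ∈ Her (b m)) (hy : y ∈ Her (b n))
      (hx0 : 0 ≤ x) (hy0 : 0 ≤ y) : x * y = 0 :=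
    mul_eq_zero_of_mem_Her_of_mem_Her (hbsa m) (hbsa n) (hb m n hmn) hx hy
      (IsSelfAdjoint.of_nonneg hy0) (IsSelfAdjoint.of_nonneg hx0)
  have hω : ∑' n, (osc (b n) + (ω' n : ℝ≥0∞)) ≤ ε := by
    rw [ENNReal.tsum_add]
    exact (add_le_add le_rfl hsum.le).trans (add_tsub_cancel_of_le hosc.le).le
  have hdb (τ) (hτ : τ ∈ closure (QT A)) (n : ℕ) : dim τ.re (b n) ≤
      ENNReal.ofReal (τ.re (cfcₙ (cutoff (2 * s n)) (b n))) + (osc (b n) + ω' n) := by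
    rw [(hs n).2]; exact hm n τ hτ
  refine ⟨fun n => cfcₙ (cutoff (s n)) (b n), fun n => cfcₙ (cutoff (2 * s n)) (b n),
    fun n => osc (b n) + ω' n, fun n => ⟨Her_mono (hba n) (hpb n), hp0 n, norm_cutoff_le _ _⟩,
    fun n => ⟨Her_mono (hba n) (hqb n), hP.cutoff_mem (mul_pos two_pos (hs n).1) _, hq0 n,
      norm_cutoff_le _ _, ?_⟩,
    fun m n hmn => horth hmn (hpb m) (hpb n) (hp0 m) (hp0 n),
    fun m n hmn => horth hmn (hpb m) (hqb n) (hp0 m) (hq0 n),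
    fun m n hmn => horth hmn (hqb m) (hqb n) (hq0 m) (hq0 n), hω,
    fun τ hτ n => ⟨?_, τ.isLocalTrace.cutoff_two_mul_le hP (hbsa n) (hs n).1⟩, fun τ hτ => ?_⟩
  · have := mul_cfc_eq_self (mul_pos two_pos (hs n).1) (continuous_cutoff (2 * s n))
      (fun t ht => cutoff_eq_zero (mul_pos two_pos (hs n).1) ht) (b n)
    rwa [mul_div_cancel_left₀ _ (two_ne_zero)] at this
  · exact (τ.isLocalTrace.dim_le_of_mem_Her hP (hb0 n) (hp0 n) (hpb n)).trans (hdb τ hτ n)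
  · have h1 := hdim τ hτ
    simp only [DQT.dimFun_eq] at h1
    refine h1.trans_le ?_
    rw [two_mul, ← add_assoc]
    refine add_le_add ((ENNReal.tsum_le_tsum fun n => hdb τ hτ n).trans ?_) le_rfl
    rw [ENNReal.tsum_add]
    exact add_le_add le_rfl hω

/-- What is left of `a` after cutting down by `1 - P_N` has small dimension, pointwise on the set
of quasitraces. -/
theorem exists_dim_compress_lt {D : Type u} [NonUnitalCStarAlgebra D] [PartialOrder D]
    [StarOrderedRing D] {P : NonUnitalStarSubalgebra ℂ D} {t : D → ℝ} (ht : IsLocalTrace P t)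
    (hP : IsPedLike P) {a : D} (ha : 0 ≤ a) {p q : ℕ → D} (hp : ∀ n, p n ∈ Her a)
    (hp0 : ∀ n, 0 ≤ p n) (hq : ∀ n, q n ∈ Her a ∧ q n ∈ P ∧ 0 ≤ q n ∧ ‖q n‖ ≤ 1 ∧ p n * q n = q n)
    (hpq : ∀ m n, m ≠ n → p m * q n = 0) (hqq : ∀ m n, m ≠ n → q m * q n = 0) {ε : ℝ≥0∞}
    (h : dim t a < ∑' n, ENNReal.ofReal (t (q n)) + ε) :
    ∃ N, dim t (compress (∑ n ∈ Finset.range N, p n) a) < ε := by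
  have hmain (N : ℕ) : dim t (compress (∑ n ∈ Finset.range N, p n) a) +
      ∑ n ∈ Finset.range N, ENNReal.ofReal (t (q n)) ≤ dim t a := by
    obtain ⟨p', hp'⟩ : ∃ p', p' = ∑ n ∈ Finset.range N, p n := ⟨_, rfl⟩
    obtain ⟨q', hq'⟩ : ∃ q', q' = ∑ n ∈ Finset.range N, q n := ⟨_, rfl⟩
    have hp'0 : 0 ≤ p' := hp' ▸ Finset.sum_nonneg fun n _ => hp0 n
    have hq'0 : 0 ≤ q' := hq' ▸ Finset.sum_nonneg fun n _ => (hq n).2.2.1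
    have hpq' : p' * q' = q' := by
      rw [hp', hq', Finset.sum_mul_sum, Finset.sum_comm]
      refine Finset.sum_congr rfl fun n hn => ?_
      rw [Finset.sum_eq_single n (fun m _ hm => hpq m n hm) fun h => absurd hn h]
      exact (hq n).2.2.2.2
    have hqp' : q' * p' = q' := by
      have := congrArg star hpq'
      rwa [star_mul, (IsSelfAdjoint.of_nonneg hp'0).star_eq,
        (IsSelfAdjoint.of_nonneg hq'0).star_eq] at this
    have hcn := compress_nonneg (IsSelfAdjoint.of_nonneg hp'0) ha
    have h1 : ∑ n ∈ Finset.range N, ENNReal.ofReal (t (q n)) ≤ dim t q' := by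
      rw [hq', ht.dim_sum hP (fun n => (hq n).2.2.1) hqq]
      refine Finset.sum_le_sum fun n _ => ?_
      refine (ht.le_norm_mul_dim hP (hq n).2.1 (hq n).2.2.1).trans ?_
      calc _ ≤ ENNReal.ofReal 1 * dim t (q n) := by gcongr; exact (hq n).2.2.2.1
        _ = _ := by simp
    rw [← hp']
    refine (add_le_add le_rfl h1).trans (ht.dim_add_dim_le hP ha hcn hq'0
      (mul_eq_zero_symm (IsSelfAdjoint.of_nonneg hq'0) (IsSelfAdjoint.of_nonneg hcn)
        (mul_compress_eq_zero hqp' a)) (compress_mem_Her ?_) ?_)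
    · exact hp' ▸ sum_mem fun n _ => hp n
    · exact hq' ▸ sum_mem fun n _ => (hq n).1
  rw [ENNReal.tsum_eq_iSup_nat, ENNReal.iSup_add] at h
  obtain ⟨N, hN⟩ := lt_iSup_iff.1 h
  refine ⟨N, ?_⟩
  have hfin' : ∑ n ∈ Finset.range N, ENNReal.ofReal (t (q n)) ≠ ⊤ := by simp
  have := (hmain N).trans_lt hN
  rw [add_comm] at this
  exact (ENNReal.add_lt_add_iff_left hfin').1 this

/-- The compression lies between multiples of `P = p₀ + ⋯ + p_{N-1}`, and the cut-off of `P` dominates the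
cut-offs `q n`, which nearly exhaust the dimension of `P`. -/
theorem osc_compression_le {κ : ℝ} {a : Stab A} (ha : 0 ≤ a) (hκ : 0 < κ)
    (hκ1 : κ ≤ 1) (ha' : 0 < ‖a‖) {p q : ℕ → Stab A} {ω : ℕ → ℝ≥0∞} (hp0 : ∀ n, 0 ≤ p n)
    (hpp : ∀ m n, m ≠ n → p m * p n = 0) {ε : ℝ≥0∞} (hω : ∑' n, ω n ≤ ε)
    (h : ∀ τ ∈ closure (QT A), ∀ n, dim τ.re (p n) ≤ ENNReal.ofReal (τ.re (q n)) + ω n ∧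
        τ.re (q n) ≤ τ.re (cfcₙ (cutoff (1 / 2)) (p n))) (N : ℕ) :
    osc (compression κ (∑ n ∈ Finset.range N, p n) a) ≤ ε := by
  have hP := isPedLike_Ped (D := Stab A)
  have hκa : 0 < κ * ‖a‖ := by positivity
  obtain ⟨p', hp'⟩ : ∃ p', p' = ∑ n ∈ Finset.range N, p n := ⟨_, rfl⟩
  have hp'0 : 0 ≤ p' := hp' ▸ Finset.sum_nonneg fun n _ => hp0 n
  have hp'sa := IsSelfAdjoint.of_nonneg hp'0
  rw [← hp']
  have hc0 := compression_nonneg hκ.le hκ1 hp'0 ha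
  refine osc_le_of_forall (σ := κ * ‖a‖ / 4 / 2) (by positivity) fun τ hτ => ?_
  have ht := τ.isLocalTrace
  have h1 : ∑ n ∈ Finset.range N, ENNReal.ofReal (τ.re (q n)) ≤
      ENNReal.ofReal (τ.re (cfcₙ (cutoff (1 / 2)) p')) := by
    rw [hp', ht.sum_cutoff hP hp0 hpp (by norm_num), ENNReal.ofReal_sum_of_nonneg fun n _ =>
      ht.cutoff_nonneg hP (by norm_num) (p n)]
    exact Finset.sum_le_sum fun n _ => ENNReal.ofReal_le_ofReal (h τ hτ n).2
  have h2 : τ.re (cfcₙ (cutoff (1 / 2)) p') ≤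
      τ.re (cfcₙ (cutoff (κ * ‖a‖ / 4 / 2)) (compression κ p' a)) := by
    rw [← cfcₙ_cutoff_smul hp'sa hκa]
    refine ht.cutoff_le_of_le_add hP (r := 0) ((IsSelfAdjoint.all (κ * ‖a‖)).smul hp'sa) hc0
      (.zero _) ?_ (by positivity) (by rw [norm_zero]; linarith)
    rw [add_zero]; exact smul_le_compression hκ1 hp'0 ha
  calc dim τ.re (compression κ p' a) ≤ dim τ.re p' :=
        ht.dim_le_of_mem_Her hP hp'0 hc0 (compression_mem_Her hp'0 ha)
    _ = ∑ n ∈ Finset.range N, dim τ.re (p n) := by rw [hp', ht.dim_sum hP hp0 hpp]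
    _ ≤ ∑ n ∈ Finset.range N, (ENNReal.ofReal (τ.re (q n)) + ω n) :=
        Finset.sum_le_sum fun n _ => (h τ hτ n).1
    _ ≤ ENNReal.ofReal (τ.re (cfcₙ (cutoff (1 / 2)) p')) + ε := by
        rw [Finset.sum_add_distrib]
        exact add_le_add h1 ((ENNReal.sum_le_tsum _).trans hω)
    _ ≤ _ := add_le_add (ENNReal.ofReal_le_ofReal h2) le_rfl

/-- The approximant is the compression of `a` by a partial sum `P_N` of the local units: its oscillation
is small for all `N`, and `a - c` is dominated by `(1 - P_N) a (1 - P_N)`, whose dimension is small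
uniformly on the closure of `QT(A)` for large `N`, by compactness. -/
theorem elementTAOZ_of_exhaustion (hsimple : IsSimpleRing A) {a : Stab A} (haP : a ∈ Ped (Stab A))
    (ha : 0 ≤ a)
    (h : ∀ ε : ℝ, 0 < ε → ∃ b : ℕ → Stab A, (∀ n, b n ∈ Her a ∧ 0 ≤ b n ∧ ‖b n‖ ≤ 1) ∧
      (∀ m n, m ≠ n → b m * b n = 0) ∧ (∑' n, osc (b n)) < ENNReal.ofReal ε ∧
      ∀ τ ∈ closure (QT A), dimFun τ a < (∑' n, dimFun τ (b n)) + ENNReal.ofReal ε) :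
    ElementTAOZ a := by
  intro ε hε
  have hP := isPedLike_Ped (D := Stab A)
  have hasa := IsSelfAdjoint.of_nonneg ha
  obtain ⟨C', hC', hdim⟩ := exists_dim_le_closure hsimple haP ha
  obtain ⟨C, hC0, rfl⟩ : ∃ C : ℝ, 0 ≤ C ∧ C' = ENNReal.ofReal C :=
    ⟨C'.toReal, ENNReal.toReal_nonneg, (ENNReal.ofReal_toReal hC').symm⟩
  -- for `a = 0` the lower bound `κ ‖a‖ P` of the compression is void, and `c = 0` will do
  rcases (norm_nonneg a).eq_or_lt with hM | hM
  · have ha0 : a = 0 := norm_eq_zero.1 hM.symm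
    have hz (τ : DQT (Stab A)) : τ.re 0 = 0 := by
      have := τ.isLocalTrace.smul 0 0 (zero_mem _) (.zero _)
      simpa using this
    refine ⟨0, zero_mem _, le_rfl, ?_, by simp, ?_⟩
    · refine (twoNorm_le_of_forall (x := a - 0) (by simpa using haP) (by simpa using hasa) le_rfl
        fun τ _ => ?_).trans_lt (by simpa using hε)
      simp [ha0, hz]
    · refine (osc_le_of_forall (ε := 0) one_pos fun τ _ => ?_).trans_lt (by simpa using hε)
      exact IsLocalTrace.dim_le fun δ _ => by simp [hz]
  have hM2 : 0 < ‖a‖ ^ 2 := by positivity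
  -- `σ` is the threshold below which the elements do not matter for the `2`-norm
  obtain ⟨σ, hσ, hσ1, hσC⟩ : ∃ σ : ℝ, 0 < σ ∧ σ ≤ 1 ∧ σ * (C + 1) ≤ ε ^ 2 / 32 :=
    ⟨min 1 (ε ^ 2 / 32 / (C + 1)), by positivity, min_le_left _ _, by
      rw [← le_div_iff₀ (by positivity)]; exact min_le_right _ _⟩
  obtain ⟨ε₀, hε₀, hε₀ε, hε₀M⟩ : ∃ ε₀ : ℝ, 0 < ε₀ ∧ ε₀ < ε ∧ ε₀ * ‖a‖ ^ 2 ≤ ε ^ 2 / 128 :=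
    ⟨min (ε / 2) (ε ^ 2 / 128 / ‖a‖ ^ 2), by positivity,
      (min_le_left _ _).trans_lt (half_lt_self hε), by
      rw [← le_div_iff₀ hM2]; exact min_le_right _ _⟩
  -- errors of order `κ ‖a‖` stay below the threshold `σ`
  obtain ⟨κ, hκ, hκ1, hκσ⟩ : ∃ κ : ℝ, 0 < κ ∧ κ ≤ 1 ∧ κ * ‖a‖ ≤ σ / 8 :=
    ⟨min 1 (σ / 8 / ‖a‖), by positivity, min_le_left _ _, by
      rw [← le_div_iff₀ hM]; exact min_le_right _ _⟩
  obtain ⟨b, hb, hbb, hosc, hbd⟩ := h ε₀ hε₀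
  obtain ⟨p, q, ω, hp, hq, hpp, hpq, hqq, hω, hpd, hqd⟩ := exists_orthogonal_cutoffs
    (fun n => (hb n).1) (fun n => (hb n).2.1) hbb hosc hbd
  have hp0 (n : ℕ) : 0 ≤ p n := (hp n).2.1
  let S : ℕ → Stab A := fun N => ∑ n ∈ Finset.range N, p n
  have hS0 (N : ℕ) : 0 ≤ S N := Finset.sum_nonneg fun n _ => hp0 n
  have hSsa (N : ℕ) := IsSelfAdjoint.of_nonneg (hS0 N)
  have hS1 (N : ℕ) : ‖S N‖ ≤ 1 := norm_sum_le_one hp0 (fun n => (hp n).2.2) hpp N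
  have hSa (N : ℕ) : S N ∈ Her a := sum_mem fun n _ => (hp n).1
  have hK : 0 < 1 + κ⁻¹ := by positivity
  have hKa : 0 ≤ (1 + κ⁻¹) • a := smul_nonneg hK.le ha
  obtain ⟨r, hr, hrr⟩ : ∃ r : Stab A, IsSelfAdjoint r ∧ r * r = (1 + κ⁻¹) • a :=
    ⟨_, sqrt_isSelfAdjoint _, CFC.sqrt_mul_sqrt_self _ hKa⟩
  have hcomp (N : ℕ) : (r - S N * r) * star (r - S N * r) = (1 + κ⁻¹) • compress (S N) a := by
    rw [compress_eq_mul_star (hSsa N) hr hrr]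
    simp only [compress, smul_mul_assoc, mul_smul_comm, smul_sub, smul_add]
  -- `r (1 - P_N)² r` decreases with `N`, and it has the same dimension as `(1 - P_N) r² (1 - P_N)`
  have hanti : Antitone fun N => star (r - S N * r) * (r - S N * r) :=
    antitone_nat_of_succ_le fun N => by
      have hSN : S (N + 1) = S N + p N := Finset.sum_range_succ _ _
      rw [hSN]
      refine star_mul_sub_le hr (hSsa N) (hp0 N) (hp N).2.2 ?_
      show (∑ n ∈ Finset.range N, p n) * p N = 0
      rw [Finset.sum_mul]
      exact Finset.sum_eq_zero fun n hn => hpp n N (Finset.mem_range.1 hn).ne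
  obtain ⟨N, hN⟩ := exists_cutoff_lt_of_isCompact (isCompact_closure_QT hsimple)
    (fun N => star_mul_self_nonneg (r - S N * r)) hanti (C := 2 * ENNReal.ofReal ε₀)
    (fun τ hτ => by
      obtain ⟨N, hN⟩ := exists_dim_compress_lt τ.isLocalTrace hP ha (fun n => (hp n).1) hp0 hq hpq hqq (hqd τ hτ)
      refine ⟨N, lt_of_le_of_lt ?_ hN⟩
      rw [τ.isLocalTrace.dim_star_mul hP, hcomp]
      exact τ.isLocalTrace.dim_le_of_le_smul hP _
        (smul_nonneg hK.le (compress_nonneg (hSsa N) ha)) (compress_nonneg (hSsa N) ha) le_rfl)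
    (ν := σ / 2 / 2) (by positivity)
  have hc0 := compression_nonneg hκ.le hκ1 (hS0 N) ha
  have hcH : compression κ (S N) a ∈ Her a := Her_mono (hSa N) (compression_mem_Her (hS0 N) ha)
  have hcn := norm_compression_le hκ.le hκ1 (hS1 N) a
  have hcP := hP.mem_of_mem_Her haP ha hcH hc0
  have hxsa : IsSelfAdjoint (a - compression κ (S N) a) := hasa.sub (IsSelfAdjoint.of_nonneg hc0)
  refine ⟨compression κ (S N) a, hcH, hc0, ?_, hcn, ?_⟩
  · refine (twoNorm_le_of_forall (sub_mem haP hcP) hxsa (half_pos hε).le fun τ hτ => ?_).trans_lt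
      ((ENNReal.ofReal_lt_ofReal_iff hε).2 (half_lt_self hε))
    have ht := τ.isLocalTrace
    have h1 : τ.re (cfcₙ (cutoff (σ / 2 / 2)) ((1 + κ⁻¹) • compress (S N) a)) ≤ 2 * ε₀ := by
      have := (hN τ hτ).le
      rw [ht.cutoff_star_mul hP (by positivity), hcomp,
        show (2 : ℝ≥0∞) = ENNReal.ofReal 2 by simp, ← ENNReal.ofReal_mul (by norm_num)] at this
      exact (ENNReal.ofReal_le_ofReal_iff (by positivity)).1 this
    have hX : 0 ≤ (1 + κ⁻¹) • compress (S N) a := smul_nonneg hK.le (compress_nonneg (hSsa N) ha)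
    have hpap := mul_mul_self_nonneg (hS0 N) ha
    refine (ht.mul_self_le hP haP ha (sub_mem haP hcP) (sub_mem (mem_Her_self a) hcH) hxsa
      (L := 2 * ‖a‖) (ρ := 2 * ε₀) hσ ?_ (hdim τ hτ) hC0 ?_ ?_).trans ?_
    · refine (norm_sub_le _ _).trans ?_; linarith
    · refine (ht.cutoff_le_of_le_add hP hxsa hX
        ((IsSelfAdjoint.all (2 * κ)).smul (IsSelfAdjoint.of_nonneg hpap))
        (sub_compression_le hκ (hS0 N) ha) (half_pos hσ) ?_).trans h1
      rw [norm_smul, Real.norm_of_nonneg (by positivity)]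
      have := mul_le_mul_of_nonneg_left (norm_mul_mul_self_le (hS1 N) a) hκ.le
      linarith
    · rw [neg_sub]
      refine (ht.cutoff_le_of_le_add hP ((IsSelfAdjoint.of_nonneg hc0).sub hasa) hX
        ((IsSelfAdjoint.all (κ * ‖a‖)).smul (hSsa N))
        (compression_sub_le hκ (hS0 N) ha) (half_pos hσ) ?_).trans h1
      rw [norm_smul, Real.norm_of_nonneg (by positivity)]
      have := mul_le_mul_of_nonneg_left (hS1 N) (mul_nonneg hκ.le hM.le)
      linarith
    · have h3 : σ ^ 2 * C ≤ σ * (C + 1) := by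
        nlinarith [mul_nonneg (mul_nonneg hσ.le hC0) (sub_nonneg.2 hσ1)]
      nlinarith
  · exact (osc_compression_le ha hκ hκ1 hM hp0 hpp hω hpd N).trans_lt
      ((ENNReal.ofReal_lt_ofReal_iff hε).2 hε₀ε)

end Converse

end CStarStab

open CStarStab
theorem mainTheorem5 (A : Type*) [NonUnitalCStarAlgebra A] [PartialOrder A] [StarOrderedRing A]
    (hσ : IsSigmaUnital A) (hsimple : IsSimpleRing A) (hQT : (QT A).Nonempty) :
    List.TFAE [
      HasTAOZ A,
      ∀ e ∈ Ped (Stab A), 0 ≤ e → ∀ ε : ℝ, 0 < ε →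
        ∃ b : ℕ → Ped (Stab A),
          (∀ n, (b n : Stab A) ∈ Her e ∧ 0 ≤ (b n : Stab A) ∧ ‖(b n : Stab A)‖ ≤ 1) ∧
          (∀ m n, m ≠ n → (b m : Stab A) * (b n : Stab A) = 0) ∧
          (∑' n, osc (b n : Stab A)) < ENNReal.ofReal ε ∧
          ∀ τ ∈ closure (QT A), dimFun τ e < (∑' n, τ.eval (b n)) + ENNReal.ofReal ε,
      ∀ e ∈ Ped (Stab A), 0 ≤ e → ∀ ε : ℝ, 0 < ε →
        ∃ b : ℕ → Stab A,
          (∀ n, b n ∈ Her e ∧ 0 ≤ b n ∧ ‖b n‖ ≤ 1) ∧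
          (∀ m n, m ≠ n → b m * b n = 0) ∧
          (∑' n, osc (b n)) < ENNReal.ofReal ε ∧
          ∀ τ ∈ closure (QT A), dimFun τ e < (∑' n, dimFun τ (b n)) + ENNReal.ofReal ε] := by
  tfae_have 1 → 2 := fun h e heP he ε hε => h.exists_exhaustion hsimple heP he hε
  tfae_have 2 → 3 := fun h e heP he ε hε => by
    obtain ⟨b, hb, hbb, hosc, hd⟩ := h e heP he ε hε
    refine ⟨fun n => b n, hb, hbb, hosc, fun τ hτ => (hd τ hτ).trans_le ?_⟩
    gcongr with n
    exact τ.eval_le_dimFun (hb n).2.1 (hb n).2.2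
  tfae_have 3 → 1 := fun h a haP ha => elementTAOZ_of_exhaustion hsimple haP ha (h a haP ha)
  tfae_finish
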